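/- Let $0<H<1$ and let $B_H=(B_H(t))_{t\in\mathbb R}$ be a (standard, two-sided) fractional Brownian motion with Hurst exponent $H$. Let $\psi\in L^2(\mathbb R)$ be a real wavelet, i.e. $\psi$ is not a.e. zero, $\psi$ and $|t|^H\psi(t)$ are integrable, and $\int\psi=0$, and write $\psi_{jk}(t)=2^{j/2}\psi(2^j(t-k))$ for the atoms of the non-decimated wavelet transform. Fix $m\ge 2$ consecutive levels $j_0,j_0+1,\dots,j_0+m-1$ with $j_0\in\mathbb Z$. For each of these levels $j$ and each $k\in\{0,1,2,\dots\}$ let the coefficient $d_{j,k}$ be a random variable with the law of the wavelet coefficient $\int_{\mathbb R}B_H(t)\psi_{jk}(t)\,dt$, and suppose that all the $d_{j,k}$ are mutually independent (within and across levels). For $N\ge1$ let $\hat y_j^*$ be the sample median of $\log d_{j,0}^2,\dots,\log d_{j,N-1}^2$ (the average of the two middle order statistics if $N$ is even), let $\hat\beta$ be the slope of the ordinary least squares line through the $m$ points $(j,\hat y_j^*)$, and let $\widehat H_N=-\frac{\hat\beta}{2\log 2}-\frac12$ be the MEDL estimator. Put $Q=(\Phi^{-1}(3/4))^2$, where $\Phi$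 is the standard normal distribution function, and $A=\frac{\pi e^{Q}}{2Q}$. Then $\widehat H_N$ is asymptotically normal with mean $H$ and variance $\frac{3A}{N m(m^2-1)(\log 2)^2}$ as $N\to\infty$ with $m$ fixed, in the following sense: 1. for every $N\ge1$, $\widehat H_N$ is square-integrable and $\mathbb E\,\widehat H_N=H$; 2. $N\operatorname{Var}(\widehat H_N)\to\dfrac{3A}{m(m^2-1)(\log 2)^2}$ as $N\to\infty$; 3. $\sqrt N\,(\widehat H_N-H)$ converges in distribution to $\mathcal N\!\left(0,\dfrac{3A}{m(m^2-1)(\log 2)^2}\right)$ as $N\to\infty$. Moreover $A\approx 5.4418$, i.e. $|A-5.4418|<5\cdot10^{-5}$. -/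

import Mathlib

open MeasureTheory ProbabilityTheory Filter Topology

noncomputable section

/-- Two-sided (standard) fractional Brownian motion with Hurst exponent `H`: a centred Gaussian
process indexed by the real line, with the fractional covariance and almost surely continuous
paths. -/
structure IsFractionalBrownianMotion {Ω : Type*} [MeasurableSpace Ω] (B : ℝ → Ω → ℝ) (H : ℝ)
    (P : Measure Ω) : Prop where
  isGaussianProcess : IsGaussianProcess B P
  mean_eq_zero : ∀ t, ∫ ω, B t ω ∂P = 0
  covariance_eq : ∀ s t,
    cov[B s, B t; P] = (|s| ^ (2 * H) + |t| ^ (2 * H) - |s - t| ^ (2 * H)) / 2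
  continuous_paths : ∀ᵐ ω ∂P, Continuous fun t => B t ω

/-- A real wavelet: a nonzero square-integrable function with vanishing integral. The weighted
integrability makes the integral of a path of fractional Brownian motion with Hurst exponent `H`
against the wavelet absolutely convergent (almost surely). -/
structure IsWavelet (ψ : ℝ → ℝ) (H : ℝ) : Prop where
  memLp_two : MemLp ψ 2
  integrable : Integrable ψ
  integrable_weight : Integrable fun t => |t| ^ H * ψ t
  integral_eq_zero : ∫ t, ψ t = 0
  ne_zero : ¬ ψ =ᵐ[volume] 0

/-- The atom `ψ_{jk}(t) = 2^{j/2} ψ(2^j (t - k))` of the non-decimated wavelet transform. -/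
def ndwtAtom (ψ : ℝ → ℝ) (j k : ℤ) (t : ℝ) : ℝ :=
  (2 : ℝ) ^ ((j : ℝ) / 2) * ψ ((2 : ℝ) ^ j * (t - k))

/-- The detail coefficient `d_{jk} = ∫ B(t) ψ_{jk}(t) dt` of a random signal `B`. -/
def ndwtCoeff {Ω : Type*} (ψ : ℝ → ℝ) (B : ℝ → Ω → ℝ) (j k : ℤ) (ω : Ω) : ℝ :=
  ∫ t, B t ω * ndwtAtom ψ j k t

/-- The sample median of `N` reals: the middle order statistic for odd `N`, the average of the two
middle order statistics for even `N` (and `0` for the empty sample). -/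
def sampleMedian {N : ℕ} (x : Fin N → ℝ) : ℝ :=
  if h : 0 < N then
    (x (Tuple.sort x ⟨(N - 1) / 2, by omega⟩) + x (Tuple.sort x ⟨N / 2, by omega⟩)) / 2
  else 0

/-- The slope of the ordinary least squares line (with intercept) through the points
`(x i, y i)`. -/
def olsSlope {m : ℕ} (x y : Fin m → ℝ) : ℝ :=
  (∑ i, (x i - (∑ l, x l) / m) * (y i - (∑ l, y l) / m)) / ∑ i, (x i - (∑ l, x l) / m) ^ 2

/-- The MEDL estimator of the Hurst exponent from the `m` consecutive levels
`j₀, j₀ + 1, …, j₀ + m - 1`, using the first `N` coefficients `d i 0, …, d i (N - 1)` of the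
level `j₀ + i`: OLS regression of the level-wise sample median of `log d²` on the level, and the
slope `β` converted to `-β / (2 log 2) - 1 / 2`. -/
def medlEstimator (j₀ : ℤ) {m : ℕ} (N : ℕ) (d : Fin m → ℕ → ℝ) : ℝ :=
  -olsSlope (fun i : Fin m => (j₀ : ℝ) + (i : ℕ))
      (fun i : Fin m => sampleMedian fun k : Fin N => Real.log (d i k ^ 2)) / (2 * Real.log 2)
    - 1 / 2

/-- The quantile function `Φ⁻¹` of the standard normal distribution. -/
def stdNormalQuantile (p : ℝ) : ℝ :=
  sInf {x : ℝ | p ≤ cdf (gaussianReal 0 1) x}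

/-- `Q = (Φ⁻¹(3/4))²`. -/
def medlQ : ℝ := stdNormalQuantile (3 / 4) ^ 2

/-- `A = π e^Q / (2 Q)`. -/
def medlA : ℝ := Real.pi * Real.exp medlQ / (2 * medlQ)

end

/-!
Subtracting `H` turns the estimator into a fixed linear combination of `m` independent, identically
distributed sample medians, so everything reduces to the behaviour of one sample median.

*The coefficients.* A wavelet coefficient is the integral of fractional Brownian motion against an
atom; it is a limit of finite linear combinations of values of the process, hence centred Gaussian
(`map_integral_fbm`). Since the atom has mean zero, the identity
`∫₀^∞ (1 - cos (a ξ)) ξ ^ (-1 - 2 H) dξ = C |a| ^ (2 H)` turns its variance into the spectral integral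
`(2 C)⁻¹ ∫₀^∞ |φ̂(ξ)|² ξ ^ (-1 - 2 H) dξ` (`variance_eq_spectral`). This form shows at once that the
variance is positive for a nonzero wavelet (`integral_spectral_pos`), that it does not depend on the
translation, and that at level `j` it is `2 ^ (-(2 H + 1) j)` times the variance at level `0`
(`map_ndwtCoeff`).

*Reduction to medians.* Hence `log d²` at level `j` is `log Z²`, with `Z` standard normal, plus a
constant which is affine in `j` with slope `-(2 H + 1) log 2`. The sample median commutes with
translations, least squares reproduces affine functions, and the least squares weights sum to zero,
so `√N (Ĥ - H)` is a linear combination, with weights `medlWeight`, of the rescaled medians of `m`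
independent samples of `log Z²` (`exists_medlError_eq`). These have a common mean, which the weights
cancel: the estimator is exactly unbiased, and the sum of the squared weights,
`3 / (m (m² - 1) (log 2)²)`, is the factor in the asymptotic variance.

*One sample median.* The median exceeds a level exactly when a majority of the observations does, up
to ties when the sample size is even. A binomial central limit theorem at a level moving at speed
`1 / √N` gives the limit of the tail probabilities of the rescaled median, for both the weak and the
strict majority (`tendsto_prob_lt_scaledMedian`), and Chernoff's bound dominates these tails by an
exponential uniformly in `N` (`abs_signedTail_scaledMedian_le`). Writing `𝔼 g(T)` as an integral of
`g'` against the tails of `T`, dominated convergence yields the convergence of `𝔼 g(T)` for every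
`g` whose derivative grows at most linearly (`scaledMedian_expectations`). The choices `g(x) = x`,
`x²` and `e ^ (i u x)` give moments and characteristic functions, hence both the limit of the
variances and the convergence in law.

*The constant.* The asymptotic variance of a median is `1 / (4 f²)`, where `f` is the density at the
median; for `log Z²` the median is `log Q` and this value is `A`
(`one_div_four_mul_logChiDensity_sq`). The numerical value follows from Taylor bounds enclosing the
upper quartile of the normal distribution (`stdNormalQuantile_spec`).
-/

noncomputable section

/-! ### Order statistics and the sample median -/

/-- An order statistic lies below a level exactly when enough observations do. -/
theorem orderStat_le_iff {N : ℕ} (x : Fin N → ℝ) (r : Fin N) (y : ℝ) :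
    x (Tuple.sort x r) ≤ y ↔ (r : ℕ) < (Finset.univ.filter fun k => x k ≤ y).card := by
  rw [← Function.comp_apply (f := x), ← Tuple.lt_card_le_iff_apply_le_of_monotone
    (Tuple.monotone_sort x)]
  have : (Finset.univ.filter fun k => (x ∘ Tuple.sort x) k ≤ y).card
      = (Finset.univ.filter fun k => x k ≤ y).card := by
    refine Finset.card_bij (fun k _ => Tuple.sort x k) (by simp) (by simp) ?_
    intro b hb
    exact ⟨(Tuple.sort x).symm b, by simpa using hb, by simp⟩
  rw [this]

theorem sampleMedian_add_const {N : ℕ} (hN : 0 < N) (x : Fin N → ℝ) (c : ℝ) :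
    sampleMedian (fun k => x k + c) = sampleMedian x + c := by
  have h : (fun k => x k + c) ∘ Tuple.sort (fun k => x k + c)
      = (fun k => x k + c) ∘ Tuple.sort x := by
    refine ((Tuple.comp_sort_eq_comp_iff_monotone).2 ?_).symm
    intro a b hab
    simpa using Tuple.monotone_sort x hab
  have h' := fun r => congrFun h r
  simp only [Function.comp_apply] at h'
  simp only [sampleMedian, hN, dite_true, h']
  ring

theorem measurable_orderStat {N : ℕ} (r : Fin N) :
    Measurable fun x : Fin N → ℝ => x (Tuple.sort x r) := by
  refine measurable_of_Iic fun y => ?_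
  have hm : Measurable fun x : Fin N → ℝ => ∑ k, if x k ≤ y then 1 else 0 := by
    refine Finset.measurable_sum _ fun k _ => Measurable.ite ?_ measurable_const measurable_const
    exact measurableSet_le (measurable_pi_apply k) measurable_const
  have : (fun x : Fin N → ℝ => x (Tuple.sort x r)) ⁻¹' Set.Iic y
      = (fun x : Fin N → ℝ => ∑ k, if x k ≤ y then 1 else 0) ⁻¹' Set.Ioi (r : ℕ) := by
    ext x
    simp [orderStat_le_iff]
  rw [this]
  exact hm measurableSet_Ioi

theorem measurable_sampleMedian {N : ℕ} :
    Measurable (sampleMedian : (Fin N → ℝ) → ℝ) := by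
  unfold sampleMedian
  split_ifs with h
  · exact ((measurable_orderStat _).add (measurable_orderStat _)).div_const 2
  · exact measurable_const

/-- The number of observations above `y` minus the number of the others. -/
def signCount {N : ℕ} (x : Fin N → ℝ) (y : ℝ) : ℝ := ∑ k, if y < x k then 1 else -1

theorem signCount_eq {N : ℕ} (x : Fin N → ℝ) (y : ℝ) :
    signCount x y = N - 2 * ((Finset.univ.filter fun k => x k ≤ y).card : ℝ) := by
  have h : ∀ k, (if y < x k then (1 : ℝ) else -1) = 1 - 2 * (if x k ≤ y then 1 else 0) := by
    intro k
    by_cases hk : y < x k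
    · simp [hk, not_le.2 hk]
    · simp [hk, not_lt.1 hk]; norm_num
  simp only [signCount, h, Finset.sum_sub_distrib, ← Finset.mul_sum]
  simp

/-- For even sample sizes the median averages two order statistics, so a median above `y` only
forces the larger one above `y`: the majority need not be strict. -/
theorem signCount_nonneg_of_lt_sampleMedian {N : ℕ} (hN : 0 < N) {x : Fin N → ℝ} {y : ℝ}
    (h : y < sampleMedian x) : 0 ≤ signCount x y := by
  simp only [sampleMedian, hN, dite_true] at h
  have hmono : x (Tuple.sort x ⟨(N - 1) / 2, by omega⟩) ≤ x (Tuple.sort x ⟨N / 2, by omega⟩) :=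
    Tuple.monotone_sort x (by simp only [Fin.mk_le_mk]; omega)
  have h2 : ¬ x (Tuple.sort x ⟨N / 2, by omega⟩) ≤ y := by
    intro h3; linarith
  rw [orderStat_le_iff] at h2
  simp only [not_lt] at h2
  rw [signCount_eq]
  have : 2 * (Finset.univ.filter fun k => x k ≤ y).card ≤ N := by omega
  have : 2 * ((Finset.univ.filter fun k => x k ≤ y).card : ℝ) ≤ N := by exact_mod_cast this
  linarith

theorem lt_sampleMedian_of_signCount_pos {N : ℕ} (hN : 0 < N) {x : Fin N → ℝ} {y : ℝ}
    (h : 0 < signCount x y) : y < sampleMedian x := by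
  rw [signCount_eq] at h
  have h1 : 2 * ((Finset.univ.filter fun k => x k ≤ y).card : ℝ) < N := by linarith
  have h1 : 2 * (Finset.univ.filter fun k => x k ≤ y).card < N := by exact_mod_cast h1
  have hmono : x (Tuple.sort x ⟨(N - 1) / 2, by omega⟩) ≤ x (Tuple.sort x ⟨N / 2, by omega⟩) :=
    Tuple.monotone_sort x (by simp only [Fin.mk_le_mk]; omega)
  have h2 : ¬ x (Tuple.sort x ⟨(N - 1) / 2, by omega⟩) ≤ y := by
    rw [orderStat_le_iff]
    simp only [not_lt]
    omega
  simp only [sampleMedian, hN, dite_true]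
  linarith

/-! ### Least squares on equally spaced levels -/

/-- The weight with which the response at the `i`-th of `m` consecutive levels enters the least
squares slope. -/
def olsWeight (m : ℕ) (i : Fin m) : ℝ :=
  12 * ((i : ℕ) - ((m : ℝ) - 1) / 2) / (m * ((m : ℝ) ^ 2 - 1))

theorem sum_fin_val (m : ℕ) : ∑ i : Fin m, ((i : ℕ) : ℝ) = m * (m - 1) / 2 := by
  rw [Fin.sum_univ_eq_sum_range (fun i => (i : ℝ))]
  induction m with
  | zero => simp
  | succ n ih => rw [Finset.sum_range_succ, ih]; push_cast; ring

theorem sum_fin_sub_mean_sq (m : ℕ) :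
    ∑ i : Fin m, (((i : ℕ) : ℝ) - ((m : ℝ) - 1) / 2) ^ 2 = m * ((m : ℝ) ^ 2 - 1) / 12 := by
  have h : ∀ n : ℕ, ∑ i ∈ Finset.range n, (i : ℝ) ^ 2 = n * (n - 1) * (2 * n - 1) / 6 := by
    intro n
    induction n with
    | zero => simp
    | succ n ih => rw [Finset.sum_range_succ, ih]; push_cast; ring
  have h2 : ∑ i : Fin m, ((i : ℕ) : ℝ) ^ 2 = m * (m - 1) * (2 * m - 1) / 6 := by
    rw [Fin.sum_univ_eq_sum_range (fun i => (i : ℝ) ^ 2), h]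
  simp only [sub_sq, Finset.sum_add_distrib, Finset.sum_sub_distrib, h2, ← Finset.sum_mul,
    ← Finset.mul_sum, sum_fin_val]
  simp
  ring

theorem levels_norm_pos {m : ℕ} (hm : 2 ≤ m) : (0 : ℝ) < m * ((m : ℝ) ^ 2 - 1) := by
  have : (2 : ℝ) ≤ m := by exact_mod_cast hm
  have h2 : (0 : ℝ) < (m : ℝ) ^ 2 - 1 := by nlinarith
  positivity

theorem sum_fin_sub_mean (m : ℕ) :
    ∑ i : Fin m, (((i : ℕ) : ℝ) - ((m : ℝ) - 1) / 2) = 0 := by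
  simp only [Finset.sum_sub_distrib, sum_fin_val]
  simp
  ring

theorem sum_olsWeight (m : ℕ) : ∑ i, olsWeight m i = 0 := by
  simp only [olsWeight, ← Finset.sum_div, ← Finset.mul_sum, sum_fin_sub_mean]
  simp

theorem sum_olsWeight_sq {m : ℕ} (hm : 2 ≤ m) :
    ∑ i, olsWeight m i ^ 2 = 12 / (m * ((m : ℝ) ^ 2 - 1)) := by
  have := levels_norm_pos hm
  simp only [olsWeight, div_pow, mul_pow, ← Finset.sum_div, ← Finset.mul_sum, sum_fin_sub_mean_sq]
  field_simp

/-- Together with `sum_olsWeight`: least squares recovers the slope of an affine response. -/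
theorem sum_olsWeight_mul_level {m : ℕ} (hm : 2 ≤ m) :
    ∑ i, olsWeight m i * ((i : ℕ) : ℝ) = 1 := by
  have h0 := levels_norm_pos hm
  have : ∀ i : Fin m, olsWeight m i * ((i : ℕ) : ℝ)
      = 12 / (m * ((m : ℝ) ^ 2 - 1)) * (((i : ℕ) : ℝ) - ((m : ℝ) - 1) / 2) ^ 2
        + olsWeight m i * (((m : ℝ) - 1) / 2) := by
    intro i; simp only [olsWeight]; ring
  simp only [this, Finset.sum_add_distrib, ← Finset.mul_sum, ← Finset.sum_mul, sum_olsWeight,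
    sum_fin_sub_mean_sq]
  rw [zero_mul, add_zero]
  field_simp [h0.ne']
  have : (m : ℝ) ^ 2 - 1 ≠ 0 := (mul_ne_zero_iff.1 h0.ne').2
  field_simp

theorem olsSlope_levels {m : ℕ} (hm : 2 ≤ m) (a : ℝ) (y : Fin m → ℝ) :
    olsSlope (fun i : Fin m => a + (i : ℕ)) y = ∑ i, olsWeight m i * y i := by
  have h0 := levels_norm_pos hm
  have hm0 : (m : ℝ) ≠ 0 := by
    have : m ≠ 0 := by omega
    exact_mod_cast this
  have hx : ∀ i : Fin m, a + ((i : ℕ) : ℝ) - (∑ l : Fin m, (a + ((l : ℕ) : ℝ))) / m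
      = ((i : ℕ) : ℝ) - ((m : ℝ) - 1) / 2 := by
    intro i
    simp only [Finset.sum_add_distrib, sum_fin_val]
    simp
    field_simp
    ring
  have hy : ∀ c : ℝ, ∑ i : Fin m, (((i : ℕ) : ℝ) - ((m : ℝ) - 1) / 2) * (y i - c)
      = ∑ i : Fin m, (((i : ℕ) : ℝ) - ((m : ℝ) - 1) / 2) * y i := by
    intro c
    have e : ∀ i : Fin m, (((i : ℕ) : ℝ) - ((m : ℝ) - 1) / 2) * (y i - c)
        = (((i : ℕ) : ℝ) - ((m : ℝ) - 1) / 2) * y i - (((i : ℕ) : ℝ) - ((m : ℝ) - 1) / 2) * c :=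
      fun i => mul_sub _ _ _
    rw [Finset.sum_congr rfl fun i _ => e i, Finset.sum_sub_distrib, ← Finset.sum_mul,
      sum_fin_sub_mean, zero_mul, sub_zero]
  simp only [olsSlope, hx, sum_fin_sub_mean_sq, hy]
  rw [Finset.sum_div]
  refine Finset.sum_congr rfl fun i _ => ?_
  simp only [olsWeight]
  field_simp

/-- If the level variances decay like `2 ^ (-(2 H + 1) j)`, the estimator differs from `H` by a
linear combination of the medians of the standardized samples. -/
theorem medlEstimator_eq {m : ℕ} (hm : 2 ≤ m) (j₀ : ℤ) {N : ℕ} (H a : ℝ)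
    (d : Fin m → ℕ → ℝ) (w : Fin m → Fin N → ℝ) (μ : ℝ) (hN : 0 < N)
    (h : ∀ i (k : Fin N), Real.log (d i k ^ 2)
      = w i k + (a - (2 * H + 1) * Real.log 2 * (i : ℕ))) :
    medlEstimator j₀ N d - H
      = ∑ i, (-(olsWeight m i) / (2 * Real.log 2)) * (sampleMedian (w i) - μ) := by
  have hl : Real.log 2 ≠ 0 := (Real.log_pos one_lt_two).ne'
  simp only [medlEstimator]
  rw [olsSlope_levels hm]
  simp only [h, sampleMedian_add_const hN]
  have e : ∀ i, olsWeight m i * (sampleMedian (w i) + (a - (2 * H + 1) * Real.log 2 * (i : ℕ)))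
      = olsWeight m i * (sampleMedian (w i) - μ) + olsWeight m i * (a + μ)
        - (2 * H + 1) * Real.log 2 * (olsWeight m i * (i : ℕ)) := by
    intro i; ring
  simp only [e, Finset.sum_sub_distrib, Finset.sum_add_distrib, ← Finset.sum_mul, ← Finset.mul_sum,
    sum_olsWeight, sum_olsWeight_mul_level hm]
  have e2 : ∀ i, -(olsWeight m i) / (2 * Real.log 2) * (sampleMedian (w i) - μ)
      = -1 / (2 * Real.log 2) * (olsWeight m i * (sampleMedian (w i) - μ)) := by
    intro i; ring
  simp only [e2, ← Finset.mul_sum]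
  field_simp
  ring

/-! ### Counting observations above a level -/

theorem measurable_levelSign (y : ℝ) : Measurable fun x : ℝ => if y < x then (1 : ℝ) else -1 :=
  Measurable.ite measurableSet_Ioi measurable_const measurable_const

theorem measurable_signCount {N : ℕ} (y : ℝ) :
    Measurable fun x : Fin N → ℝ => signCount x y :=
  Finset.measurable_sum _ fun k _ => (measurable_levelSign y).comp (measurable_pi_apply k)

/-- Expectation of a function of the sign of `X - y`. -/
theorem integral_comp_levelSign {Ω E : Type*} [MeasurableSpace Ω] [NormedAddCommGroup E]
    [NormedSpace ℝ E] [CompleteSpace E] {P : Measure Ω} [IsProbabilityMeasure P] {X : Ω → ℝ}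
    (hX : Measurable X) (y : ℝ) (φ : ℝ → E) :
    ∫ ω, φ (if y < X ω then 1 else -1) ∂P
      = P.real {ω | y < X ω} • φ 1 + (1 - P.real {ω | y < X ω}) • φ (-1) := by
  have hs : MeasurableSet {ω | y < X ω} := measurableSet_lt measurable_const hX
  have e : (fun ω => φ (if y < X ω then 1 else -1))
      = fun ω => {ω | y < X ω}.indicator (fun _ => φ 1) ω
          + {ω | y < X ω}ᶜ.indicator (fun _ => φ (-1)) ω := by
    ext ω
    by_cases h : y < X ω <;> simp [Set.indicator, h]
  rw [e, integral_add ((integrable_const _).indicator hs) ((integrable_const _).indicator hs.compl),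
    integral_indicator_const _ hs, integral_indicator_const _ hs.compl,
    probReal_compl_eq_one_sub hs]

theorem iIndepFun_levelSign {Ω : Type*} [MeasurableSpace Ω] {P : Measure Ω} {X : ℕ → Ω → ℝ}
    (hind : iIndepFun X P) (N : ℕ) (y : ℝ) :
    iIndepFun (fun (k : Fin N) ω => if y < X k ω then (1 : ℝ) else -1) P :=
  (hind.precomp (g := fun k : Fin N => (k : ℕ)) Fin.val_injective).comp
    (fun _ x => if y < x then (1 : ℝ) else -1) fun _ => measurable_levelSign y

section Counting

variable {Ω : Type*} [MeasurableSpace Ω] {P : Measure Ω} [IsProbabilityMeasure P]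
  {X : ℕ → Ω → ℝ}

theorem mgf_signCount (hX : ∀ k, Measurable (X k)) (hind : iIndepFun X P) (N : ℕ) {y p : ℝ}
    (hp : ∀ k, P.real {ω | y < X k ω} = p) (t : ℝ) :
    mgf (fun ω => signCount (fun k : Fin N => X k ω) y) P t
      = (p * Real.exp t + (1 - p) * Real.exp (-t)) ^ N := by
  have h := (iIndepFun_levelSign hind N y).mgf_sum (t := t)
    (fun k => (measurable_levelSign y).comp (hX k)) Finset.univ
  have e : (fun ω => signCount (fun k : Fin N => X k ω) y)
      = ∑ k : Fin N, fun ω => if y < X k ω then (1 : ℝ) else -1 := by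
    ext ω; simp [signCount]
  rw [e, h]
  have : ∀ k : Fin N, mgf (fun ω => if y < X k ω then (1 : ℝ) else -1) P t
      = p * Real.exp t + (1 - p) * Real.exp (-t) := by
    intro k
    have := integral_comp_levelSign (P := P) (hX k) y (fun v => Real.exp (t * v))
    simp only [hp, smul_eq_mul, mul_one, mul_neg] at this
    simpa [mgf] using this
  simp [this]

theorem integrable_exp_signCount (hX : ∀ k, Measurable (X k)) (N : ℕ) (y t : ℝ) :
    Integrable (fun ω => Real.exp (t * signCount (fun k : Fin N => X k ω) y)) P := by
  refine Integrable.of_bound (C := Real.exp (|t| * N)) ?_ ?_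
  · refine (Real.measurable_exp.comp (measurable_const.mul ((measurable_signCount y).comp
      (measurable_pi_lambda _ fun k => hX _)))).aestronglyMeasurable
  · refine Eventually.of_forall fun ω => ?_
    rw [Real.norm_eq_abs, Real.abs_exp, Real.exp_le_exp]
    refine (le_abs_self _).trans ?_
    rw [abs_mul]
    gcongr
    refine (Finset.abs_sum_le_sum_abs _ _).trans ?_
    have : ∀ k : Fin N, |if y < X k ω then (1 : ℝ) else -1| = 1 := by
      intro k; split_ifs <;> simp
    simp [this]

/-- The optimal exponent in Chernoff's bound for `±1` trials is `log ((1 - q) / q) / 2`. -/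
theorem chernoff_value {q : ℝ} (hq0 : 0 < q) (hq : q ≤ 1 / 2) :
    q * Real.exp (Real.log ((1 - q) / q) / 2) + (1 - q) * Real.exp (-(Real.log ((1 - q) / q) / 2))
      = √(4 * q * (1 - q)) := by
  have h1 : 0 < (1 - q) / q := div_pos (by linarith) hq0
  have h1q : 0 < 1 - q := by linarith
  have e1 : Real.exp (Real.log ((1 - q) / q) / 2) = √(1 - q) / √q := by
    rw [Real.exp_half, Real.exp_log h1, Real.sqrt_div h1q.le]
  rw [Real.exp_neg, e1]
  have e2 : √(4 * q * (1 - q)) = 2 * (√q * √(1 - q)) := by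
    rw [mul_assoc, Real.sqrt_mul (by norm_num), Real.sqrt_mul hq0.le]
    congr 1
    rw [show (4 : ℝ) = 2 ^ 2 by norm_num, Real.sqrt_sq (by norm_num)]
  rw [e2]
  have a := Real.sqrt_pos.2 hq0
  have b := Real.sqrt_pos.2 h1q
  have a2 := Real.sq_sqrt hq0.le
  have b2 := Real.sq_sqrt h1q.le
  field_simp
  rw [a2, b2]
  ring

/-- Chernoff's bound for the probability of a weak majority above `y`, when each observation exceeds
`y` with probability at most `q ≤ 1 / 2`. -/
theorem chernoff_signCount_nonneg (hX : ∀ k, Measurable (X k)) (hind : iIndepFun X P) (N : ℕ)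
    {y p q : ℝ} (hp : ∀ k, P.real {ω | y < X k ω} = p) (hpq : p ≤ q) (hq0 : 0 < q)
    (hq : q ≤ 1 / 2) :
    P.real {ω | 0 ≤ signCount (fun k : Fin N => X k ω) y} ≤ √(4 * q * (1 - q)) ^ N := by
  set t := Real.log ((1 - q) / q) / 2 with ht
  have ht0 : 0 ≤ t := by
    have : 1 ≤ (1 - q) / q := by rw [le_div_iff₀ hq0]; linarith
    have := Real.log_nonneg this
    positivity
  have h := measure_ge_le_exp_mul_mgf (μ := P)
    (X := fun ω => signCount (fun k : Fin N => X k ω) y) 0 ht0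
    (integrable_exp_signCount hX N y t)
  rw [mgf_signCount hX hind N hp] at h
  refine h.trans ?_
  have p0 : 0 ≤ p := by rw [← hp 0]; exact measureReal_nonneg
  have e : Real.exp (-t) ≤ Real.exp t := Real.exp_le_exp.2 (by linarith)
  rw [← chernoff_value hq0 hq, ← ht]
  simp only [mul_zero, Real.exp_zero, one_mul]
  have : 0 < Real.exp (-t) := Real.exp_pos _
  have h1p : 0 ≤ 1 - p := by linarith
  have : 0 < Real.exp t := Real.exp_pos _
  refine pow_le_pow_left₀ (by positivity) ?_ N
  nlinarith

/-- The mirror image of `chernoff_signCount_nonneg`. -/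
theorem chernoff_signCount_nonpos (hX : ∀ k, Measurable (X k)) (hind : iIndepFun X P) (N : ℕ)
    {y p q : ℝ} (hp : ∀ k, P.real {ω | y < X k ω} = p) (hpq : 1 - p ≤ q) (hq0 : 0 < q)
    (hq : q ≤ 1 / 2) :
    P.real {ω | signCount (fun k : Fin N => X k ω) y ≤ 0} ≤ √(4 * q * (1 - q)) ^ N := by
  set t := Real.log ((1 - q) / q) / 2 with ht
  have ht0 : 0 ≤ t := by
    have : 1 ≤ (1 - q) / q := by rw [le_div_iff₀ hq0]; linarith
    have := Real.log_nonneg this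
    positivity
  have h := measure_le_le_exp_mul_mgf (μ := P)
    (X := fun ω => signCount (fun k : Fin N => X k ω) y) 0 (neg_nonpos.2 ht0)
    (integrable_exp_signCount hX N y (-t))
  rw [mgf_signCount hX hind N hp] at h
  refine h.trans ?_
  have p1 : p ≤ 1 := by rw [← hp 0]; exact measureReal_le_one
  have e : Real.exp (-t) ≤ Real.exp t := Real.exp_le_exp.2 (by linarith)
  rw [← chernoff_value hq0 hq, ← ht]
  simp only [mul_zero, Real.exp_zero, one_mul, neg_neg]
  have : 0 < Real.exp (-t) := Real.exp_pos _
  have h1p : 0 ≤ 1 - p := by linarith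
  have hp0 : 0 ≤ p := by linarith
  have : 0 < Real.exp t := Real.exp_pos _
  refine pow_le_pow_left₀ (by positivity) ?_ N
  nlinarith

theorem charFun_signCount (hX : ∀ k, Measurable (X k)) (hind : iIndepFun X P) (N : ℕ) {y p : ℝ}
    (hp : ∀ k, P.real {ω | y < X k ω} = p) (c u : ℝ) :
    charFun (P.map fun ω => c * signCount (fun k : Fin N => X k ω) y) u
      = (Complex.cos (u * c) + (2 * p - 1) * Complex.sin (u * c) * Complex.I) ^ N := by
  have hS : Measurable fun ω => signCount (fun k : Fin N => X k ω) y :=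
    (measurable_signCount y).comp (measurable_pi_lambda _ fun k => hX _)
  have hm : (P.map fun ω => c * signCount (fun k : Fin N => X k ω) y)
      = (P.map fun ω => signCount (fun k : Fin N => X k ω) y).map (c * ·) := by
    rw [Measure.map_map (measurable_const_mul c) hS]; rfl
  rw [hm, charFun_map_mul]
  have h := (iIndepFun_levelSign hind N y).charFun_map_fun_sum_eq_prod
    (fun k : Fin N => ((measurable_levelSign y).comp (hX k)).aemeasurable)
  change charFun (P.map fun ω => signCount (fun k : Fin N => X k ω) y)
    = ∏ k : Fin N, charFun (P.map fun ω => if y < X k ω then (1 : ℝ) else -1) at h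
  rw [h, Finset.prod_apply]
  have : ∀ k : Fin N, charFun (P.map fun ω => if y < X k ω then (1 : ℝ) else -1) (c * u)
      = Complex.cos (u * c) + (2 * p - 1) * Complex.sin (u * c) * Complex.I := by
    intro k
    have hm : AEMeasurable (fun ω => if y < X k ω then (1 : ℝ) else -1) P :=
      ((measurable_levelSign y).comp (hX k)).aemeasurable
    rw [charFun_apply_real, integral_map hm (by fun_prop)]
    have := integral_comp_levelSign (P := P) (hX k) y
      (fun v : ℝ => Complex.exp ((c * u : ℝ) * v * Complex.I))
    rw [hp] at this
    rw [this]
    have e1 : Complex.exp (((c * u : ℝ) : ℂ) * ((1 : ℝ) : ℂ) * Complex.I)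
        = Complex.cos (u * c) + Complex.sin (u * c) * Complex.I := by
      rw [← Complex.exp_mul_I]; congr 1; push_cast; ring
    have e2 : Complex.exp (((c * u : ℝ) : ℂ) * ((-1 : ℝ) : ℂ) * Complex.I)
        = Complex.cos (u * c) - Complex.sin (u * c) * Complex.I := by
      rw [show (((c * u : ℝ) : ℂ) * ((-1 : ℝ) : ℂ) * Complex.I)
        = (-(u * c : ℂ)) * Complex.I by push_cast; ring, Complex.exp_mul_I]
      simp [sub_eq_add_neg]
    rw [e1, e2]
    simp only [Complex.real_smul]
    push_cast
    ring
  simp [this]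

end Counting

/-- If `√N (2 p_N - 1) → δ`, the characteristic functions of the centred and scaled sign counts
converge to that of `N(δ, 1)`. -/
theorem tendsto_charFun_binomial {p : ℕ → ℝ} {δ : ℝ}
    (hp : Tendsto (fun N : ℕ => √(N : ℝ) * (2 * p N - 1)) atTop (𝓝 δ)) (u : ℝ) :
    Tendsto (fun N : ℕ => (Complex.cos (u * ((√(N : ℝ))⁻¹ : ℝ))
        + (2 * (p N : ℝ) - 1) * Complex.sin (u * ((√(N : ℝ))⁻¹ : ℝ)) * Complex.I) ^ N) atTop
      (𝓝 (charFun (gaussianReal δ 1) u)) := by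
  set ε : ℕ → ℝ := fun N => (√(N : ℝ))⁻¹ with hε
  have hε0 : Tendsto ε atTop (𝓝 0) := tendsto_inv_atTop_zero.comp
    (Real.tendsto_sqrt_atTop.comp tendsto_natCast_atTop_atTop)
  have hs : ∀ c : ℝ, Tendsto (fun N => c * Real.sinc (c * ε N)) atTop (𝓝 c) := by
    intro c
    have h1 : Tendsto (fun N => c * ε N) atTop (𝓝 0) := by simpa using hε0.const_mul c
    have := ((Real.continuous_sinc.tendsto 0).comp h1).const_mul c
    simpa using this
  have key : Tendsto (fun N => -2 * ((u / 2) * Real.sinc ((u / 2) * ε N)) ^ 2) atTop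
      (𝓝 (-2 * (u / 2) ^ 2)) := ((hs (u / 2)).pow 2).const_mul (-2)
  have key2 : Tendsto (fun N : ℕ => (√(N : ℝ) * (2 * p N - 1)) * (u * Real.sinc (u * ε N))) atTop
      (𝓝 (δ * u)) := hp.mul (hs u)
  have hlim : Tendsto (fun N : ℕ => (N : ℂ) * ((Complex.cos (u * (ε N : ℝ)) - 1)
      + (2 * p N - 1) * Complex.sin (u * (ε N : ℝ)) * Complex.I)) atTop
      (𝓝 (((-2 * (u / 2) ^ 2 : ℝ) : ℂ) + ((δ * u : ℝ) : ℂ) * Complex.I)) := by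
    have hc := ((Complex.continuous_ofReal.tendsto _).comp key).add
      (((Complex.continuous_ofReal.tendsto _).comp key2).mul_const Complex.I)
    refine hc.congr' ?_
    filter_upwards [eventually_gt_atTop 0] with N hN
    have hN' : (0 : ℝ) < N := by exact_mod_cast hN
    have hsq : 0 < √(N : ℝ) := Real.sqrt_pos.2 hN'
    have hεN : ε N ≠ 0 := (inv_pos.2 hsq).ne'
    have hNε : (N : ℝ) * ε N ^ 2 = 1 := by
      simp only [hε, inv_pow, Real.sq_sqrt hN'.le]; field_simp
    have hsε : √(N : ℝ) * ε N = 1 := by simp only [hε]; field_simp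
    have hsinc : ∀ c : ℝ, c * Real.sinc (c * ε N) * ε N = Real.sin (c * ε N) := by
      intro c
      by_cases hc : c = 0
      · simp [hc]
      · rw [Real.sinc_of_ne_zero (mul_ne_zero hc hεN)]
        field_simp
    -- half-angle form, so that only the limit of `sinc` at `0` is needed
    have c1 : (N : ℝ) * (Real.cos (u * ε N) - 1)
        = -2 * ((u / 2) * Real.sinc ((u / 2) * ε N)) ^ 2 := by
      have : Real.cos (u * ε N) = 1 - 2 * Real.sin (u / 2 * ε N) ^ 2 := by
        rw [show u * ε N = 2 * (u / 2 * ε N) by ring, Real.cos_two_mul, Real.cos_sq']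
        ring
      rw [this, ← hsinc (u / 2)]
      linear_combination (-2 * ((u / 2) * Real.sinc ((u / 2) * ε N)) ^ 2) * hNε
    have c2 : (N : ℝ) * ((2 * p N - 1) * Real.sin (u * ε N))
        = (√(N : ℝ) * (2 * p N - 1)) * (u * Real.sinc (u * ε N)) := by
      rw [← hsinc u]
      have : (N : ℝ) * ε N = √(N : ℝ) := by
        simp only [hε]
        rw [← div_eq_mul_inv, Real.div_sqrt]
      linear_combination ((2 * p N - 1) * u * Real.sinc (u * ε N)) * this
    simp only [Function.comp_apply]
    rw [← c1, ← c2]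
    push_cast
    ring
  have := Complex.tendsto_one_add_pow_exp_of_tendsto hlim
  rw [charFun_gaussianReal]
  have e : Complex.exp (((-2 * (u / 2) ^ 2 : ℝ) : ℂ) + ((δ * u : ℝ) : ℂ) * Complex.I)
      = Complex.exp (u * δ * Complex.I - ((1 : NNReal) : ℝ) * u ^ 2 / 2) := by
    congr 1; push_cast; ring
  rw [← e]
  refine this.congr fun N => ?_
  ring

section CLT

variable {Ω : Type*} [MeasurableSpace Ω] {P : Measure Ω} [IsProbabilityMeasure P]
  {X : ℕ → Ω → ℝ}

/-- Central limit theorem for the number of observations above a moving level, in the form needed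
for medians: both the weak and the strict majority have asymptotically Gaussian probability. -/
theorem tendsto_prob_signCount (hX : ∀ k, Measurable (X k)) (hind : iIndepFun X P)
    {y p : ℕ → ℝ} (hp : ∀ N k, P.real {ω | y N < X k ω} = p N) {δ : ℝ}
    (hδ : Tendsto (fun N : ℕ => √(N : ℝ) * (2 * p N - 1)) atTop (𝓝 δ)) :
    Tendsto (fun N : ℕ => P.real {ω | 0 < signCount (fun k : Fin N => X k ω) (y N)}) atTop
        (𝓝 ((gaussianReal δ 1).real (Set.Ioi 0))) ∧
      Tendsto (fun N : ℕ => P.real {ω | 0 ≤ signCount (fun k : Fin N => X k ω) (y N)}) atTop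
        (𝓝 ((gaussianReal δ 1).real (Set.Ioi 0))) := by
  have hS : ∀ N : ℕ, Measurable fun ω =>
      (√(N : ℝ))⁻¹ * signCount (fun k : Fin N => X k ω) (y N) := fun N =>
    measurable_const.mul ((measurable_signCount _).comp (measurable_pi_lambda _ fun k => hX _))
  let ρ : ℕ → ProbabilityMeasure ℝ := fun N =>
    ⟨P.map fun ω => (√(N : ℝ))⁻¹ * signCount (fun k : Fin N => X k ω) (y N),
      Measure.isProbabilityMeasure_map (hS N).aemeasurable⟩
  let γ : ProbabilityMeasure ℝ := ⟨gaussianReal δ 1, inferInstance⟩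
  have hρ : Tendsto ρ atTop (𝓝 γ) := by
    refine ProbabilityMeasure.tendsto_iff_tendsto_charFun.2 fun u => ?_
    refine (tendsto_charFun_binomial hδ u).congr fun N => ?_
    exact (charFun_signCount hX hind N (hp N) _ u).symm
  have : NullSingletonClass (gaussianReal δ 1) :=
    nullSingletonClass_gaussianReal one_ne_zero
  have h0 : gaussianReal δ 1 {0} = 0 := measure_singleton 0
  have hIci : (gaussianReal δ 1).real (Set.Ici 0) = (gaussianReal δ 1).real (Set.Ioi 0) :=
    measureReal_congr Ioi_ae_eq_Ici.symm
  have h1 := ProbabilityMeasure.tendsto_measure_of_null_frontier_of_tendsto' hρ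
    (E := Set.Ioi 0) (by rw [frontier_Ioi]; exact h0)
  have h2 := ProbabilityMeasure.tendsto_measure_of_null_frontier_of_tendsto' hρ
    (E := Set.Ici 0) (by rw [frontier_Ici]; exact h0)
  have h1' := (ENNReal.tendsto_toReal (measure_ne_top _ _)).comp h1
  have h2' := (ENNReal.tendsto_toReal (measure_ne_top _ _)).comp h2
  constructor
  · refine h1'.congr' ?_
    filter_upwards [eventually_gt_atTop 0] with N hN
    have hsq : 0 < (√(N : ℝ))⁻¹ := inv_pos.2 (Real.sqrt_pos.2 (by exact_mod_cast hN))
    simp only [ρ, Function.comp_apply, ProbabilityMeasure.coe_mk, Measure.real]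
    rw [Measure.map_apply (hS N) measurableSet_Ioi]
    congr 2
    ext ω
    simp [hsq]
  · rw [← hIci]
    refine h2'.congr' ?_
    filter_upwards [eventually_gt_atTop 0] with N hN
    have hsq : 0 < (√(N : ℝ))⁻¹ := inv_pos.2 (Real.sqrt_pos.2 (by exact_mod_cast hN))
    simp only [ρ, Function.comp_apply, ProbabilityMeasure.coe_mk, Measure.real]
    rw [Measure.map_apply (hS N) measurableSet_Ici]
    congr 2
    ext ω
    simp only [Set.mem_preimage, Set.mem_Ici, Set.mem_ofPred_eq]
    exact mul_nonneg_iff_of_pos_left hsq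

end CLT

/-! ### Expectations from tail probabilities -/

/-- The signed tail function of a real random variable: the upper tail on the positive half-line,
minus the lower tail on the negative one. It carries the whole distribution, since
`𝔼 g(T) - g(0) = ∫ g' · signedTail`. -/
def signedTail {Ω : Type*} [MeasurableSpace Ω] (P : Measure Ω) (T : Ω → ℝ) (x : ℝ) : ℝ :=
  if 0 < x then P.real {ω | x < T ω} else -P.real {ω | T ω ≤ x}

/-- The function `1_{0 < x < t} - 1_{t ≤ x ≤ 0}` of `x`, whose integral against `g'` is
`g t - g 0` and whose expectation for random `t` is the signed tail at `x`. -/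
def signedIndicator (t x : ℝ) : ℝ :=
  if 0 < x then (if x < t then 1 else 0) else (if t ≤ x then -1 else 0)

theorem measurable_signedIndicator : Measurable fun z : ℝ × ℝ => signedIndicator z.1 z.2 := by
  refine Measurable.ite (measurableSet_lt measurable_const measurable_snd) ?_ ?_
  · exact Measurable.ite (measurableSet_lt measurable_snd measurable_fst) measurable_const
      measurable_const
  · exact Measurable.ite (measurableSet_le measurable_fst measurable_snd) measurable_const
      measurable_const

theorem abs_signedIndicator_le (t x : ℝ) : |signedIndicator t x| ≤ 1 := by
  unfold signedIndicator; split_ifs <;> simp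

theorem integral_signedIndicator {Ω : Type*} [MeasurableSpace Ω] {P : Measure Ω}
    [IsProbabilityMeasure P] {T : Ω → ℝ} (hT : Measurable T) (x : ℝ) :
    ∫ ω, signedIndicator (T ω) x ∂P = signedTail P T x := by
  unfold signedIndicator signedTail
  split_ifs with hx
  · have : (fun ω => if x < T ω then (1 : ℝ) else 0) = {ω | x < T ω}.indicator fun _ => 1 := by
      ext ω; simp [Set.indicator]
    rw [this, integral_indicator_const _ (measurableSet_lt measurable_const hT)]
    simp
  · have : (fun ω => if T ω ≤ x then (-1 : ℝ) else 0) = {ω | T ω ≤ x}.indicator fun _ => -1 := by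
      ext ω; simp [Set.indicator]
    rw [this, integral_indicator_const _ (measurableSet_le hT measurable_const)]
    simp

theorem integral_abs_signedIndicator {Ω : Type*} [MeasurableSpace Ω] {P : Measure Ω}
    [IsProbabilityMeasure P] {T : Ω → ℝ} (hT : Measurable T) (x : ℝ) :
    ∫ ω, |signedIndicator (T ω) x| ∂P = |signedTail P T x| := by
  rw [← integral_signedIndicator hT]
  by_cases hx : 0 < x
  · have : ∀ t, 0 ≤ signedIndicator t x := by
      intro t; simp only [signedIndicator, hx, if_true]; split_ifs <;> simp
    rw [abs_of_nonneg (integral_nonneg fun ω => this _)]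
    exact integral_congr_ae (Eventually.of_forall fun ω => abs_of_nonneg (this _))
  · have : ∀ t, signedIndicator t x ≤ 0 := by
      intro t; simp only [signedIndicator, hx, if_false]; split_ifs <;> simp
    rw [abs_of_nonpos (integral_nonpos fun ω => this _), ← integral_neg]
    exact integral_congr_ae (Eventually.of_forall fun ω => abs_of_nonpos (this _))

theorem integral_signedIndicator_smul_deriv {E : Type*} [NormedAddCommGroup E] [NormedSpace ℝ E]
    [CompleteSpace E] {g g' : ℝ → E} (hg : ∀ x, HasDerivAt g (g' x) x) (hg' : Continuous g')
    (t : ℝ) : ∫ x, signedIndicator t x • g' x = g t - g 0 := by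
  rw [← intervalIntegral.integral_eq_sub_of_hasDerivAt (fun x _ => hg x)
    (hg'.intervalIntegrable _ _)]
  rcases le_total 0 t with ht | ht
  · rw [intervalIntegral.integral_of_le ht, integral_Ioc_eq_integral_Ioo,
      ← integral_indicator measurableSet_Ioo]
    have hne : ∀ᵐ x : ℝ, x ≠ 0 := by simp [ae_iff]
    refine integral_congr_ae ?_
    filter_upwards [hne] with x hx
    simp only [signedIndicator, Set.indicator, Set.mem_Ioo]
    by_cases h0 : 0 < x
    · by_cases h1 : x < t <;> simp [h0, h1]
    · have : x < 0 := lt_of_le_of_ne (not_lt.1 h0) hx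
      simp [h0, not_le.2 (this.trans_le ht)]
  · rw [intervalIntegral.integral_of_ge ht, ← integral_Icc_eq_integral_Ioc,
      ← integral_indicator measurableSet_Icc, ← integral_neg]
    congr 1
    ext x
    simp only [signedIndicator, Set.indicator, Set.mem_Icc]
    by_cases h0 : 0 < x
    · simp [h0, not_le.2 h0, not_lt.2 (ht.trans h0.le)]
    · by_cases h1 : t ≤ x <;> simp [h0, h1, not_lt.1 h0]

/-- Layer-cake formula for differentiable functions of a random variable with light tails. -/
theorem integrable_and_integral_eq_signedTail {Ω E : Type*} [MeasurableSpace Ω]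
    [NormedAddCommGroup E] [NormedSpace ℝ E] [CompleteSpace E] {P : Measure Ω}
    [IsProbabilityMeasure P] {T : Ω → ℝ} (hT : Measurable T) {b : ℝ → ℝ}
    (hb : Integrable fun x => (1 + |x|) * b x) (hTb : ∀ x, |signedTail P T x| ≤ b x)
    {g g' : ℝ → E} (hg : ∀ x, HasDerivAt g (g' x) x) (hg' : Continuous g') {C : ℝ}
    (hC : ∀ x, ‖g' x‖ ≤ C * (1 + |x|)) :
    Integrable (fun ω => g (T ω)) P ∧
      ∫ ω, g (T ω) ∂P = g 0 + ∫ x, signedTail P T x • g' x := by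
  set k : Ω × ℝ → E := fun z => signedIndicator (T z.1) z.2 • g' z.2 with hk
  have hind : Measurable fun z : Ω × ℝ => signedIndicator (T z.1) z.2 :=
    measurable_signedIndicator.comp ((hT.comp measurable_fst).prodMk measurable_snd)
  have hkm : AEStronglyMeasurable k (P.prod volume) :=
    hind.aestronglyMeasurable.smul
      (hg'.stronglyMeasurable.comp_measurable measurable_snd).aestronglyMeasurable
  have hkx : ∀ x, Integrable (fun ω => signedIndicator (T ω) x) P := fun x =>
    Integrable.of_bound (hind.comp measurable_prodMk_right).aestronglyMeasurable 1
      (Eventually.of_forall fun ω => by simpa using abs_signedIndicator_le (T ω) x)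
  have hnorm : ∀ x, ∫ ω, ‖k (ω, x)‖ ∂P = |signedTail P T x| * ‖g' x‖ := by
    intro x
    simp only [hk, norm_smul, Real.norm_eq_abs]
    rw [integral_mul_const, integral_abs_signedIndicator hT]
  have hki : Integrable k (P.prod volume) := by
    rw [integrable_prod_iff' hkm]
    refine ⟨Eventually.of_forall fun x => (hkx x).smul_const (g' x), ?_⟩
    refine Integrable.mono' (hb.const_mul C) ?_ (Eventually.of_forall fun x => ?_)
    · exact hkm.norm.prod_swap.integral_prod_right'
    · rw [hnorm, Real.norm_eq_abs, abs_mul, abs_abs, abs_norm]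
      calc |signedTail P T x| * ‖g' x‖ ≤ b x * (C * (1 + |x|)) :=
            mul_le_mul (hTb x) (hC x) (norm_nonneg _) ((abs_nonneg _).trans (hTb x))
        _ = C * ((1 + |x|) * b x) := by ring
  have hin : ∀ ω, ∫ x, k (ω, x) = g (T ω) - g 0 := fun ω =>
    integral_signedIndicator_smul_deriv hg hg' (T ω)
  have hgi : Integrable (fun ω => g (T ω) - g 0) P := by
    simpa only [hin] using hki.integral_prod_left
  have hgi' : Integrable (fun ω => g (T ω)) P := by
    refine (hgi.add (integrable_const (g 0))).congr (Eventually.of_forall fun ω => ?_)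
    simp
  refine ⟨hgi', ?_⟩
  have hswap := integral_integral_swap (f := fun ω x => k (ω, x)) hki
  simp only [hin] at hswap
  rw [integral_sub hgi' (integrable_const _)] at hswap
  simp only [integral_const, probReal_univ, one_smul] at hswap
  rw [sub_eq_iff_eq_add] at hswap
  rw [hswap, add_comm]
  congr 1
  refine integral_congr_ae (Eventually.of_forall fun x => ?_)
  simp only [hk]
  rw [integral_smul_const, integral_signedIndicator hT]

/-- Exponential decay beats the weight: compare with `1 / (1 + x ^ 2)` through `y ^ 3 / 6 ≤ exp y`. -/
theorem integrable_one_add_abs_mul_exp {c : ℝ} (hc : 0 < c) :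
    Integrable fun x : ℝ => (1 + |x|) * (2 * Real.exp (-(c * |x|))) := by
  refine Integrable.mono' (integrable_inv_one_add_sq.const_mul (12 / c ^ 3 * Real.exp c)) ?_ ?_
  · exact Continuous.aestronglyMeasurable (by fun_prop)
  · refine Eventually.of_forall fun x => ?_
    have h0 := abs_nonneg x
    rw [Real.norm_eq_abs, abs_of_nonneg (by positivity)]
    have h := Real.pow_div_factorial_le_exp (x := c * (1 + |x|)) (by positivity) 3
    rw [show c * (1 + |x|) = c + c * |x| by ring, Real.exp_add] at h
    have hx : x ^ 2 = |x| ^ 2 := (sq_abs x).symm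
    rw [Real.exp_neg, hx, mul_comm (12 / c ^ 3 * Real.exp c), ← div_eq_inv_mul,
      le_div_iff₀ (by positivity)]
    have hE : 0 < Real.exp (c * |x|) := Real.exp_pos _
    have h3 : (1 + |x|) * (1 + |x| ^ 2) ≤ (1 + |x|) ^ 3 := by nlinarith [pow_nonneg h0 2]
    have h4 : (1 + |x|) ^ 3 ≤ 6 / c ^ 3 * (Real.exp c * Real.exp (c * |x|)) := by
      rw [div_mul_eq_mul_div, le_div_iff₀ (by positivity)]
      have : (c + c * |x|) ^ 3 = (1 + |x|) ^ 3 * c ^ 3 := by ring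
      rw [this] at h
      norm_num [Nat.factorial] at h
      linarith
    calc (1 + |x|) * (2 * (Real.exp (c * |x|))⁻¹) * (1 + |x| ^ 2)
        = 2 * ((1 + |x|) * (1 + |x| ^ 2)) * (Real.exp (c * |x|))⁻¹ := by ring
      _ ≤ 2 * (6 / c ^ 3 * (Real.exp c * Real.exp (c * |x|))) * (Real.exp (c * |x|))⁻¹ := by
          refine mul_le_mul_of_nonneg_right ?_ (by positivity)
          exact mul_le_mul_of_nonneg_left (h3.trans h4) (by norm_num)
      _ = 12 / c ^ 3 * Real.exp c := by field_simp; ring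

/-! ### Asymptotics of the sample median -/

/-- Chernoff's bound for a majority of `N` trials whose success probability decays exponentially
in the distance `x / √N` from the median: it is uniformly exponentially small in `x`. -/
theorem chernoff_median_bound {a x : ℝ} (ha : 0 < a) (hx : 0 ≤ x) {N : ℕ} (hN : 0 < N) :
    √(4 * (1 / 2 * Real.exp (-(a * (x / √(N : ℝ)))))
        * (1 - 1 / 2 * Real.exp (-(a * (x / √(N : ℝ)))))) ^ N
      ≤ 2 * Real.exp (-(a / 8 * x)) := by
  have hN1 : (1 : ℝ) ≤ N := by exact_mod_cast hN
  have hs : 0 < √(N : ℝ) := Real.sqrt_pos.2 (by linarith)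
  have hs1 : 1 ≤ √(N : ℝ) := by rw [← Real.sqrt_one]; exact Real.sqrt_le_sqrt hN1
  set v := a * (x / √(N : ℝ)) with hv
  have hv0 : 0 ≤ v := by positivity
  have hvs : v * √(N : ℝ) = a * x := by rw [hv]; field_simp
  have hNs : √(N : ℝ) ^ 2 = N := Real.sq_sqrt (by linarith)
  -- for small `v` the exponent is quadratic, `N v ^ 2 = (a x) ^ 2`; for large `v` it is linear,
  -- `N v = √N a x`; both dominate `a x - 1 / 4`
  have hNv : a * x - 1 / 4 ≤ N * min (v ^ 2) v := by
    rcases min_choice (v ^ 2) v with h | h <;> rw [h]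
    · have : N * v ^ 2 = (a * x) ^ 2 := by
        rw [← hvs]; linear_combination (-v ^ 2) * hNs
      nlinarith [sq_nonneg (a * x - 1 / 2)]
    · rw [← hNs]
      nlinarith [mul_nonneg ha.le hx]
  have hq : 4 * (1 / 2 * Real.exp (-v)) * (1 - 1 / 2 * Real.exp (-v))
      ≤ Real.exp (-(min (v ^ 2) v / 4)) := by
    have hu0 := Real.exp_pos (-v)
    rcases le_total v 1 with h1 | h1
    · have hu : Real.exp (-v) ≤ 1 - v / 2 := by
        have h2 := Real.add_one_le_exp v
        have h3 : Real.exp (-v) * Real.exp v = 1 := by rw [← Real.exp_add]; simp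
        have h4 : Real.exp (-v) * (v + 1) ≤ 1 := by
          have := mul_le_mul_of_nonneg_left h2 hu0.le
          rwa [h3] at this
        by_contra hc
        nlinarith [mul_lt_mul_of_pos_right (not_le.1 hc) (show 0 < v + 1 by linarith)]
      have hmin : min (v ^ 2) v = v ^ 2 := min_eq_left (by nlinarith)
      rw [hmin]
      have := Real.add_one_le_exp (-(v ^ 2 / 4))
      nlinarith
    · have hmin : min (v ^ 2) v = v := min_eq_right (by nlinarith)
      rw [hmin]
      have h2 : 1 + v ≤ Real.exp (3 * v / 4) := by
        have := Real.quadratic_le_exp_of_nonneg (x := 3 * v / 4) (by positivity)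
        nlinarith
      have h3 := Real.add_one_le_exp (-v)
      have h4 : Real.exp (-(v / 4)) = Real.exp (3 * v / 4) * Real.exp (-v) := by
        rw [← Real.exp_add]; congr 1; ring
      rw [h4]
      nlinarith
  calc √(4 * (1 / 2 * Real.exp (-v)) * (1 - 1 / 2 * Real.exp (-v))) ^ N
      ≤ √(Real.exp (-(min (v ^ 2) v / 4))) ^ N := by gcongr
    _ = Real.exp (-(N * min (v ^ 2) v / 8)) := by
        rw [← Real.exp_half, ← Real.exp_nat_mul]; congr 1; ring
    _ ≤ Real.exp (1 / 32 + -(a / 8 * x)) := by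
        rw [Real.exp_le_exp]; linarith
    _ ≤ 2 * Real.exp (-(a / 8 * x)) := by
        rw [Real.exp_add]
        gcongr
        have := Real.abs_exp_sub_one_le (x := 1 / 32) (by rw [abs_of_pos] <;> norm_num)
        have := (abs_le.1 this).2
        rw [abs_of_pos (by norm_num)] at this
        linarith

/-- Shifting the mean of a unit Gaussian is the same as moving the level of the rescaled one. -/
theorem gaussianReal_shift_Ioi {f : ℝ} (hf : 0 < f) (x : ℝ) :
    (gaussianReal (-(2 * f * x)) 1).real (Set.Ioi 0)
      = (gaussianReal 0 (Real.toNNReal (1 / (4 * f ^ 2)))).real (Set.Ioi x) := by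
  have h1 : gaussianReal (-(2 * f * x)) 1
      = (gaussianReal 0 1).map (fun y => y + -(2 * f * x)) := by
    rw [gaussianReal_map_add_const, zero_add]
  have h2 : gaussianReal 0 (Real.toNNReal (1 / (4 * f ^ 2)))
      = (gaussianReal 0 1).map (fun y => 1 / (2 * f) * y) := by
    rw [gaussianReal_map_const_mul, mul_zero, mul_one]
    congr 1
    ext
    rw [Real.coe_toNNReal _ (by positivity)]
    simp only [NNReal.coe_mk]
    field_simp
    norm_num
  rw [h1, h2, measureReal_def, measureReal_def, Measure.map_apply (by fun_prop) measurableSet_Ioi,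
    Measure.map_apply (by fun_prop) measurableSet_Ioi]
  congr 2
  ext y
  simp only [Set.mem_preimage, Set.mem_Ioi]
  rw [one_div, ← div_eq_inv_mul, lt_div_iff₀ (by positivity)]
  constructor <;> intro h <;> linarith

/-- The sample median of the first `N` observations, centred at `μ` and scaled by `√N`. -/
def scaledMedian {Ω : Type*} (X : ℕ → Ω → ℝ) (μ : ℝ) (N : ℕ) (ω : Ω) : ℝ :=
  √(N : ℝ) * (sampleMedian (fun k : Fin N => X k ω) - μ)

theorem lt_scaledMedian_iff {Ω : Type*} {X : ℕ → Ω → ℝ} {μ : ℝ} {N : ℕ} (hN : 0 < N)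
    (x : ℝ) (ω : Ω) :
    x < scaledMedian X μ N ω ↔ μ + x / √(N : ℝ) < sampleMedian fun k : Fin N => X k ω := by
  have hs : 0 < √(N : ℝ) := Real.sqrt_pos.2 (by exact_mod_cast hN)
  rw [scaledMedian, ← div_lt_iff₀' hs]
  constructor <;> intro h <;> linarith

section Median

variable {Ω : Type*} [MeasurableSpace Ω] {P : Measure Ω} [IsProbabilityMeasure P]
  {X : ℕ → Ω → ℝ} {G : ℝ → ℝ} {μ f a : ℝ}

theorem measurable_scaledMedian (hX : ∀ k, Measurable (X k)) (N : ℕ) :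
    Measurable (scaledMedian X μ N) :=
  measurable_const.mul ((measurable_sampleMedian.comp (measurable_pi_lambda _ fun _ => hX _)).sub
    measurable_const)

/-- The tails of the scaled sample median are bounded by an exponential, uniformly in the sample
size. -/
theorem abs_signedTail_scaledMedian_le (hX : ∀ k, Measurable (X k)) (hind : iIndepFun X P)
    (hG : ∀ k y, P.real {ω | y < X k ω} = G y) (ha : 0 < a)
    (hup : ∀ t, 0 ≤ t → G (μ + t) ≤ 1 / 2 * Real.exp (-(a * t)))
    (hlo : ∀ t, 0 ≤ t → 1 - G (μ - t) ≤ 1 / 2 * Real.exp (-(a * t))) {N : ℕ} (hN : 0 < N) (x : ℝ) :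
    |signedTail P (scaledMedian X μ N) x| ≤ 2 * Real.exp (-(a / 8 * |x|)) := by
  have hs : 0 < √(N : ℝ) := Real.sqrt_pos.2 (by exact_mod_cast hN)
  refine le_trans ?_ (chernoff_median_bound ha (abs_nonneg x) hN)
  set q := 1 / 2 * Real.exp (-(a * (|x| / √(N : ℝ)))) with hq
  have hq0 : 0 < q := by positivity
  have hq1 : q ≤ 1 / 2 := by
    have : Real.exp (-(a * (|x| / √(N : ℝ)))) ≤ 1 := Real.exp_le_one_iff.2
      (neg_nonpos.2 (by positivity))
    linarith
  by_cases h0 : 0 < x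
  · simp only [signedTail, h0, if_true]
    rw [abs_of_nonneg measureReal_nonneg]
    refine le_trans (measureReal_mono ?_) (chernoff_signCount_nonneg hX hind N
      (y := μ + x / √(N : ℝ)) (fun k => hG k _) ?_ hq0 hq1)
    · intro ω hω
      exact signCount_nonneg_of_lt_sampleMedian hN ((lt_scaledMedian_iff hN x ω).1 hω)
    · rw [hq, abs_of_pos h0]
      exact hup _ (by positivity)
  · simp only [signedTail, h0, if_false]
    rw [abs_neg, abs_of_nonneg measureReal_nonneg]
    refine le_trans (measureReal_mono ?_) (chernoff_signCount_nonpos hX hind N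
      (y := μ + x / √(N : ℝ)) (fun k => hG k _) ?_ hq0 hq1)
    · intro ω hω
      by_contra hc
      have := (lt_scaledMedian_iff (X := X) (μ := μ) hN x ω).2
        (lt_sampleMedian_of_signCount_pos hN (not_le.1 hc))
      exact absurd hω (not_le.2 this)
    · rw [hq, abs_of_nonpos (not_lt.1 h0)]
      have : μ + x / √(N : ℝ) = μ - -x / √(N : ℝ) := by ring
      rw [this]
      refine hlo _ (div_nonneg (by linarith) hs.le)

/-- The event that the scaled median exceeds `x` lies between the strict and the weak majority of
observations above `μ + x / √N`, and the probability of one such observation is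
`1 / 2 - f x / √N + o(1 / √N)`. -/
theorem tendsto_prob_lt_scaledMedian (hX : ∀ k, Measurable (X k)) (hind : iIndepFun X P)
    (hG : ∀ k y, P.real {ω | y < X k ω} = G y) (hGμ : G μ = 1 / 2) (hf : 0 < f)
    (hderiv : HasDerivAt G (-f) μ) (x : ℝ) :
    Tendsto (fun N : ℕ => P.real {ω | x < scaledMedian X μ N ω}) atTop
      (𝓝 ((gaussianReal 0 (Real.toNNReal (1 / (4 * f ^ 2)))).real (Set.Ioi x))) := by
  rw [← gaussianReal_shift_Ioi hf]
  have hε : Tendsto (fun N : ℕ => (√(N : ℝ))) atTop atTop :=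
    Real.tendsto_sqrt_atTop.comp tendsto_natCast_atTop_atTop
  have hδ : Tendsto (fun N : ℕ => √(N : ℝ) * (2 * G (μ + x / √(N : ℝ)) - 1)) atTop
      (𝓝 (-(2 * f * x))) := by
    have h1 : HasDerivAt (fun s : ℝ => 2 * G (μ + x * s) - 1) (2 * (-f * x)) 0 := by
      have h2 : HasDerivAt (fun s : ℝ => μ + x * s) x 0 := by
        simpa using ((hasDerivAt_id (0 : ℝ)).const_mul x).const_add μ
      have h3 : HasDerivAt G (-f) (μ + x * 0) := by simpa using hderiv
      exact ((h3.comp (0 : ℝ) h2).const_mul 2).sub_const 1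
    have h4 := h1.tendsto_slope_zero
    have h5 : Tendsto (fun N : ℕ => (√(N : ℝ))⁻¹) atTop (𝓝[≠] 0) := by
      refine tendsto_nhdsWithin_iff.2 ⟨tendsto_inv_atTop_zero.comp hε, ?_⟩
      filter_upwards [eventually_gt_atTop 0] with N hN
      exact (inv_pos.2 (Real.sqrt_pos.2 (by exact_mod_cast hN))).ne'
    have h6 := h4.comp h5
    rw [show -(2 * f * x) = 2 * (-f * x) by ring]
    refine h6.congr fun N => ?_
    simp only [Function.comp_apply, inv_inv, zero_add, mul_zero, add_zero, hGμ, smul_eq_mul]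
    rw [div_eq_mul_inv]
    ring_nf
  obtain ⟨h1, h2⟩ := tendsto_prob_signCount hX hind
    (y := fun N : ℕ => μ + x / √(N : ℝ)) (fun N k => hG k _) hδ
  refine tendsto_of_tendsto_of_tendsto_of_le_of_le' h1 h2 ?_ ?_
  · filter_upwards [eventually_gt_atTop 0] with N hN
    refine measureReal_mono fun ω hω => ?_
    exact (lt_scaledMedian_iff hN x ω).2 (lt_sampleMedian_of_signCount_pos hN hω)
  · filter_upwards [eventually_gt_atTop 0] with N hN
    refine measureReal_mono fun ω hω => ?_
    exact signCount_nonneg_of_lt_sampleMedian hN ((lt_scaledMedian_iff hN x ω).1 hω)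

theorem tendsto_signedTail_scaledMedian (hX : ∀ k, Measurable (X k)) (hind : iIndepFun X P)
    (hG : ∀ k y, P.real {ω | y < X k ω} = G y) (hGμ : G μ = 1 / 2) (hf : 0 < f)
    (hderiv : HasDerivAt G (-f) μ) (x : ℝ) :
    Tendsto (fun N : ℕ => signedTail P (scaledMedian X μ N) x) atTop
      (𝓝 (signedTail (gaussianReal 0 (Real.toNNReal (1 / (4 * f ^ 2)))) id x)) := by
  have h := tendsto_prob_lt_scaledMedian hX hind hG hGμ hf hderiv x
  by_cases h0 : 0 < x
  · simp only [signedTail, h0, if_true]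
    exact h
  · simp only [signedTail, h0, if_false]
    refine Tendsto.neg ?_
    have e : ∀ {Ω' : Type _} [MeasurableSpace Ω'] (P' : Measure Ω') [IsProbabilityMeasure P']
        (T : Ω' → ℝ), Measurable T → P'.real {ω | T ω ≤ x} = 1 - P'.real {ω | x < T ω} := by
      intro Ω' _ P' _ T hT
      rw [← probReal_compl_eq_one_sub (measurableSet_lt measurable_const hT)]
      congr 1
      ext ω; simp
    have e1 := fun N => e P _ (measurable_scaledMedian (μ := μ) hX N)
    simp only [e1]
    have e2 : (gaussianReal 0 (Real.toNNReal (1 / (4 * f ^ 2)))).real {ω | id ω ≤ x}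
        = 1 - (gaussianReal 0 (Real.toNNReal (1 / (4 * f ^ 2)))).real (Set.Ioi x) := by
      rw [← probReal_compl_eq_one_sub measurableSet_Ioi]
      congr 1
      ext ω; simp
    rw [e2]
    exact h.const_sub 1

/-- The scaled sample median converges to a Gaussian law together with all expectations of `C¹`
functions whose derivative grows at most linearly; these cover first and second moments and
characteristic functions. -/
theorem scaledMedian_expectations {E : Type*} [NormedAddCommGroup E] [NormedSpace ℝ E]
    [CompleteSpace E] (hX : ∀ k, Measurable (X k)) (hind : iIndepFun X P)
    (hG : ∀ k y, P.real {ω | y < X k ω} = G y) (hGμ : G μ = 1 / 2) (hf : 0 < f)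
    (hderiv : HasDerivAt G (-f) μ) (ha : 0 < a)
    (hup : ∀ t, 0 ≤ t → G (μ + t) ≤ 1 / 2 * Real.exp (-(a * t)))
    (hlo : ∀ t, 0 ≤ t → 1 - G (μ - t) ≤ 1 / 2 * Real.exp (-(a * t)))
    {g g' : ℝ → E} (hg : ∀ x, HasDerivAt g (g' x) x) (hg' : Continuous g') {C : ℝ}
    (hC : ∀ x, ‖g' x‖ ≤ C * (1 + |x|)) :
    (∀ N : ℕ, 0 < N → Integrable (fun ω => g (scaledMedian X μ N ω)) P) ∧
      Tendsto (fun N : ℕ => ∫ ω, g (scaledMedian X μ N ω) ∂P) atTop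
        (𝓝 (∫ x, g x ∂(gaussianReal 0 (Real.toNNReal (1 / (4 * f ^ 2)))))) := by
  have hb := integrable_one_add_abs_mul_exp (c := a / 8) (by positivity)
  have hbd := fun (N : ℕ) (hN : 0 < N) (x : ℝ) =>
    abs_signedTail_scaledMedian_le hX hind hG ha hup hlo hN x
  have hrep := fun (N : ℕ) (hN : 0 < N) =>
    integrable_and_integral_eq_signedTail (measurable_scaledMedian (μ := μ) hX N) hb (hbd N hN)
      hg hg' hC
  refine ⟨fun N hN => (hrep N hN).1, ?_⟩
  have hlim := fun x => tendsto_signedTail_scaledMedian hX hind hG hGμ hf hderiv x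
  -- the Gaussian limit inherits the uniform tail bound
  have hγ : ∀ x, |signedTail (gaussianReal 0 (Real.toNNReal (1 / (4 * f ^ 2)))) id x|
      ≤ 2 * Real.exp (-(a / 8 * |x|)) := by
    intro x
    refine le_of_tendsto (hlim x).abs ?_
    filter_upwards [eventually_gt_atTop 0] with N hN using hbd N hN x
  have hrepγ := (integrable_and_integral_eq_signedTail
    (P := gaussianReal 0 (Real.toNNReal (1 / (4 * f ^ 2)))) measurable_id hb hγ hg hg' hC).2
  simp only [id] at hrepγ
  rw [hrepγ]
  refine Tendsto.congr' (f₁ := fun N : ℕ =>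
    g 0 + ∫ x, signedTail P (scaledMedian X μ N) x • g' x) ?_ ?_
  · filter_upwards [eventually_gt_atTop 0] with N hN using (hrep N hN).2.symm
  refine Tendsto.const_add _ ?_
  refine tendsto_integral_filter_of_dominated_convergence
    (fun x => C * ((1 + |x|) * (2 * Real.exp (-(a / 8 * |x|))))) ?_ ?_ (hb.const_mul C) ?_
  · refine Eventually.of_forall fun N => ?_
    have hm : AEStronglyMeasurable (fun x => signedTail P (scaledMedian X μ N) x) volume := by
      have hT := measurable_scaledMedian (μ := μ) hX N
      have : AEStronglyMeasurable (fun z : ℝ × Ω => signedIndicator (scaledMedian X μ N z.2) z.1)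
          ((volume : Measure ℝ).prod P) :=
        (measurable_signedIndicator.comp
          ((hT.comp measurable_snd).prodMk measurable_fst)).aestronglyMeasurable
      have := this.integral_prod_right'
      refine this.congr (Eventually.of_forall fun x => ?_)
      exact integral_signedIndicator hT x
    exact hm.smul hg'.aestronglyMeasurable
  · filter_upwards [eventually_gt_atTop 0] with N hN
    refine Eventually.of_forall fun x => ?_
    rw [norm_smul, Real.norm_eq_abs]
    calc |signedTail P (scaledMedian X μ N) x| * ‖g' x‖
        ≤ (2 * Real.exp (-(a / 8 * |x|))) * (C * (1 + |x|)) :=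
          mul_le_mul (hbd N hN x) (hC x) (norm_nonneg _) (by positivity)
      _ = C * ((1 + |x|) * (2 * Real.exp (-(a / 8 * |x|)))) := by ring
  · exact Eventually.of_forall fun x => (hlim x).smul_const (g' x)

end Median

/-! ### Numerical bounds for the normal quartile -/

theorem abs_exp_neg_sub_taylor_le {s : ℝ} (h0 : 0 ≤ s) (h1 : s ≤ 1 / 4) :
    |Real.exp (-s) - (1 - s + s ^ 2 / 2 - s ^ 3 / 6 + s ^ 4 / 24 - s ^ 5 / 120 + s ^ 6 / 720
      - s ^ 7 / 5040)| ≤ 1 / 10 ^ 9 := by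
  have h := Real.exp_bound (x := -s) (by rw [abs_neg, abs_of_nonneg h0]; linarith) (n := 8)
    (by norm_num)
  simp only [Finset.sum_range_succ, Finset.sum_range_zero, Nat.factorial] at h
  norm_num [abs_of_nonneg h0] at h
  have e : Real.exp (-s) - (1 - s + s ^ 2 / 2 - s ^ 3 / 6 + s ^ 4 / 24 - s ^ 5 / 120 + s ^ 6 / 720
      - s ^ 7 / 5040) = Real.exp (-s) - (1 + -s + s ^ 2 / 2 + (-s) ^ 3 / 6 + s ^ 4 / 24
      + (-s) ^ 5 / 120 + s ^ 6 / 720 + (-s) ^ 7 / 5040) := by ring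
  rw [e]
  refine h.trans ?_
  have : s ^ 8 ≤ (1 / 4) ^ 8 := pow_le_pow_left₀ h0 h1 8
  norm_num at this
  linarith

/-- Antiderivative of the Taylor polynomial of `exp (-x ^ 2 / 2)`. -/
def gaussTaylor (x : ℝ) : ℝ :=
  x - x ^ 3 / 6 + x ^ 5 / 40 - x ^ 7 / 336 + x ^ 9 / 3456 - x ^ 11 / 42240 + x ^ 13 / 599040
    - x ^ 15 / 9676800

theorem abs_integral_exp_sub_gaussTaylor_le {r : ℝ} (h0 : 0 ≤ r) (h1 : r ≤ 7 / 10) :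
    |(∫ x in (0 : ℝ)..r, Real.exp (-(x ^ 2 / 2))) - gaussTaylor r| ≤ 1 / 10 ^ 9 := by
  have hd : ∀ x, HasDerivAt gaussTaylor (1 - (x ^ 2 / 2) + (x ^ 2 / 2) ^ 2 / 2
      - (x ^ 2 / 2) ^ 3 / 6 + (x ^ 2 / 2) ^ 4 / 24 - (x ^ 2 / 2) ^ 5 / 120
      + (x ^ 2 / 2) ^ 6 / 720 - (x ^ 2 / 2) ^ 7 / 5040) x := by
    intro x
    have h := ((((((((hasDerivAt_id x).sub ((hasDerivAt_pow 3 x).div_const 6)).add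
      ((hasDerivAt_pow 5 x).div_const 40)).sub ((hasDerivAt_pow 7 x).div_const 336)).add
      ((hasDerivAt_pow 9 x).div_const 3456)).sub ((hasDerivAt_pow 11 x).div_const 42240)).add
      ((hasDerivAt_pow 13 x).div_const 599040)).sub ((hasDerivAt_pow 15 x).div_const 9676800))
    refine h.congr_deriv ?_
    push_cast
    ring
  have hi := intervalIntegral.integral_eq_sub_of_hasDerivAt (a := 0) (b := r)
    (fun x _ => hd x) (Continuous.intervalIntegrable (by fun_prop) _ _)
  have hz : gaussTaylor 0 = 0 := by simp [gaussTaylor]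
  rw [hz, sub_zero] at hi
  rw [← hi, ← intervalIntegral.integral_sub (Continuous.intervalIntegrable (by fun_prop) _ _)
    (Continuous.intervalIntegrable (by fun_prop) _ _), ← Real.norm_eq_abs]
  refine (intervalIntegral.norm_integral_le_of_norm_le_const (C := 1 / 10 ^ 9) ?_).trans ?_
  · intro x hx
    rw [Set.uIoc_of_le h0] at hx
    have hx0 := hx.1
    have hx1 := hx.2
    exact abs_exp_neg_sub_taylor_le (by positivity) (by nlinarith)
  · rw [sub_zero, abs_of_nonneg h0]
    norm_num
    linarith

/-- The standard Gaussian mass of `[0, r]`. -/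
def gaussMass (r : ℝ) : ℝ := ∫ x in (0 : ℝ)..r, gaussianPDFReal 0 1 x

theorem gaussianPDFReal_std (x : ℝ) :
    gaussianPDFReal 0 1 x = (√(2 * Real.pi))⁻¹ * Real.exp (-(x ^ 2 / 2)) := by
  simp [gaussianPDFReal, neg_div]

theorem continuous_gaussianPDFReal_std : Continuous (gaussianPDFReal 0 1) := by
  simp only [funext gaussianPDFReal_std]; fun_prop

theorem gaussMass_eq (r : ℝ) :
    gaussMass r = (√(2 * Real.pi))⁻¹ * ∫ x in (0 : ℝ)..r, Real.exp (-(x ^ 2 / 2)) := by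
  simp only [gaussMass, gaussianPDFReal_std]
  rw [intervalIntegral.integral_const_mul]

theorem hasDerivAt_gaussMass (r : ℝ) : HasDerivAt gaussMass (gaussianPDFReal 0 1 r) r :=
  intervalIntegral.integral_hasDerivAt_right (continuous_gaussianPDFReal_std.intervalIntegrable _ _)
    (continuous_gaussianPDFReal_std.stronglyMeasurableAtFilter _ _)
    continuous_gaussianPDFReal_std.continuousAt

theorem strictMono_gaussMass : StrictMono gaussMass :=
  strictMono_of_hasDerivAt_pos hasDerivAt_gaussMass
    fun x => gaussianPDFReal_pos 0 1 x one_ne_zero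

theorem gaussMass_zero : gaussMass 0 = 0 := by simp [gaussMass]

/-- The numerals `0.6744897` and `0.6744898` enclose the upper quartile of the normal distribution. -/
theorem gaussMass_lt_quarter : gaussMass 0.6744897 < 1 / 4 := by
  have h := (abs_le.1 (abs_integral_exp_sub_gaussTaylor_le (r := 0.6744897) (by norm_num)
    (by norm_num))).2
  have hs : 0 < √(2 * Real.pi) := Real.sqrt_pos.2 (by positivity)
  have h2 : 2.506628 < √(2 * Real.pi) := by
    apply Real.lt_sqrt_of_sq_lt; have := Real.pi_gt_d20; norm_num at this ⊢; linarith
  rw [gaussMass_eq, ← div_eq_inv_mul, div_lt_iff₀ hs]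
  have h3 : 4 * (gaussTaylor 0.6744897 + 1 / 10 ^ 9) < √(2 * Real.pi) := by
    apply Real.lt_sqrt_of_sq_lt
    have := Real.pi_gt_d20
    norm_num [gaussTaylor] at this ⊢
    linarith
  linarith

theorem quarter_lt_gaussMass : 1 / 4 < gaussMass 0.6744898 := by
  have h := (abs_le.1 (abs_integral_exp_sub_gaussTaylor_le (r := 0.6744898) (by norm_num)
    (by norm_num))).1
  have hs : 0 < √(2 * Real.pi) := Real.sqrt_pos.2 (by positivity)
  rw [gaussMass_eq, ← div_eq_inv_mul, lt_div_iff₀ hs]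
  have h3 : √(2 * Real.pi) < 4 * (gaussTaylor 0.6744898 - 1 / 10 ^ 9) := by
    rw [Real.sqrt_lt' (by norm_num [gaussTaylor])]
    have := Real.pi_lt_d20
    norm_num [gaussTaylor] at this ⊢
    linarith
  linarith

theorem gaussianReal_std_Iic_zero : (gaussianReal 0 1).real (Set.Iic 0) = 1 / 2 := by
  have : NullSingletonClass (gaussianReal 0 1) := nullSingletonClass_gaussianReal one_ne_zero
  have h1 : (gaussianReal 0 1).real (Set.Iic 0) = (gaussianReal 0 1).real (Set.Ici 0) := by
    have h := gaussianReal_map_neg (μ := 0) (v := 1)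
    rw [neg_zero] at h
    conv_lhs => rw [← h]
    rw [map_measureReal_apply measurable_neg measurableSet_Iic]
    congr 1
    ext x; simp
  have h2 : (gaussianReal 0 1).real (Set.Ioi 0) = (gaussianReal 0 1).real (Set.Ici 0) :=
    measureReal_congr Ioi_ae_eq_Ici
  have h3 := probReal_compl_eq_one_sub (μ := gaussianReal 0 1) (measurableSet_Iic (a := (0 : ℝ)))
  rw [Set.compl_Iic, h2] at h3
  linarith

theorem gaussianReal_std_real {s : Set ℝ} :
    (gaussianReal 0 1).real s = ∫ x in s, gaussianPDFReal 0 1 x := by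
  rw [measureReal_def, gaussianReal_apply_eq_integral _ one_ne_zero,
    ENNReal.toReal_ofReal (integral_nonneg fun x => gaussianPDFReal_nonneg _ _ _)]

theorem cdf_gaussianReal_std {r : ℝ} (hr : 0 ≤ r) :
    cdf (gaussianReal 0 1) r = 1 / 2 + gaussMass r := by
  rw [cdf_eq_real, ← Set.Iic_union_Ioc_eq_Iic hr, measureReal_union
    (Set.Iic_disjoint_Ioc le_rfl) measurableSet_Ioc, gaussianReal_std_Iic_zero, gaussMass,
    intervalIntegral.integral_of_le hr, gaussianReal_std_real]

/-- The infimum defining the quantile is attained, and lies in the numerical enclosure. -/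
theorem stdNormalQuantile_spec :
    0.6744897 < stdNormalQuantile (3 / 4) ∧ stdNormalQuantile (3 / 4) < 0.6744898 ∧
      gaussMass (stdNormalQuantile (3 / 4)) = 1 / 4 := by
  have hc : ContinuousOn gaussMass (Set.Icc 0.6744897 0.6744898) := fun x _ =>
    (hasDerivAt_gaussMass x).continuousAt.continuousWithinAt
  obtain ⟨q, hq, hqm⟩ := intermediate_value_Ioo (by norm_num) hc
    ⟨gaussMass_lt_quarter, quarter_lt_gaussMass⟩
  have hq0 : 0 ≤ q := by have := hq.1; norm_num at this; linarith
  have : stdNormalQuantile (3 / 4) = q := by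
    have hl : IsLeast {x : ℝ | 3 / 4 ≤ cdf (gaussianReal 0 1) x} q := by
      constructor
      · change 3 / 4 ≤ cdf (gaussianReal 0 1) q
        rw [cdf_gaussianReal_std hq0, hqm]; norm_num
      · intro x hx
        change 3 / 4 ≤ cdf (gaussianReal 0 1) x at hx
        by_contra hc
        have hxq := not_le.1 hc
        rcases le_total 0 x with h0 | h0
        · rw [cdf_gaussianReal_std h0] at hx
          have := strictMono_gaussMass hxq
          linarith
        · have := monotone_cdf (gaussianReal 0 1) h0
          rw [cdf_gaussianReal_std le_rfl, gaussMass_zero] at this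
          linarith
    exact hl.csInf_eq
  rw [this]
  exact ⟨hq.1, hq.2, hqm⟩

theorem exp_taylor_bounds {s : ℝ} (h0 : 0 ≤ s) (h1 : s ≤ 1 / 2) :
    |Real.exp s - (1 + s + s ^ 2 / 2 + s ^ 3 / 6 + s ^ 4 / 24 + s ^ 5 / 120 + s ^ 6 / 720
      + s ^ 7 / 5040 + s ^ 8 / 40320 + s ^ 9 / 362880)| ≤ 1 / 10 ^ 9 := by
  have h := Real.exp_bound (x := s) (by rw [abs_of_nonneg h0]; linarith) (n := 10)
    (by norm_num)
  simp only [Finset.sum_range_succ, Finset.sum_range_zero, Nat.factorial] at h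
  norm_num [abs_of_nonneg h0] at h
  refine h.trans ?_
  have : s ^ 10 ≤ (1 / 2) ^ 10 := pow_le_pow_left₀ h0 h1 10
  norm_num at this
  linarith

theorem abs_medlA_sub_lt : |medlA - 5.4418| < 0.00005 := by
  obtain ⟨h1, h2, -⟩ := stdNormalQuantile_spec
  set q := stdNormalQuantile (3 / 4) with hq
  have hQ1 : (0.6744897 : ℝ) ^ 2 ≤ medlQ := pow_le_pow_left₀ (by norm_num) h1.le 2
  have hQ2 : medlQ ≤ (0.6744898 : ℝ) ^ 2 :=
    pow_le_pow_left₀ (le_trans (by norm_num) h1.le) h2.le 2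
  have hQ0 : 0 < medlQ := lt_of_lt_of_le (by norm_num) hQ1
  have e1 := (abs_le.1 (exp_taylor_bounds (s := (0.6744897 : ℝ) ^ 2) (by norm_num)
    (by norm_num))).1
  have e2 := (abs_le.1 (exp_taylor_bounds (s := (0.6744898 : ℝ) ^ 2) (by norm_num)
    (by norm_num))).2
  have e1' := Real.exp_le_exp.2 hQ1
  have e2' := Real.exp_le_exp.2 hQ2
  have p1 := Real.pi_gt_d20
  have p2 := Real.pi_lt_d20
  have E1 : 1.576072 ≤ Real.exp medlQ := by
    refine le_trans ?_ e1'
    norm_num at e1 ⊢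
    linarith
  have E2 : Real.exp medlQ ≤ 1.576074 := by
    refine e2'.trans ?_
    norm_num at e2 ⊢
    linarith
  rw [medlA, abs_lt, lt_sub_iff_add_lt, sub_lt_iff_lt_add, lt_div_iff₀ (by positivity),
    div_lt_iff₀ (by positivity)]
  norm_num at E1 E2 hQ1 hQ2 p1 p2
  constructor
  · norm_num
    nlinarith [Real.exp_pos medlQ]
  · norm_num
    nlinarith [Real.exp_pos medlQ]

/-! ### The logarithm of a squared standard normal variable -/

/-- The upper tail `P(log Z² > y)` for a standard normal `Z`. -/
def logChiTail (y : ℝ) : ℝ := 1 - 2 * gaussMass (Real.exp (y / 2))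

theorem gaussianReal_std_Icc {r : ℝ} (hr : 0 ≤ r) :
    (gaussianReal 0 1).real (Set.Icc (-r) r) = 2 * gaussMass r := by
  have hi := fun a b => continuous_gaussianPDFReal_std.intervalIntegrable (μ := volume) a b
  rw [gaussianReal_std_real, integral_Icc_eq_integral_Ioc,
    ← intervalIntegral.integral_of_le (by linarith),
    ← intervalIntegral.integral_add_adjacent_intervals (hi (-r) 0) (hi 0 r)]
  have h : ∫ x in (-r)..0, gaussianPDFReal 0 1 x = gaussMass r := by
    have := intervalIntegral.integral_comp_neg (a := 0) (b := r) (fun x => gaussianPDFReal 0 1 x)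
    rw [neg_zero] at this
    rw [← this, gaussMass]
    simp only [gaussianPDFReal_std, neg_sq]
  rw [h, gaussMass]
  ring

theorem lt_log_sq_iff {y z : ℝ} (hz : z ≠ 0) :
    y < Real.log (z ^ 2) ↔ Real.exp (y / 2) < |z| := by
  rw [Real.log_pow, ← Real.log_abs, ← Real.lt_log_iff_exp_lt (abs_pos.2 hz)]
  push_cast
  constructor <;> intro h <;> linarith

theorem gaussianReal_std_log_sq (y : ℝ) :
    (gaussianReal 0 1).real {z | y < Real.log (z ^ 2)} = logChiTail y := by
  have : NullSingletonClass (gaussianReal 0 1) := nullSingletonClass_gaussianReal one_ne_zero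
  rw [logChiTail, ← gaussianReal_std_Icc (Real.exp_pos _).le,
    ← probReal_compl_eq_one_sub measurableSet_Icc]
  refine measureReal_congr ?_
  have h0 : ∀ᵐ z ∂(gaussianReal 0 1), z ≠ 0 := by
    rw [ae_iff]; simp
  filter_upwards [h0] with z hz
  refine propext ?_
  change y < Real.log (z ^ 2) ↔ ¬ (-Real.exp (y / 2) ≤ z ∧ z ≤ Real.exp (y / 2))
  rw [lt_log_sq_iff hz, ← abs_le, not_le]

theorem hasDerivAt_logChiTail (y : ℝ) :
    HasDerivAt logChiTail (-(Real.exp (y / 2) * gaussianPDFReal 0 1 (Real.exp (y / 2)))) y := by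
  have h1 : HasDerivAt (fun y : ℝ => Real.exp (y / 2)) (Real.exp (y / 2) * (1 / 2)) y :=
    ((hasDerivAt_id y).div_const 2).exp
  have h2 := (((hasDerivAt_gaussMass (Real.exp (y / 2))).comp y h1).const_mul 2).const_sub 1
  exact h2.congr_deriv (by ring)

theorem antitone_logChiTail : Antitone logChiTail := by
  intro x y hxy
  have := strictMono_gaussMass.monotone
    (Real.exp_le_exp.2 (by linarith : x / 2 ≤ y / 2))
  simp only [logChiTail]
  linarith

/-- Markov's inequality for `Z²`. -/
theorem logChiTail_le (y : ℝ) : logChiTail y ≤ Real.exp (-y) := by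
  have h := mul_meas_ge_le_integral_of_nonneg (μ := gaussianReal 0 1) (f := fun z : ℝ => z ^ 2)
    (Eventually.of_forall fun z => sq_nonneg z)
    ((memLp_id_gaussianReal 2).integrable_sq) (Real.exp y)
  have hv : ∫ z, z ^ 2 ∂(gaussianReal 0 1) = 1 := by
    have := variance_fun_id_gaussianReal (μ := 0) (v := 1)
    rw [variance_eq_integral (by fun_prop)] at this
    simpa using this
  rw [hv] at h
  rw [← gaussianReal_std_log_sq, Real.exp_neg, ← one_div, le_div_iff₀ (Real.exp_pos _), mul_comm]
  refine le_trans ?_ h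
  refine mul_le_mul_of_nonneg_left ?_ (Real.exp_pos _).le
  have : NullSingletonClass (gaussianReal 0 1) := nullSingletonClass_gaussianReal one_ne_zero
  have h0 : ∀ᵐ z ∂(gaussianReal 0 1), z ≠ 0 := by
    rw [ae_iff]; simp
  refine ENNReal.toReal_mono (measure_ne_top _ _) (measure_mono_ae ?_)
  filter_upwards [h0] with z hz
  intro hy
  have hy' : y < Real.log (z ^ 2) := hy
  have hz2 : 0 < z ^ 2 := by positivity
  exact ((Real.lt_log_iff_exp_lt hz2).1 hy').le

/-- The normal density is at most `1`. -/
theorem one_sub_logChiTail_le (y : ℝ) : 1 - logChiTail y ≤ 2 * Real.exp (y / 2) := by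
  have h : gaussMass (Real.exp (y / 2)) ≤ Real.exp (y / 2) := by
    have hn := intervalIntegral.norm_integral_le_of_norm_le_const (a := 0) (b := Real.exp (y / 2))
      (f := gaussianPDFReal 0 1) (C := 1) ?_
    · rw [sub_zero, one_mul, abs_of_pos (Real.exp_pos _)] at hn
      exact (le_abs_self _).trans hn
    · intro x _
      rw [gaussianPDFReal_std, Real.norm_eq_abs, abs_of_nonneg (by positivity)]
      have h1 : Real.exp (-(x ^ 2 / 2)) ≤ 1 := Real.exp_le_one_iff.2 (by nlinarith [sq_nonneg x])
      have h2 : (√(2 * Real.pi))⁻¹ ≤ 1 := by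
        refine inv_le_one_of_one_le₀ ?_
        rw [← Real.sqrt_one]
        exact Real.sqrt_le_sqrt (by have := Real.pi_gt_three; linarith)
      calc _ ≤ (1 : ℝ) * 1 := mul_le_mul h2 h1 (Real.exp_pos _).le zero_le_one
        _ = 1 := one_mul 1
  simp only [logChiTail]
  linarith

/-- A decreasing tail function that starts at `1/2` with negative slope and is eventually
exponentially small is bounded by half an exponential throughout. -/
theorem exists_half_exp_bound {K : ℝ → ℝ} {f C b : ℝ} (hK : Antitone K) (hK0 : K 0 = 1 / 2)
    (hf : 0 < f) (hd : HasDerivAt K (-f) 0) (hb : 0 < b)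
    (hC : ∀ t, 0 ≤ t → K t ≤ C * Real.exp (-(b * t))) :
    ∃ a, 0 < a ∧ ∀ a', 0 < a' → a' ≤ a → ∀ t, 0 ≤ t → K t ≤ 1 / 2 * Real.exp (-(a' * t)) := by
  -- near `0` the derivative controls `K`, far out the exponential bound does, and in between
  -- monotonicity leaves `K` bounded away from `1 / 2`
  obtain ⟨δ, hδ, hnear⟩ : ∃ δ > 0, ∀ t, 0 ≤ t → t ≤ δ → K t ≤ 1 / 2 * Real.exp (-(f * t)) := by
    have h := hd.isLittleO.def (show 0 < f / 2 by positivity)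
    rw [Metric.eventually_nhds_iff] at h
    obtain ⟨ε, hε, h⟩ := h
    refine ⟨ε / 2, by positivity, fun t h0 h1 => ?_⟩
    have := h (y := t) (by rw [Real.dist_eq, sub_zero, abs_of_nonneg h0]; linarith)
    rw [sub_zero, Real.norm_eq_abs, Real.norm_eq_abs, abs_of_nonneg h0, hK0, smul_eq_mul] at this
    have := (abs_le.1 this).2
    have := Real.add_one_le_exp (-(f * t))
    linarith
  set C' := max C 1 with hC'
  set T := max (2 / b * Real.log (2 * C')) 1 with hT
  have hT0 : 0 < T := lt_of_lt_of_le one_pos (le_max_right _ _)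
  have hC'0 : 0 < C' := lt_of_lt_of_le one_pos (le_max_right _ _)
  refine ⟨min (min f (b / 2)) (f * δ / T), by positivity, fun a ha0 ha t ht => ?_⟩
  have ha1 : a ≤ f := ha.trans ((min_le_left _ _).trans (min_le_left _ _))
  have ha2 : a ≤ b / 2 := ha.trans ((min_le_left _ _).trans (min_le_right _ _))
  have ha3 : a * T ≤ f * δ := by
    rw [← le_div_iff₀ hT0]; exact ha.trans (min_le_right _ _)
  rcases le_total t δ with h1 | h1
  · refine (hnear t ht h1).trans ?_
    gcongr
  rcases le_total t T with h2 | h2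
  · refine (hK h1).trans ((hnear δ hδ.le le_rfl).trans ?_)
    have : a * t ≤ f * δ := (mul_le_mul_of_nonneg_left h2 ha0.le).trans ha3
    gcongr
  · have h3 : Real.log (2 * C') ≤ b / 2 * t := by
      have : 2 / b * Real.log (2 * C') ≤ t := (le_max_left _ _).trans h2
      calc Real.log (2 * C') = b / 2 * (2 / b * Real.log (2 * C')) := by field_simp
        _ ≤ b / 2 * t := by gcongr
    have h4 : 2 * C' ≤ Real.exp (b / 2 * t) := (Real.log_le_iff_le_exp (by positivity)).1 h3
    calc K t ≤ C * Real.exp (-(b * t)) := hC t ht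
      _ ≤ C' * Real.exp (-(b * t)) := by gcongr; exact le_max_left _ _
      _ = 1 / 2 * ((2 * C') * Real.exp (-(b * t))) := by ring
      _ ≤ 1 / 2 * (Real.exp (b / 2 * t) * Real.exp (-(b * t))) := by gcongr
      _ = 1 / 2 * Real.exp (-(b / 2 * t)) := by rw [← Real.exp_add]; congr 2; ring
      _ ≤ 1 / 2 * Real.exp (-(a * t)) := by gcongr

/-- The median of `log Z²` for a standard normal `Z`. -/
def logChiMedian : ℝ := 2 * Real.log (stdNormalQuantile (3 / 4))

/-- The density of `log Z²` at its median, for a standard normal `Z`. -/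
def logChiDensity : ℝ :=
  stdNormalQuantile (3 / 4) * gaussianPDFReal 0 1 (stdNormalQuantile (3 / 4))

theorem stdNormalQuantile_pos : 0 < stdNormalQuantile (3 / 4) :=
  lt_trans (by norm_num) stdNormalQuantile_spec.1

theorem exp_half_logChiMedian : Real.exp (logChiMedian / 2) = stdNormalQuantile (3 / 4) := by
  rw [logChiMedian, mul_div_cancel_left₀ _ two_ne_zero, Real.exp_log stdNormalQuantile_pos]

theorem logChiTail_median : logChiTail logChiMedian = 1 / 2 := by
  rw [logChiTail, exp_half_logChiMedian, stdNormalQuantile_spec.2.2]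
  norm_num

theorem logChiDensity_pos : 0 < logChiDensity :=
  mul_pos stdNormalQuantile_pos (gaussianPDFReal_pos 0 1 _ one_ne_zero)

theorem hasDerivAt_logChiTail_median : HasDerivAt logChiTail (-logChiDensity) logChiMedian := by
  have := hasDerivAt_logChiTail logChiMedian
  rwa [exp_half_logChiMedian] at this

/-- The asymptotic variance `1 / (4 f²)` of the median of `log Z²` is `A`. -/
theorem one_div_four_mul_logChiDensity_sq : 1 / (4 * logChiDensity ^ 2) = medlA := by
  have hq := stdNormalQuantile_pos
  rw [logChiDensity, medlA, medlQ, gaussianPDFReal_std]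
  set q := stdNormalQuantile (3 / 4)
  have hs : √(2 * Real.pi) ^ 2 = 2 * Real.pi := Real.sq_sqrt (by positivity)
  have he : Real.exp (q ^ 2) = (Real.exp (-(q ^ 2 / 2)))⁻¹ ^ 2 := by
    rw [← Real.exp_neg, ← Real.exp_nat_mul]; congr 1; push_cast; ring
  rw [he, mul_pow, mul_pow, inv_pow, hs]
  have := Real.exp_pos (-(q ^ 2 / 2))
  have := Real.pi_pos
  field_simp
  norm_num

/-- Both tails of `log Z²` about its median are at most half an exponential, as Chernoff's bound for
the sample median requires. -/
theorem exists_logChiTail_bound : ∃ a, 0 < a ∧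
    (∀ t, 0 ≤ t → logChiTail (logChiMedian + t) ≤ 1 / 2 * Real.exp (-(a * t))) ∧
    (∀ t, 0 ≤ t → 1 - logChiTail (logChiMedian - t) ≤ 1 / 2 * Real.exp (-(a * t))) := by
  obtain ⟨a₁, h1, h1'⟩ := exists_half_exp_bound (K := fun t => logChiTail (logChiMedian + t))
    (C := Real.exp (-logChiMedian)) (b := 1)
    (fun x y hxy => antitone_logChiTail (by linarith)) (by simp [logChiTail_median])
    logChiDensity_pos
    (by
      have h : HasDerivAt (fun t => logChiMedian + t) 1 0 := (hasDerivAt_id 0).const_add _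
      have h2 : HasDerivAt logChiTail (-logChiDensity) (logChiMedian + 0) := by
        simpa using hasDerivAt_logChiTail_median
      exact (h2.comp 0 h).congr_deriv (mul_one _))
    one_pos (fun t _ => by
      rw [← Real.exp_add]
      refine (logChiTail_le _).trans (Real.exp_le_exp.2 (by linarith)))
  obtain ⟨a₂, h2, h2'⟩ := exists_half_exp_bound (K := fun t => 1 - logChiTail (logChiMedian - t))
    (C := 2 * Real.exp (logChiMedian / 2)) (b := 1 / 2)
    (fun x y hxy => by
      have : logChiTail (logChiMedian - x) ≤ logChiTail (logChiMedian - y) :=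
        antitone_logChiTail (by linarith)
      simp only; linarith)
    (by simp [logChiTail_median]; norm_num) logChiDensity_pos
    (by
      have h : HasDerivAt (fun t => logChiMedian - t) (-1) 0 := (hasDerivAt_id 0).const_sub _
      have h2 : HasDerivAt logChiTail (-logChiDensity) (logChiMedian - 0) := by
        simpa using hasDerivAt_logChiTail_median
      simpa using (h2.comp 0 h).const_sub 1)
    (by norm_num) (fun t _ => by
      refine (one_sub_logChiTail_le _).trans_eq ?_
      rw [mul_assoc, ← Real.exp_add]; congr 2; ring)
  refine ⟨min a₁ a₂, lt_min h1 h2, h1' _ (lt_min h1 h2) (min_le_left _ _),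
    h2' _ (lt_min h1 h2) (min_le_right _ _)⟩

/-! ### Integrals of fractional Brownian motion against a weight -/

/-- The covariance kernel of fractional Brownian motion. -/
def fbmCov (H s t : ℝ) : ℝ := (|s| ^ (2 * H) + |t| ^ (2 * H) - |s - t| ^ (2 * H)) / 2

theorem continuous_fbmCov {H : ℝ} (hH : 0 < H) : Continuous fun z : ℝ × ℝ => fbmCov H z.1 z.2 := by
  have h : ∀ x : ℝ, x ≠ 0 ∨ 0 ≤ 2 * H := fun _ => Or.inr (by linarith)
  unfold fbmCov
  refine Continuous.div_const (Continuous.sub (Continuous.add ?_ ?_) ?_) 2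
  · exact Continuous.rpow_const (by fun_prop) fun _ => h _
  · exact Continuous.rpow_const (by fun_prop) fun _ => h _
  · exact Continuous.rpow_const (by fun_prop) fun _ => h _

/-- Weighted integrals of a process along a simple time change are finite linear combinations. -/
theorem integral_fbm_simpleFunc {Ω : Type*} {B : ℝ → Ω → ℝ} {φ : ℝ → ℝ} (hφ : Integrable φ)
    (τ : SimpleFunc ℝ ℝ) (ω : Ω) :
    ∫ t, B (τ t) ω * φ t = ∑ s ∈ τ.range, (∫ t in τ ⁻¹' {s}, φ t) • B s ω := by
  have h : ∀ t, B (τ t) ω * φ t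
      = ∑ s ∈ τ.range, (τ ⁻¹' {s}).indicator (fun t => B s ω * φ t) t := by
    intro t
    rw [Finset.sum_eq_single (τ t)]
    · simp
    · intro s _ hs
      simp [Set.indicator, hs.symm]
    · intro h; exact absurd (τ.mem_range_self t) h
  simp only [h]
  rw [integral_finsetSum _ fun s _ => (hφ.const_mul _).indicator (τ.measurableSet_preimage _)]
  refine Finset.sum_congr rfl fun s _ => ?_
  rw [integral_indicator (τ.measurableSet_preimage _), integral_const_mul, smul_eq_mul, mul_comm]

section FBM

variable {Ω : Type*} [MeasurableSpace Ω] {P : Measure Ω} {B : ℝ → Ω → ℝ} {H : ℝ}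

/-- A fractional Brownian motion has a jointly measurable version all of whose paths are continuous
and which has, almost surely, the same path. -/
theorem IsFractionalBrownianMotion.exists_measurable_version
    (hB : IsFractionalBrownianMotion B H P) :
    ∃ B' : ℝ → Ω → ℝ, Measurable (Function.uncurry B') ∧ IsFractionalBrownianMotion B' H P ∧
      ∀ᵐ ω ∂P, ∀ t, B' t ω = B t ω := by
  have hBm := fun t => hB.isGaussianProcess.aemeasurable t
  -- a measurable null set containing all discontinuous paths and all points where `B` differs from
  -- a measurable version at some rational time
  set N : Set Ω := toMeasurable P {ω | (Continuous fun t => B t ω) ∧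
    ∀ q : ℚ, B q ω = (hBm q).mk (B q) ω}ᶜ with hN
  have hN0 : P N = 0 := by
    rw [hN, measure_toMeasurable]
    have h : ∀ᵐ ω ∂P, (Continuous fun t => B t ω) ∧ ∀ q : ℚ, B q ω = (hBm q).mk (B q) ω :=
      hB.continuous_paths.and (ae_all_iff.2 fun q => (hBm q).ae_eq_mk)
    exact h
  have hNm : MeasurableSet N := measurableSet_toMeasurable _ _
  have hgood : ∀ ω, ω ∉ N → (Continuous fun t => B t ω) ∧
      ∀ q : ℚ, B q ω = (hBm q).mk (B q) ω := by
    intro ω hω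
    by_contra hc
    exact hω (subset_toMeasurable P _ hc)
  classical
  set B' : ℝ → Ω → ℝ := fun t ω => if ω ∈ N then 0 else B t ω with hB'
  have hcont : ∀ ω, Continuous fun t => B' t ω := by
    intro ω
    by_cases h : ω ∈ N
    · simp only [hB', h, if_true]; exact continuous_const
    · simp only [hB', h, if_false]; exact (hgood ω h).1
  have hmq : ∀ q : ℚ, Measurable (B' q) := by
    intro q
    have : B' q = fun ω => if ω ∈ N then 0 else (hBm q).mk (B q) ω := by
      ext ω
      by_cases h : ω ∈ N
      · simp [hB', h]
      · simp only [hB', h, if_false]; exact (hgood ω h).2 q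
    rw [this]
    exact Measurable.ite hNm measurable_const (hBm q).measurable_mk
  have hm : ∀ t, Measurable (B' t) := by
    intro t
    obtain ⟨u, hu, hut⟩ := mem_closure_iff_seq_limit.1
      (Rat.denseRange_cast (𝕜 := ℝ) t)
    refine measurable_of_tendsto_metrizable (f := fun n => B' (u n)) (fun n => ?_)
      (tendsto_pi_nhds.2 fun ω => ((hcont ω).tendsto t).comp hut)
    obtain ⟨q, hq⟩ := hu n
    simp only [← hq]
    exact hmq q
  have hae : ∀ᵐ ω ∂P, ∀ t, B' t ω = B t ω := by
    have : ∀ᵐ ω ∂P, ω ∉ N := measure_eq_zero_iff_ae_notMem.1 hN0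
    filter_upwards [this] with ω hω t
    simp [hB', hω]
  have haet : ∀ t, B' t =ᵐ[P] B t := fun t => by filter_upwards [hae] with ω hω using hω t
  refine ⟨B', measurable_uncurry_of_continuous_of_measurable hcont hm, ?_, hae⟩
  refine ⟨hB.isGaussianProcess.congr fun t => (haet t).symm, fun t => ?_, fun s t => ?_,
    Eventually.of_forall hcont⟩
  · rw [integral_congr_ae (haet t), hB.mean_eq_zero]
  · rw [← hB.covariance_eq, covariance, covariance, integral_congr_ae (haet s),
      integral_congr_ae (haet t)]
    refine integral_congr_ae ?_
    filter_upwards [haet s, haet t] with ω h1 h2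
    rw [h1, h2]

theorem IsFractionalBrownianMotion.memLp_two [IsProbabilityMeasure P]
    (hB : IsFractionalBrownianMotion B H P) (t : ℝ) : MemLp (B t) 2 P :=
  (hB.isGaussianProcess.hasGaussianLaw_eval t).memLp_two

theorem IsFractionalBrownianMotion.integral_mul [IsProbabilityMeasure P]
    (hB : IsFractionalBrownianMotion B H P) (s t : ℝ) :
    ∫ ω, B s ω * B t ω ∂P = fbmCov H s t := by
  have := covariance_eq_sub (hB.memLp_two s) (hB.memLp_two t)
  rw [hB.covariance_eq, hB.mean_eq_zero, hB.mean_eq_zero, zero_mul, sub_zero] at this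
  exact this.symm

theorem fbmCov_self (hH : 0 < H) (t : ℝ) : fbmCov H t t = |t| ^ (2 * H) := by
  rw [fbmCov, sub_self, abs_zero, Real.zero_rpow (by linarith)]
  ring

theorem abs_rpow_two_mul (x H : ℝ) : |x| ^ (2 * H) = (|x| ^ H) ^ 2 := by
  rw [mul_comm, Real.rpow_mul (abs_nonneg x), Real.rpow_two]

theorem integral_abs_mul_abs_le {X Y : Ω → ℝ} (hX : MemLp X 2 P) (hY : MemLp Y 2 P) :
    ∫ ω, |X ω| * |Y ω| ∂P ≤ √(∫ ω, X ω ^ 2 ∂P) * √(∫ ω, Y ω ^ 2 ∂P) := by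
  have h := integral_mul_norm_le_Lp_mul_Lq (μ := P) Real.HolderConjugate.two_two
    (f := X) (g := Y) (by simpa using hX) (by simpa using hY)
  simpa [Real.sqrt_eq_rpow] using h

theorem IsFractionalBrownianMotion.integral_abs_mul_le [IsProbabilityMeasure P] (hH : 0 < H)
    (hB : IsFractionalBrownianMotion B H P) (s t : ℝ) :
    ∫ ω, |B s ω| * |B t ω| ∂P ≤ |s| ^ H * |t| ^ H := by
  refine (integral_abs_mul_abs_le (hB.memLp_two s) (hB.memLp_two t)).trans_eq ?_
  have h : ∀ t, √(∫ ω, B t ω ^ 2 ∂P) = |t| ^ H := by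
    intro t
    simp only [sq]
    rw [hB.integral_mul, fbmCov_self hH, abs_rpow_two_mul, Real.sqrt_sq (by positivity)]
  rw [h, h]

theorem IsFractionalBrownianMotion.abs_fbmCov_le [IsProbabilityMeasure P] (hH : 0 < H)
    (hB : IsFractionalBrownianMotion B H P) (s t : ℝ) :
    |fbmCov H s t| ≤ |s| ^ H * |t| ^ H := by
  rw [← hB.integral_mul]
  refine (abs_integral_le_integral_abs).trans ?_
  simp only [abs_mul]
  exact hB.integral_abs_mul_le hH s t

theorem IsFractionalBrownianMotion.integral_abs_sub_le [IsProbabilityMeasure P] (hH : 0 < H)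
    (hB : IsFractionalBrownianMotion B H P) (s t : ℝ) :
    ∫ ω, |B s ω - B t ω| ∂P ≤ |s - t| ^ H := by
  have hs := hB.memLp_two s
  have ht := hB.memLp_two t
  have h := integral_abs_mul_abs_le (P := P) (hs.sub ht) (memLp_const (1 : ℝ))
  simp only [Pi.sub_apply, abs_one, mul_one, one_pow, integral_const, probReal_univ, smul_eq_mul,
    Real.sqrt_one] at h
  refine h.trans_eq ?_
  have e : ∫ ω, (B s ω - B t ω) ^ 2 ∂P = |s - t| ^ (2 * H) := by
    have e1 : ∀ ω, (B s ω - B t ω) ^ 2 = B s ω * B s ω - 2 * (B s ω * B t ω) + B t ω * B t ω :=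
      fun ω => by ring
    have i1 : Integrable (fun ω => B s ω * B s ω) P := hs.integrable_mul hs
    have i2 : Integrable (fun ω => 2 * (B s ω * B t ω)) P := (hs.integrable_mul ht).const_mul 2
    have i4 : Integrable (fun ω => B s ω * B s ω - 2 * (B s ω * B t ω)) P := i1.sub i2
    have i3 : Integrable (fun ω => B t ω * B t ω) P := ht.integrable_mul ht
    simp only [e1]
    rw [integral_add i4 i3, integral_sub i1 i2, integral_const_mul, hB.integral_mul, hB.integral_mul,
      hB.integral_mul, fbmCov_self hH, fbmCov_self hH, fbmCov]
    ring
  rw [e, abs_rpow_two_mul, Real.sqrt_sq (by positivity)]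

theorem IsFractionalBrownianMotion.integral_abs_le [IsProbabilityMeasure P] (hH : 0 < H)
    (hB : IsFractionalBrownianMotion B H P) (t : ℝ) : ∫ ω, |B t ω| ∂P ≤ |t| ^ H := by
  have h := integral_abs_mul_abs_le (P := P) (hB.memLp_two t) (memLp_const (1 : ℝ))
  simp only [abs_one, mul_one, integral_const, probReal_univ, smul_eq_mul, Real.sqrt_one,
    sq] at h
  rwa [hB.integral_mul, fbmCov_self hH, abs_rpow_two_mul, Real.sqrt_sq (by positivity)] at h

/-- Simple time changes at most double the distance to the origin, which costs a factor `2`. -/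
theorem two_mul_rpow_le (hH : H ∈ Set.Ioo (0 : ℝ) 1) {a b : ℝ} (h : |a| ≤ 2 * |b|) :
    |a| ^ H ≤ 2 * |b| ^ H := by
  calc |a| ^ H ≤ (2 * |b|) ^ H := Real.rpow_le_rpow (abs_nonneg _) h hH.1.le
    _ = 2 ^ H * |b| ^ H := Real.mul_rpow zero_le_two (abs_nonneg _)
    _ ≤ 2 * |b| ^ H := by
      gcongr
      calc (2 : ℝ) ^ H ≤ 2 ^ (1 : ℝ) := Real.rpow_le_rpow_of_exponent_le one_le_two hH.2.le
        _ = 2 := Real.rpow_one 2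

variable {φ : ℝ → ℝ}

theorem norm_weight (φ : ℝ → ℝ) (H t : ℝ) : |t| ^ H * |φ t| = ‖|t| ^ H * φ t‖ := by
  rw [Real.norm_eq_abs, abs_mul, abs_of_nonneg (Real.rpow_nonneg (abs_nonneg t) H)]

theorem integrable_fbm_comp_mul [IsProbabilityMeasure P] (hH : H ∈ Set.Ioo (0 : ℝ) 1)
    (hB : IsFractionalBrownianMotion B H P) (hBm : Measurable (Function.uncurry B))
    (hφ : AEStronglyMeasurable φ) (hφH : Integrable fun t => |t| ^ H * φ t) {τ : ℝ → ℝ}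
    (hτ : Measurable τ) (hτ2 : ∀ t, |τ t| ≤ 2 * |t|) :
    Integrable (fun z : Ω × ℝ => B (τ z.2) z.1 * φ z.2) (P.prod volume) := by
  have hm : AEStronglyMeasurable (fun z : Ω × ℝ => B (τ z.2) z.1 * φ z.2) (P.prod volume) :=
    (hBm.comp ((hτ.comp measurable_snd).prodMk measurable_fst)).aestronglyMeasurable.mul
      hφ.comp_snd
  rw [integrable_prod_iff' hm]
  refine ⟨Eventually.of_forall fun t =>
    ((hB.memLp_two (τ t)).integrable one_le_two).mul_const (φ t), ?_⟩
  refine Integrable.mono' (hφH.norm.const_mul 2) hm.norm.prod_swap.integral_prod_right'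
    (Eventually.of_forall fun t => ?_)
  rw [← norm_weight]
  simp only [norm_mul]
  rw [integral_mul_const, norm_mul, norm_norm, Real.norm_eq_abs,
    abs_of_nonneg (integral_nonneg fun _ => norm_nonneg _), Real.norm_eq_abs, ← mul_assoc]
  refine mul_le_mul_of_nonneg_right ?_ (abs_nonneg _)
  exact (hB.integral_abs_le hH.1 (τ t)).trans (two_mul_rpow_le hH (hτ2 t))

/-- Second moment of a weighted integral of fractional Brownian motion along a time change. -/
theorem integral_sq_integral_fbm_comp [IsProbabilityMeasure P] (hH : H ∈ Set.Ioo (0 : ℝ) 1)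
    (hB : IsFractionalBrownianMotion B H P) (hBm : Measurable (Function.uncurry B))
    (hφ : AEStronglyMeasurable φ) (hφH : Integrable fun t => |t| ^ H * φ t) {τ : ℝ → ℝ}
    (hτ : Measurable τ) (hτ2 : ∀ t, |τ t| ≤ 2 * |t|) :
    ∫ ω, (∫ t, B (τ t) ω * φ t) ^ 2 ∂P
      = ∫ z : ℝ × ℝ, fbmCov H (τ z.1) (τ z.2) * (φ z.1 * φ z.2) := by
  have hBτ : Measurable fun z : Ω × ℝ => B (τ z.2) z.1 :=
    hBm.comp ((hτ.comp measurable_snd).prodMk measurable_fst)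
  have hm : AEStronglyMeasurable (fun z : Ω × (ℝ × ℝ) =>
      (B (τ z.2.1) z.1 * B (τ z.2.2) z.1) * (φ z.2.1 * φ z.2.2))
      (P.prod (volume.prod volume)) := by
    refine AEStronglyMeasurable.mul ?_ ?_
    · exact ((hBτ.comp (measurable_fst.prodMk (measurable_fst.comp measurable_snd))).mul
        (hBτ.comp (measurable_fst.prodMk (measurable_snd.comp measurable_snd)))).aestronglyMeasurable
    · exact (hφ.comp_fst.mul hφ.comp_snd).comp_snd
  have hi : Integrable (fun z : Ω × (ℝ × ℝ) =>
      (B (τ z.2.1) z.1 * B (τ z.2.2) z.1) * (φ z.2.1 * φ z.2.2))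
      (P.prod (volume.prod volume)) := by
    rw [integrable_prod_iff' hm]
    refine ⟨Eventually.of_forall fun t =>
      ((hB.memLp_two (τ t.1)).integrable_mul (hB.memLp_two (τ t.2))).mul_const
        (φ t.1 * φ t.2), ?_⟩
    refine Integrable.mono' ((hφH.norm.const_mul 2).mul_prod (hφH.norm.const_mul 2))
      hm.norm.prod_swap.integral_prod_right' (Eventually.of_forall fun t => ?_)
    simp only [norm_mul]
    rw [integral_mul_const, norm_mul, norm_mul, norm_norm, norm_norm, Real.norm_eq_abs,
      abs_of_nonneg (integral_nonneg fun _ => by positivity)]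
    have h1 := (hB.integral_abs_mul_le hH.1 (τ t.1) (τ t.2)).trans
      (mul_le_mul (two_mul_rpow_le hH (hτ2 t.1)) (two_mul_rpow_le hH (hτ2 t.2))
        (by positivity) (by positivity))
    simp only [Real.norm_eq_abs] at h1 ⊢
    calc _ ≤ (2 * |t.1| ^ H * (2 * |t.2| ^ H)) * (|φ t.1| * |φ t.2|) := by gcongr
      _ = _ := by
        simp only [abs_of_nonneg (Real.rpow_nonneg (abs_nonneg t.1) H),
          abs_of_nonneg (Real.rpow_nonneg (abs_nonneg t.2) H)]
        ring
  have h1 : ∀ ω, (∫ t, B (τ t) ω * φ t) ^ 2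
      = ∫ z : ℝ × ℝ, (B (τ z.1) ω * B (τ z.2) ω) * (φ z.1 * φ z.2) := by
    intro ω
    rw [sq, ← integral_prod_mul]
    exact integral_congr_ae (Eventually.of_forall fun z => by ring)
  simp only [h1]
  refine (integral_integral_swap (f := fun ω (z : ℝ × ℝ) =>
    (B (τ z.1) ω * B (τ z.2) ω) * (φ z.1 * φ z.2)) hi).trans ?_
  refine integral_congr_ae (Eventually.of_forall fun z => ?_)
  simp only
  rw [integral_mul_const, hB.integral_mul]

theorem map_integral_fbm_simpleFunc [IsProbabilityMeasure P] (hH : H ∈ Set.Ioo (0 : ℝ) 1)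
    (hB : IsFractionalBrownianMotion B H P) (hBm : Measurable (Function.uncurry B))
    (hφ : Integrable φ) (hφH : Integrable fun t => |t| ^ H * φ t) (τ : SimpleFunc ℝ ℝ)
    (hτ2 : ∀ t, |τ t| ≤ 2 * |t|) :
    P.map (fun ω => ∫ t, B (τ t) ω * φ t) = gaussianReal 0
      (Real.toNNReal (∫ z : ℝ × ℝ, fbmCov H (τ z.1) (τ z.2) * (φ z.1 * φ z.2))) := by
  have hlaw : HasGaussianLaw (fun ω => ∫ t, B (τ t) ω * φ t) P := by
    simp only [integral_fbm_simpleFunc hφ τ]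
    exact (hB.isGaussianProcess.smul fun s => ∫ t in τ ⁻¹' {s}, φ t).hasGaussianLaw_fun_sum
  have hmean : ∫ ω, (∫ t, B (τ t) ω * φ t) ∂P = 0 := by
    simp only [integral_fbm_simpleFunc hφ τ]
    have hi : ∀ s ∈ τ.range, Integrable (fun ω => (∫ t in τ ⁻¹' {s}, φ t) • B s ω) P :=
      fun s _ => ((hB.memLp_two s).integrable one_le_two).smul (∫ t in τ ⁻¹' {s}, φ t)
    rw [integral_finsetSum _ hi]
    simp only [integral_smul, hB.mean_eq_zero]
    simp
  rw [hlaw.map_eq_gaussianReal, hmean,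
    variance_of_integral_eq_zero hlaw.aemeasurable hmean,
    integral_sq_integral_fbm_comp hH hB hBm hφ.1 hφH τ.measurable hτ2]

/-- Passage to the limit along simple time changes `τ → id`: the laws are Gaussian, they converge
because `𝔼|B_{τ(t)} - B_t| ≤ |τ(t) - t| ^ H`, and their variances converge to the double integral
of the covariance. -/
theorem map_integral_fbm_of_measurable [IsProbabilityMeasure P] (hH : H ∈ Set.Ioo (0 : ℝ) 1)
    (hB : IsFractionalBrownianMotion B H P) (hBm : Measurable (Function.uncurry B))
    (hφ : Integrable φ) (hφH : Integrable fun t => |t| ^ H * φ t) :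
    P.map (fun ω => ∫ t, B t ω * φ t) = gaussianReal 0
      (Real.toNNReal (∫ z : ℝ × ℝ, fbmCov H z.1 z.2 * (φ z.1 * φ z.2))) := by
  set τ : ℕ → SimpleFunc ℝ ℝ := SimpleFunc.approxOn id measurable_id Set.univ 0 (Set.mem_univ _)
    with hτ
  have hτlim : ∀ t, Tendsto (fun n => τ n t) atTop (𝓝 t) := fun t =>
    SimpleFunc.tendsto_approxOn measurable_id (Set.mem_univ _) (by simp)
  -- the approximation picks the nearest point among finitely many, one of which is `0`
  have hτd : ∀ n t, |τ n t - t| ≤ |t| := by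
    intro n t
    have h := SimpleFunc.edist_approxOn_le (f := id) measurable_id (Set.mem_univ (0 : ℝ)) t n
    rw [edist_dist, edist_dist, ENNReal.ofReal_le_ofReal_iff dist_nonneg, Real.dist_eq,
      Real.dist_eq] at h
    simpa using h
  have hτ2 : ∀ n t, |τ n t| ≤ 2 * |t| := by
    intro n t
    have := abs_add_le (τ n t - t) t
    rw [sub_add_cancel] at this
    have := hτd n t
    linarith
  have hint : ∀ {τ : ℝ → ℝ}, Measurable τ → (∀ t, |τ t| ≤ 2 * |t|) →
      Integrable (fun z : Ω × ℝ => B (τ z.2) z.1 * φ z.2) (P.prod volume) := fun h1 h2 =>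
    integrable_fbm_comp_mul hH hB hBm hφ.1 hφH h1 h2
  have hid2 : ∀ t : ℝ, |id t| ≤ 2 * |t| := fun t => by
    have := abs_nonneg t
    simp only [id]; linarith
  have hX := hint measurable_id hid2
  simp only [id] at hX
  have hXi : Integrable (fun ω => ∫ t, B t ω * φ t) P := hX.integral_prod_left
  have hXn : ∀ n, Integrable (fun ω => ∫ t, B (τ n t) ω * φ t) P := fun n =>
    (hint (τ n).measurable (hτ2 n)).integral_prod_left
  -- convergence in mean
  have hL1 : Tendsto (fun n => ∫ ω, |(∫ t, B (τ n t) ω * φ t) - ∫ t, B t ω * φ t| ∂P) atTop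
      (𝓝 0) := by
    have hup : Tendsto (fun n => ∫ t, |τ n t - t| ^ H * |φ t|) atTop (𝓝 0) := by
      have h0 : ∫ _ : ℝ, (0 : ℝ) = 0 := integral_zero _ _
      rw [← h0]
      refine tendsto_integral_of_dominated_convergence (fun t => ‖|t| ^ H * φ t‖) ?_ hφH.norm ?_ ?_
      · intro n
        refine AEStronglyMeasurable.mul ?_ hφ.1.norm
        exact (((τ n).measurable.sub measurable_id).abs.pow_const H).aestronglyMeasurable
      · intro n
        refine Eventually.of_forall fun t => ?_
        rw [← norm_weight, Real.norm_eq_abs, abs_of_nonneg (by positivity)]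
        exact mul_le_mul_of_nonneg_right
          (Real.rpow_le_rpow (abs_nonneg _) (hτd n t) hH.1.le) (abs_nonneg _)
      · refine Eventually.of_forall fun t => ?_
        have h1 : Tendsto (fun n => |τ n t - t| ^ H) atTop (𝓝 0) := by
          have h2 : Tendsto (fun n => |τ n t - t|) atTop (𝓝 0) := by
            simpa using ((hτlim t).sub_const t).abs
          have h3 := (Real.continuousAt_rpow_const 0 H (Or.inr hH.1.le)).tendsto.comp h2
          rwa [Real.zero_rpow hH.1.ne'] at h3
        simpa using h1.mul_const |φ t|
    refine squeeze_zero (fun n => integral_nonneg fun ω => abs_nonneg _) (fun n => ?_) hup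
    have hW : Integrable (fun z : Ω × ℝ => B (τ n z.2) z.1 * φ z.2 - B z.2 z.1 * φ z.2)
      (P.prod volume) := (hint (τ n).measurable (hτ2 n)).sub hX
    have hae : ∀ᵐ ω ∂P, |(∫ t, B (τ n t) ω * φ t) - ∫ t, B t ω * φ t|
        ≤ ∫ t, ‖B (τ n t) ω * φ t - B t ω * φ t‖ := by
      filter_upwards [(hint (τ n).measurable (hτ2 n)).prod_right_ae, hX.prod_right_ae] with ω h1 h2
      rw [← integral_sub h1 h2]
      exact norm_integral_le_integral_norm (fun t => B (τ n t) ω * φ t - B t ω * φ t)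
    refine (integral_mono_ae ((hXn n).sub hXi).abs hW.norm.integral_prod_left hae).trans ?_
    rw [integral_integral_swap (f := fun ω t => ‖B (τ n t) ω * φ t - B t ω * φ t‖) hW.norm]
    refine integral_mono hW.norm.integral_prod_right ?_ fun t => ?_
    · refine Integrable.mono' hφH.norm ?_ (Eventually.of_forall fun t => ?_)
      · refine AEStronglyMeasurable.mul ?_ hφ.1.norm
        exact (((τ n).measurable.sub measurable_id).abs.pow_const H).aestronglyMeasurable
      · rw [← norm_weight, Real.norm_eq_abs, abs_of_nonneg (by positivity)]
        exact mul_le_mul_of_nonneg_right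
          (Real.rpow_le_rpow (abs_nonneg _) (hτd n t) hH.1.le) (abs_nonneg _)
    · simp only [← sub_mul, norm_mul]
      rw [integral_mul_const]
      exact mul_le_mul_of_nonneg_right (hB.integral_abs_sub_le hH.1 _ _) (norm_nonneg _)
  -- convergence of the variances
  have hvar : Tendsto (fun n => ∫ z : ℝ × ℝ, fbmCov H (τ n z.1) (τ n z.2) * (φ z.1 * φ z.2)) atTop
      (𝓝 (∫ z : ℝ × ℝ, fbmCov H z.1 z.2 * (φ z.1 * φ z.2))) := by
    have hc := continuous_fbmCov hH.1
    refine tendsto_integral_of_dominated_convergence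
      (fun z => (2 * ‖|z.1| ^ H * φ z.1‖) * (2 * ‖|z.2| ^ H * φ z.2‖)) ?_
      ((hφH.norm.const_mul 2).mul_prod (hφH.norm.const_mul 2)) ?_ ?_
    · intro n
      refine AEStronglyMeasurable.mul ?_ (hφ.1.comp_fst.mul hφ.1.comp_snd)
      exact (hc.measurable.comp (((τ n).measurable.comp measurable_fst).prodMk
        ((τ n).measurable.comp measurable_snd))).aestronglyMeasurable
    · intro n
      refine Eventually.of_forall fun z => ?_
      rw [norm_mul, norm_mul, ← norm_weight, ← norm_weight]
      simp only [Real.norm_eq_abs]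
      have h1 := (hB.abs_fbmCov_le hH.1 (τ n z.1) (τ n z.2)).trans
        (mul_le_mul (two_mul_rpow_le hH (hτ2 n z.1)) (two_mul_rpow_le hH (hτ2 n z.2))
          (by positivity) (by positivity))
      calc _ ≤ (2 * |z.1| ^ H * (2 * |z.2| ^ H)) * (|φ z.1| * |φ z.2|) := by gcongr
        _ = _ := by ring
    · refine Eventually.of_forall fun z => ?_
      have := (hc.tendsto z).comp ((hτlim z.1).prodMk_nhds (hτlim z.2))
      exact this.mul_const _
  have : IsProbabilityMeasure (P.map fun ω => ∫ t, B t ω * φ t) :=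
    Measure.isProbabilityMeasure_map hXi.1.aemeasurable
  refine Measure.ext_of_charFun (funext fun u => ?_)
  have hcX : Tendsto (fun n => charFun (P.map fun ω => ∫ t, B (τ n t) ω * φ t) u) atTop
      (𝓝 (charFun (P.map fun ω => ∫ t, B t ω * φ t) u)) := by
    rw [tendsto_iff_norm_sub_tendsto_zero]
    have hb := hL1.const_mul |u|
    rw [mul_zero] at hb
    refine squeeze_zero (fun n => norm_nonneg _) (fun n => ?_) hb
    have hexp : ∀ {Y : Ω → ℝ}, AEMeasurable Y P →
        Integrable (fun ω => Complex.exp (u * Y ω * Complex.I)) P := by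
      intro Y hY
      refine Integrable.of_bound (C := 1) ?_ (Eventually.of_forall fun ω => ?_)
      · exact (Complex.measurable_exp.comp_aemeasurable
          ((measurable_const.mul Complex.measurable_ofReal).mul_const _ |>.comp_aemeasurable
            hY)).aestronglyMeasurable
      · rw [← Complex.ofReal_mul, Complex.norm_exp_ofReal_mul_I]
    rw [charFun_apply_real, charFun_apply_real,
      integral_map (hXn n).1.aemeasurable (by fun_prop), integral_map hXi.1.aemeasurable
      (by fun_prop), ← integral_sub (hexp (hXn n).1.aemeasurable) (hexp hXi.1.aemeasurable),
      ← integral_const_mul]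
    refine norm_integral_le_of_norm_le (((hXn n).sub hXi).abs.const_mul _)
      (Eventually.of_forall fun ω => ?_)
    have key : ∀ a b : ℝ, ‖Complex.exp (u * a * Complex.I) - Complex.exp (u * b * Complex.I)‖
        ≤ |u| * |a - b| := by
      intro a b
      have e : Complex.exp (u * a * Complex.I) - Complex.exp (u * b * Complex.I)
          = Complex.exp ((u * b : ℝ) * Complex.I)
            * (Complex.exp (Complex.I * (u * (a - b) : ℝ)) - 1) := by
        rw [mul_sub, ← Complex.exp_add, mul_one]
        congr 2 <;> push_cast <;> ring
      rw [e, norm_mul, Complex.norm_exp_ofReal_mul_I, one_mul, ← abs_mul]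
      exact Real.norm_exp_I_mul_ofReal_sub_one_le
    exact key _ _
  have hcG : Tendsto (fun n => charFun (P.map fun ω => ∫ t, B (τ n t) ω * φ t) u) atTop
      (𝓝 (charFun (gaussianReal 0
        (Real.toNNReal (∫ z : ℝ × ℝ, fbmCov H z.1 z.2 * (φ z.1 * φ z.2)))) u)) := by
    simp only [fun n => map_integral_fbm_simpleFunc hH hB hBm hφ hφH (τ n) (hτ2 n),
      charFun_gaussianReal]
    have h1 := (continuous_real_toNNReal.tendsto _).comp hvar
    have h2 : Continuous fun v : NNReal =>
        Complex.exp (u * (0 : ℝ) * Complex.I - (v : ℝ) * u ^ 2 / 2) := by fun_prop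
    exact (h2.tendsto _).comp h1
  exact tendsto_nhds_unique hcX hcG

/-- The integral of fractional Brownian motion against a weight is a centred Gaussian variable. -/
theorem map_integral_fbm [IsProbabilityMeasure P] (hH : H ∈ Set.Ioo (0 : ℝ) 1)
    (hB : IsFractionalBrownianMotion B H P)
    (hφ : Integrable φ) (hφH : Integrable fun t => |t| ^ H * φ t) :
    P.map (fun ω => ∫ t, B t ω * φ t) = gaussianReal 0
      (Real.toNNReal (∫ z : ℝ × ℝ, fbmCov H z.1 z.2 * (φ z.1 * φ z.2))) := by
  obtain ⟨B', hm, hB', hae⟩ := hB.exists_measurable_version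
  rw [← map_integral_fbm_of_measurable hH hB' hm hφ hφH]
  refine Measure.map_congr ?_
  filter_upwards [hae] with ω hω
  simp only [hω]

end FBM

/-! ### Spectral representation of the variance -/

/-- The spectral density of fractional Brownian motion, up to a constant; it is used at positive
frequencies only. -/
def specWeight (H ξ : ℝ) : ℝ := ξ ^ (-1 - 2 * H)

theorem specWeight_pos (H : ℝ) {ξ : ℝ} (hξ : 0 < ξ) : 0 < specWeight H ξ :=
  Real.rpow_pos_of_pos hξ _

theorem measurable_specWeight (H : ℝ) : Measurable (specWeight H) :=
  measurable_id.pow_const _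

theorem one_sub_cos_nonneg (x : ℝ) : 0 ≤ 1 - Real.cos x := by linarith [Real.cos_le_one x]

theorem integrableOn_one_sub_cos_mul {H : ℝ} (hH : H ∈ Set.Ioo (0 : ℝ) 1) (a : ℝ) :
    IntegrableOn (fun ξ => (1 - Real.cos (a * ξ)) * specWeight H ξ) (Set.Ioi 0) := by
  have hm : Measurable fun ξ => (1 - Real.cos (a * ξ)) * specWeight H ξ :=
    Measurable.mul (by fun_prop) (measurable_specWeight H)
  rw [← Set.Ioc_union_Ioi_eq_Ioi (zero_le_one' ℝ)]
  refine IntegrableOn.union ?_ ?_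
  · have h1 : IntegrableOn (fun ξ : ℝ => a ^ 2 / 2 * ξ ^ (1 - 2 * H)) (Set.Ioc 0 1) := by
      refine Integrable.const_mul ?_ _
      exact (intervalIntegrable_iff_integrableOn_Ioc_of_le zero_le_one).1
        (intervalIntegral.intervalIntegrable_rpow' (by linarith [hH.2]))
    refine Integrable.mono' h1 hm.aestronglyMeasurable ?_
    refine (ae_restrict_iff' measurableSet_Ioc).2 (Eventually.of_forall fun ξ hξ => ?_)
    have hw := specWeight_pos H hξ.1
    rw [Real.norm_eq_abs, abs_of_nonneg (mul_nonneg (one_sub_cos_nonneg _) hw.le)]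
    have h2 : 1 - Real.cos (a * ξ) ≤ (a * ξ) ^ 2 / 2 := by
      linarith [Real.one_sub_sq_div_two_le_cos (x := a * ξ)]
    have h3 : ξ ^ (1 - 2 * H) = ξ ^ 2 * specWeight H ξ := by
      rw [specWeight, ← Real.rpow_natCast, ← Real.rpow_add hξ.1]
      congr 1; push_cast; ring
    rw [h3]
    calc _ ≤ (a * ξ) ^ 2 / 2 * specWeight H ξ := by gcongr
      _ = _ := by ring
  · have h1 : IntegrableOn (fun ξ : ℝ => 2 * specWeight H ξ) (Set.Ioi 1) :=
      (integrableOn_Ioi_rpow_of_lt (by linarith [hH.1]) one_pos).const_mul 2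
    refine Integrable.mono' h1 hm.aestronglyMeasurable ?_
    refine (ae_restrict_iff' measurableSet_Ioi).2 (Eventually.of_forall fun ξ hξ => ?_)
    have hw := specWeight_pos H (lt_trans one_pos hξ)
    rw [Real.norm_eq_abs, abs_of_nonneg (mul_nonneg (one_sub_cos_nonneg _) hw.le)]
    gcongr
    linarith [Real.neg_one_le_cos (a * ξ)]

/-- The normalizing constant of the spectral representation. -/
def specConst (H : ℝ) : ℝ := ∫ ξ in Set.Ioi (0 : ℝ), (1 - Real.cos ξ) * specWeight H ξ

/-- The scaling identity behind the spectral representation of the covariance. -/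
theorem integral_one_sub_cos_mul {H : ℝ} (hH : H ∈ Set.Ioo (0 : ℝ) 1) (a : ℝ) :
    ∫ ξ in Set.Ioi (0 : ℝ), (1 - Real.cos (a * ξ)) * specWeight H ξ
      = |a| ^ (2 * H) * specConst H := by
  have hcos : ∀ ξ, Real.cos (a * ξ) = Real.cos (|a| * ξ) := by
    intro ξ
    rcases abs_choice a with h | h <;> rw [h]
    rw [neg_mul, Real.cos_neg]
  simp only [hcos]
  rcases (abs_nonneg a).eq_or_lt with h0 | h0
  · rw [← h0, Real.zero_rpow (by linarith [hH.1])]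
    simp
  · have h := integral_comp_mul_left_Ioi (fun ξ => (1 - Real.cos ξ) * specWeight H ξ) 0 h0
    rw [mul_zero] at h
    have hw : ∀ ξ ∈ Set.Ioi (0 : ℝ), (1 - Real.cos (|a| * ξ)) * specWeight H ξ
        = |a| ^ (1 + 2 * H) * ((1 - Real.cos (|a| * ξ)) * specWeight H (|a| * ξ)) := by
      intro ξ hξ
      rw [specWeight, specWeight, Real.mul_rpow h0.le (le_of_lt hξ)]
      have : |a| ^ (1 + 2 * H) * |a| ^ (-1 - 2 * H) = 1 := by
        rw [← Real.rpow_add h0]; ring_nf; exact Real.rpow_zero _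
      linear_combination (-(1 - Real.cos (|a| * ξ)) * ξ ^ (-1 - 2 * H)) * this
    rw [setIntegral_congr_fun measurableSet_Ioi hw, integral_const_mul, h, smul_eq_mul, ← mul_assoc,
      specConst]
    congr 1
    rw [Real.rpow_add h0, Real.rpow_one]
    field_simp

/-- A nonnegative continuous function with vanishing spectral integral vanishes at all positive
frequencies. -/
theorem eq_zero_of_integral_specWeight_eq_zero {H : ℝ} {g : ℝ → ℝ} (hg : Continuous g)
    (hg0 : ∀ x, 0 ≤ g x)
    (hi : IntegrableOn (fun ξ => g ξ * specWeight H ξ) (Set.Ioi 0))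
    (h0 : ∫ ξ in Set.Ioi (0 : ℝ), g ξ * specWeight H ξ = 0) : ∀ ξ, 0 < ξ → g ξ = 0 := by
  have hnn : 0 ≤ᵐ[volume.restrict (Set.Ioi (0 : ℝ))] fun ξ => g ξ * specWeight H ξ :=
    (ae_restrict_iff' measurableSet_Ioi).2 (Eventually.of_forall fun ξ hξ =>
      mul_nonneg (hg0 ξ) (specWeight_pos H hξ).le)
  have h1 := (integral_eq_zero_iff_of_nonneg_ae hnn hi).1 h0
  have h2 : g =ᵐ[volume.restrict (Set.Ioi (0 : ℝ))] 0 := by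
    filter_upwards [h1, ae_restrict_mem measurableSet_Ioi] with ξ h hξ
    exact (mul_eq_zero.1 h).resolve_right (specWeight_pos H hξ).ne'
  have h3 := Measure.eqOn_open_of_ae_eq h2 isOpen_Ioi hg.continuousOn continuousOn_const
  exact fun ξ hξ => h3 hξ

theorem specConst_pos {H : ℝ} (hH : H ∈ Set.Ioo (0 : ℝ) 1) : 0 < specConst H := by
  have hi : IntegrableOn (fun ξ => (1 - Real.cos ξ) * specWeight H ξ) (Set.Ioi 0) := by
    simpa using integrableOn_one_sub_cos_mul hH 1
  refine lt_of_le_of_ne ?_ fun h => ?_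
  · exact setIntegral_nonneg measurableSet_Ioi fun ξ hξ =>
      mul_nonneg (one_sub_cos_nonneg _) (specWeight_pos H hξ).le
  · have := eq_zero_of_integral_specWeight_eq_zero (g := fun ξ => 1 - Real.cos ξ) (by fun_prop)
      one_sub_cos_nonneg hi h.symm Real.pi Real.pi_pos
    norm_num at this

/-- Real form of `Re ((e ^ (i s ξ) - 1) * (e ^ (- i t ξ) - 1))`. -/
def specKernel (s t ξ : ℝ) : ℝ :=
  (Real.cos (s * ξ) - 1) * (Real.cos (t * ξ) - 1) + Real.sin (s * ξ) * Real.sin (t * ξ)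

theorem specKernel_eq (s t ξ : ℝ) : specKernel s t ξ
    = (1 - Real.cos (s * ξ)) + (1 - Real.cos (t * ξ)) - (1 - Real.cos ((s - t) * ξ)) := by
  rw [specKernel, sub_mul s t ξ, Real.cos_sub]; ring

theorem integral_specKernel {H : ℝ} (hH : H ∈ Set.Ioo (0 : ℝ) 1) (s t : ℝ) :
    IntegrableOn (fun ξ => specKernel s t ξ * specWeight H ξ) (Set.Ioi 0) ∧
      ∫ ξ in Set.Ioi (0 : ℝ), specKernel s t ξ * specWeight H ξ
        = 2 * specConst H * fbmCov H s t := by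
  have i1 := integrableOn_one_sub_cos_mul hH s
  have i2 := integrableOn_one_sub_cos_mul hH t
  have i3 := integrableOn_one_sub_cos_mul hH (s - t)
  have i4 : IntegrableOn (fun ξ => (1 - Real.cos (s * ξ)) * specWeight H ξ
    + (1 - Real.cos (t * ξ)) * specWeight H ξ) (Set.Ioi 0) := i1.add i2
  simp only [specKernel_eq, sub_mul _ (1 - Real.cos ((s - t) * _)), add_mul]
  refine ⟨i4.sub i3, ?_⟩
  rw [integral_sub i4 i3, integral_add i1 i2, integral_one_sub_cos_mul hH,
    integral_one_sub_cos_mul hH, integral_one_sub_cos_mul hH, fbmCov]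
  ring

theorem abs_specKernel_le (s t ξ : ℝ) :
    |specKernel s t ξ| ≤ √(2 * (1 - Real.cos (s * ξ))) * √(2 * (1 - Real.cos (t * ξ))) := by
  rw [← Real.sqrt_mul (by linarith [one_sub_cos_nonneg (s * ξ)])]
  refine Real.abs_le_sqrt ?_
  rw [specKernel]
  have h1 := Real.sin_sq_add_cos_sq (s * ξ)
  have h2 := Real.sin_sq_add_cos_sq (t * ξ)
  have e1 : 2 * (1 - Real.cos (s * ξ)) = (Real.cos (s * ξ) - 1) ^ 2 + Real.sin (s * ξ) ^ 2 := by
    linarith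
  have e2 : 2 * (1 - Real.cos (t * ξ)) = (Real.cos (t * ξ) - 1) ^ 2 + Real.sin (t * ξ) ^ 2 := by
    linarith
  rw [e1, e2]
  nlinarith [sq_nonneg ((Real.cos (s * ξ) - 1) * Real.sin (t * ξ)
    - Real.sin (s * ξ) * (Real.cos (t * ξ) - 1))]

/-- The Cauchy–Schwarz bound that makes the triple integral over two times and a frequency
absolutely convergent although only `|t| ^ H * φ t`, not `|t| ^ (2 * H) * φ t`, is integrable. -/
theorem integral_abs_specKernel_le {H : ℝ} (hH : H ∈ Set.Ioo (0 : ℝ) 1) (s t : ℝ) :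
    ∫ ξ in Set.Ioi (0 : ℝ), |specKernel s t ξ * specWeight H ξ|
      ≤ 2 * specConst H * (|s| ^ H * |t| ^ H) := by
  set F : ℝ → ℝ → ℝ := fun a ξ => √(2 * (1 - Real.cos (a * ξ)) * specWeight H ξ) with hF
  have hFsq : ∀ a, ∀ ξ ∈ Set.Ioi (0 : ℝ),
      F a ξ ^ 2 = 2 * ((1 - Real.cos (a * ξ)) * specWeight H ξ) := by
    intro a ξ hξ
    rw [hF]
    simp only
    rw [Real.sq_sqrt, mul_assoc]
    exact mul_nonneg (by linarith [one_sub_cos_nonneg (a * ξ)]) (specWeight_pos H hξ).le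
  have hFm : ∀ a, Measurable (F a) := fun a =>
    (Measurable.mul (by fun_prop) (measurable_specWeight H)).sqrt
  have hFi : ∀ a, MemLp (F a) 2 (volume.restrict (Set.Ioi (0 : ℝ))) := by
    intro a
    rw [memLp_two_iff_integrable_sq (hFm a).aestronglyMeasurable]
    refine ((integrableOn_one_sub_cos_mul hH a).const_mul 2).congr ?_
    filter_upwards [ae_restrict_mem measurableSet_Ioi] with ξ hξ using (hFsq a ξ hξ).symm
  have hFn : ∀ a, √(∫ ξ in Set.Ioi (0 : ℝ), F a ξ ^ 2) = √(2 * specConst H) * |a| ^ H := by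
    intro a
    rw [setIntegral_congr_fun measurableSet_Ioi (hFsq a), integral_const_mul,
      integral_one_sub_cos_mul hH, abs_rpow_two_mul, mul_left_comm, Real.sqrt_mul (by positivity),
      Real.sqrt_sq (by positivity), mul_comm]
  have h := integral_abs_mul_abs_le (hFi s) (hFi t)
  rw [hFn, hFn] at h
  have hc := (specConst_pos hH).le
  have e : √(2 * specConst H) * |s| ^ H * (√(2 * specConst H) * |t| ^ H)
      = 2 * specConst H * (|s| ^ H * |t| ^ H) := by
    have := Real.mul_self_sqrt (show 0 ≤ 2 * specConst H by positivity)
    linear_combination (|s| ^ H * |t| ^ H) * this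
  rw [e] at h
  refine le_trans ?_ h
  refine setIntegral_mono_on (integral_specKernel hH s t).1.abs
    ((hFi s).abs.integrable_mul (hFi t).abs) measurableSet_Ioi fun ξ hξ => ?_
  have hw := (specWeight_pos H hξ).le
  have h1 : ∀ a, |F a ξ| = √(2 * (1 - Real.cos (a * ξ))) * √(specWeight H ξ) := by
    intro a
    rw [hF]
    simp only
    rw [abs_of_nonneg (Real.sqrt_nonneg _),
      Real.sqrt_mul (by linarith [one_sub_cos_nonneg (a * ξ)])]
  rw [h1, h1, abs_mul, abs_of_nonneg hw]
  calc |specKernel s t ξ| * specWeight H ξ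
      ≤ (√(2 * (1 - Real.cos (s * ξ))) * √(2 * (1 - Real.cos (t * ξ)))) * specWeight H ξ :=
        mul_le_mul_of_nonneg_right (abs_specKernel_le s t ξ) hw
    _ = _ := by
      have := Real.mul_self_sqrt hw
      linear_combination (-(√(2 * (1 - Real.cos (s * ξ))) * √(2 * (1 - Real.cos (t * ξ))))) * this

/-- The Fourier integral `∫ e ^ (i ξ t) φ t dt`, normalized as a characteristic function. -/
def fourierInt (φ : ℝ → ℝ) (ξ : ℝ) : ℂ := ∫ t : ℝ, Complex.exp (ξ * t * Complex.I) * φ t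

theorem integrable_exp_mul {φ : ℝ → ℝ} (hφ : Integrable φ) (ξ : ℝ) :
    Integrable fun t : ℝ => Complex.exp (ξ * t * Complex.I) * φ t := by
  refine hφ.ofReal.bdd_mul (c := 1) (Continuous.aestronglyMeasurable (by fun_prop))
    (Eventually.of_forall fun t => ?_)
  rw [← Complex.ofReal_mul, Complex.norm_exp_ofReal_mul_I]

theorem continuous_fourierInt {φ : ℝ → ℝ} (hφ : Integrable φ) : Continuous (fourierInt φ) := by
  refine continuous_of_dominated (bound := fun t => ‖φ t‖) (fun ξ => (integrable_exp_mul hφ ξ).1)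
    (fun ξ => Eventually.of_forall fun t => ?_) hφ.norm (Eventually.of_forall fun t => ?_)
  · rw [norm_mul, ← Complex.ofReal_mul, Complex.norm_exp_ofReal_mul_I, one_mul, Complex.norm_real]
  · fun_prop

theorem integrable_cos_mul {φ : ℝ → ℝ} (hφ : Integrable φ) (ξ : ℝ) :
    Integrable fun t => Real.cos (t * ξ) * φ t :=
  hφ.bdd_mul (c := 1) (Continuous.aestronglyMeasurable (by fun_prop))
    (Eventually.of_forall fun t => by simpa using Real.abs_cos_le_one _)

theorem integrable_sin_mul {φ : ℝ → ℝ} (hφ : Integrable φ) (ξ : ℝ) :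
    Integrable fun t => Real.sin (t * ξ) * φ t :=
  hφ.bdd_mul (c := 1) (Continuous.aestronglyMeasurable (by fun_prop))
    (Eventually.of_forall fun t => by simpa using Real.abs_sin_le_one _)

theorem fourierInt_eq {φ : ℝ → ℝ} (hφ : Integrable φ) (ξ : ℝ) :
    fourierInt φ ξ = (∫ t, Real.cos (t * ξ) * φ t : ℝ)
      + (∫ t, Real.sin (t * ξ) * φ t : ℝ) * Complex.I := by
  have h : ∀ t : ℝ, Complex.exp (ξ * t * Complex.I) * φ t
      = ((Real.cos (t * ξ) * φ t : ℝ) : ℂ) + ((Real.sin (t * ξ) * φ t : ℝ) : ℂ) * Complex.I := by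
    intro t
    rw [Complex.exp_mul_I]
    push_cast
    rw [mul_comm (ξ : ℂ)]
    ring
  simp only [fourierInt, h]
  rw [integral_add (integrable_cos_mul hφ ξ).ofReal ((integrable_sin_mul hφ ξ).ofReal.mul_const _),
    integral_mul_const, integral_complex_ofReal, integral_complex_ofReal]

theorem norm_sq_fourierInt {φ : ℝ → ℝ} (hφ : Integrable φ) (ξ : ℝ) :
    ‖fourierInt φ ξ‖ ^ 2 = (∫ t, Real.cos (t * ξ) * φ t) ^ 2 + (∫ t, Real.sin (t * ξ) * φ t) ^ 2 := by
  rw [fourierInt_eq hφ, ← Complex.normSq_eq_norm_sq, Complex.normSq_add_mul_I]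

/-- The terms `- 1` in the kernel, which make it integrable at low frequencies, disappear because
`φ` has mean zero. -/
theorem integral_specKernel_mul {φ : ℝ → ℝ} (hφ : Integrable φ) (h0 : ∫ t, φ t = 0) (ξ : ℝ) :
    ∫ z : ℝ × ℝ, specKernel z.1 z.2 ξ * (φ z.1 * φ z.2) = ‖fourierInt φ ξ‖ ^ 2 := by
  have hc : Integrable fun t => (Real.cos (t * ξ) - 1) * φ t := by
    simp only [sub_mul, one_mul]
    exact (integrable_cos_mul hφ ξ).sub hφ
  have hs := integrable_sin_mul hφ ξ
  have hc0 : ∫ t, (Real.cos (t * ξ) - 1) * φ t = ∫ t, Real.cos (t * ξ) * φ t := by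
    simp only [sub_mul, one_mul]
    rw [integral_sub (integrable_cos_mul hφ ξ) hφ, h0, sub_zero]
  have e : ∀ z : ℝ × ℝ, specKernel z.1 z.2 ξ * (φ z.1 * φ z.2)
      = ((Real.cos (z.1 * ξ) - 1) * φ z.1) * ((Real.cos (z.2 * ξ) - 1) * φ z.2)
        + (Real.sin (z.1 * ξ) * φ z.1) * (Real.sin (z.2 * ξ) * φ z.2) := by
    intro z; rw [specKernel]; ring
  simp only [e]
  have := integral_add (hc.mul_prod hc) (hs.mul_prod hs)
  rw [Measure.volume_eq_prod, this,
    integral_prod_mul (fun t => (Real.cos (t * ξ) - 1) * φ t)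
      (fun t => (Real.cos (t * ξ) - 1) * φ t),
    integral_prod_mul (fun t => Real.sin (t * ξ) * φ t) (fun t => Real.sin (t * ξ) * φ t), hc0,
    norm_sq_fourierInt hφ]
  ring

/-- The variance of the integral of fractional Brownian motion against a weight of mean zero is the
spectral integral of the squared Fourier transform. -/
theorem variance_eq_spectral {H : ℝ} (hH : H ∈ Set.Ioo (0 : ℝ) 1) {φ : ℝ → ℝ} (hφ : Integrable φ)
    (hφH : Integrable fun t => |t| ^ H * φ t) (h0 : ∫ t, φ t = 0) :
    IntegrableOn (fun ξ => ‖fourierInt φ ξ‖ ^ 2 * specWeight H ξ) (Set.Ioi 0) ∧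
      2 * specConst H * ∫ z : ℝ × ℝ, fbmCov H z.1 z.2 * (φ z.1 * φ z.2)
        = ∫ ξ in Set.Ioi (0 : ℝ), ‖fourierInt φ ξ‖ ^ 2 * specWeight H ξ := by
  have hm : AEStronglyMeasurable (fun z : ℝ × (ℝ × ℝ) =>
      (specKernel z.2.1 z.2.2 z.1 * specWeight H z.1) * (φ z.2.1 * φ z.2.2))
      ((volume.restrict (Set.Ioi (0 : ℝ))).prod (volume.prod volume)) := by
    refine AEStronglyMeasurable.mul ?_ (hφ.1.comp_fst.mul hφ.1.comp_snd).comp_snd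
    refine (Measurable.mul ?_ ((measurable_specWeight H).comp measurable_fst)).aestronglyMeasurable
    unfold specKernel
    fun_prop
  have hi : Integrable (fun z : ℝ × (ℝ × ℝ) =>
      (specKernel z.2.1 z.2.2 z.1 * specWeight H z.1) * (φ z.2.1 * φ z.2.2))
      ((volume.restrict (Set.Ioi (0 : ℝ))).prod (volume.prod volume)) := by
    rw [integrable_prod_iff' hm]
    refine ⟨Eventually.of_forall fun z =>
      (integral_specKernel hH z.1 z.2).1.mul_const (φ z.1 * φ z.2), ?_⟩
    refine Integrable.mono' ((hφH.norm.mul_prod hφH.norm).const_mul (2 * specConst H))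
      hm.norm.prod_swap.integral_prod_right' (Eventually.of_forall fun z => ?_)
    simp only [norm_mul _ (φ z.1 * φ z.2)]
    rw [integral_mul_const, norm_mul, norm_norm, Real.norm_eq_abs,
      abs_of_nonneg (integral_nonneg fun _ => norm_nonneg _), ← norm_weight, ← norm_weight,
      norm_mul]
    simp only [Real.norm_eq_abs]
    calc _ ≤ (2 * specConst H * (|z.1| ^ H * |z.2| ^ H)) * (|φ z.1| * |φ z.2|) :=
          mul_le_mul_of_nonneg_right (integral_abs_specKernel_le hH z.1 z.2) (by positivity)
      _ = _ := by ring
  have hin : ∀ ξ, ∫ z : ℝ × ℝ, (specKernel z.1 z.2 ξ * specWeight H ξ) * (φ z.1 * φ z.2)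
      = ‖fourierInt φ ξ‖ ^ 2 * specWeight H ξ := by
    intro ξ
    rw [← integral_specKernel_mul hφ h0, ← integral_mul_const]
    exact integral_congr_ae (Eventually.of_forall fun z => by ring)
  constructor
  · have := hi.integral_prod_left
    simp only [← Measure.volume_eq_prod, hin] at this
    exact this
  · have := integral_integral_swap (f := fun ξ (z : ℝ × ℝ) =>
      (specKernel z.1 z.2 ξ * specWeight H ξ) * (φ z.1 * φ z.2)) hi
    simp only [← Measure.volume_eq_prod, hin] at this
    rw [this, ← integral_const_mul]
    refine integral_congr_ae (Eventually.of_forall fun z => ?_)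
    simp only
    rw [integral_mul_const, (integral_specKernel hH z.1 z.2).2]
    ring

/-- An integrable function with vanishing Fourier integral vanishes almost everywhere: its positive
and negative parts are densities of finite measures with the same characteristic function. -/
theorem ae_eq_zero_of_fourierInt_eq_zero {φ : ℝ → ℝ} (hφ : Integrable φ)
    (h : ∀ ξ, fourierInt φ ξ = 0) : φ =ᵐ[volume] 0 := by
  have hp := hφ.pos_part
  have hn := hφ.neg_part
  have hfin : ∀ {f : ℝ → ℝ}, Integrable f → IsFiniteMeasure
      (volume.withDensity fun t => ENNReal.ofReal (f t)) := fun hf =>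
    isFiniteMeasure_withDensity_ofReal hf.2
  have := hfin hp
  have := hfin hn
  have hchar : ∀ {f : ℝ → ℝ}, Integrable f → (∀ t, 0 ≤ f t) → ∀ ξ,
      charFun (volume.withDensity fun t => ENNReal.ofReal (f t)) ξ = fourierInt f ξ := by
    intro f hf hf0 ξ
    rw [charFun_apply_real, integral_withDensity_eq_integral_toReal_smul₀
      hf.1.aemeasurable.ennreal_ofReal (Eventually.of_forall fun _ => ENNReal.ofReal_lt_top),
      fourierInt]
    refine integral_congr_ae (Eventually.of_forall fun t => ?_)
    simp only
    rw [ENNReal.toReal_ofReal (hf0 t), Complex.real_smul, mul_comm]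
  have heq : (volume.withDensity fun t => ENNReal.ofReal (max (φ t) 0))
      = volume.withDensity fun t => ENNReal.ofReal (max (-φ t) 0) := by
    refine Measure.ext_of_charFun (funext fun ξ => ?_)
    rw [hchar hp (fun t => le_max_right _ _), hchar hn (fun t => le_max_right _ _), ← sub_eq_zero,
      ← h ξ, fourierInt, fourierInt, fourierInt,
      ← integral_sub (integrable_exp_mul hp ξ) (integrable_exp_mul hn ξ)]
    refine integral_congr_ae (Eventually.of_forall fun t => ?_)
    simp only
    rw [← mul_sub, ← Complex.ofReal_sub]
    congr 2
    exact max_zero_sub_max_neg_zero_eq_self (φ t)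
  rw [withDensity_eq_iff hp.1.aemeasurable.ennreal_ofReal hn.1.aemeasurable.ennreal_ofReal
    (by have := measure_ne_top (volume.withDensity fun t => ENNReal.ofReal (max (φ t) 0)) Set.univ
        rwa [withDensity_apply _ MeasurableSet.univ, Measure.restrict_univ] at this)] at heq
  filter_upwards [heq] with t ht
  rw [ENNReal.ofReal_eq_ofReal_iff (le_max_right _ _) (le_max_right _ _)] at ht
  have := max_zero_sub_max_neg_zero_eq_self (φ t)
  rw [ht, sub_self] at this
  exact this.symm

/-- The spectral energy of a wavelet is positive. -/
theorem integral_spectral_pos {H : ℝ} (hH : H ∈ Set.Ioo (0 : ℝ) 1) {ψ : ℝ → ℝ}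
    (hψ : IsWavelet ψ H) :
    0 < ∫ ξ in Set.Ioi (0 : ℝ), ‖fourierInt ψ ξ‖ ^ 2 * specWeight H ξ := by
  have hi := (variance_eq_spectral hH hψ.integrable hψ.integrable_weight hψ.integral_eq_zero).1
  refine lt_of_le_of_ne ?_ fun h => hψ.ne_zero ?_
  · exact setIntegral_nonneg measurableSet_Ioi fun ξ hξ =>
      mul_nonneg (sq_nonneg _) (specWeight_pos H hξ).le
  · have hpos : ∀ ξ, 0 < ξ → fourierInt ψ ξ = 0 := by
      intro ξ hξ
      have := eq_zero_of_integral_specWeight_eq_zero (g := fun ξ => ‖fourierInt ψ ξ‖ ^ 2)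
        ((continuous_fourierInt hψ.integrable).norm.pow 2) (fun _ => sq_nonneg _) hi h.symm ξ hξ
      simpa using this
    refine ae_eq_zero_of_fourierInt_eq_zero hψ.integrable fun ξ => ?_
    rcases lt_trichotomy ξ 0 with h1 | h1 | h1
    · have h2 := hpos (-ξ) (by linarith)
      have h3 := norm_sq_fourierInt hψ.integrable (-ξ)
      simp only [mul_neg, Real.cos_neg, Real.sin_neg, neg_mul, integral_neg, neg_sq] at h3
      rw [← norm_sq_fourierInt hψ.integrable, h2] at h3
      simpa using h3.symm
    · rw [h1, fourierInt]
      simp only [Complex.ofReal_zero, zero_mul, Complex.exp_zero, one_mul]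
      rw [integral_complex_ofReal, hψ.integral_eq_zero, Complex.ofReal_zero]
    · exact hpos ξ h1

/-! ### Law of the wavelet coefficients -/

theorem integrable_ndwtAtom {ψ : ℝ → ℝ} (hψ : Integrable ψ) (j k : ℤ) :
    Integrable (ndwtAtom ψ j k) := by
  have hc : (2 : ℝ) ^ j ≠ 0 := (zpow_pos two_pos j).ne'
  exact ((hψ.comp_mul_left' hc).comp_sub_right (k : ℝ)).const_mul _

theorem integral_ndwtAtom {ψ : ℝ → ℝ} (h0 : ∫ t, ψ t = 0) (j k : ℤ) :
    ∫ t, ndwtAtom ψ j k t = 0 := by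
  simp only [ndwtAtom, integral_const_mul]
  rw [integral_sub_right_eq_self (fun t => ψ ((2 : ℝ) ^ j * t)), Measure.integral_comp_mul_left, h0]
  simp

/-- Translating the atom is harmless because `|t| ^ H` is subadditive for `H ≤ 1`. -/
theorem integrable_weight_ndwtAtom {H : ℝ} (hH : H ∈ Set.Ioo (0 : ℝ) 1) {ψ : ℝ → ℝ}
    (hψ : Integrable ψ) (hψH : Integrable fun t => |t| ^ H * ψ t) (j k : ℤ) :
    Integrable fun t => |t| ^ H * ndwtAtom ψ j k t := by
  have hc : (0 : ℝ) < (2 : ℝ) ^ j := zpow_pos two_pos j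
  set c : ℝ := (2 : ℝ) ^ j
  have hA := integrable_ndwtAtom hψ j k
  have h1 : Integrable fun t : ℝ => |c * (t - k)| ^ H * ψ (c * (t - k)) :=
    (hψH.comp_mul_left' hc.ne').comp_sub_right (k : ℝ)
  have h2 : Integrable fun t : ℝ => |t - k| ^ H * ndwtAtom ψ j k t := by
    refine (h1.const_mul ((c ^ H)⁻¹ * (2 : ℝ) ^ ((j : ℝ) / 2))).congr
      (Eventually.of_forall fun t => ?_)
    have : c ^ H ≠ 0 := (Real.rpow_pos_of_pos hc H).ne'
    simp only [ndwtAtom, abs_mul, abs_of_pos hc]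
    rw [Real.mul_rpow hc.le (abs_nonneg _)]
    field_simp
    rfl
  refine Integrable.mono' (h2.norm.add (hA.norm.const_mul (|(k : ℝ)| ^ H))) ?_
    (Eventually.of_forall fun t => ?_)
  · exact (Measurable.aestronglyMeasurable (by fun_prop)).mul hA.aestronglyMeasurable
  · have h3 : |t| ^ H ≤ |t - k| ^ H + |(k : ℝ)| ^ H :=
      calc |t| ^ H ≤ (|t - k| + |(k : ℝ)|) ^ H := by
            refine Real.rpow_le_rpow (abs_nonneg _) ?_ hH.1.le
            simpa using abs_add_le (t - k) (k : ℝ)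
        _ ≤ _ := Real.rpow_add_le_add_rpow (abs_nonneg _) (abs_nonneg _) hH.1.le hH.2.le
    simp only [Pi.add_apply, norm_mul, Real.norm_eq_abs, Real.abs_rpow_of_nonneg (abs_nonneg _),
      abs_abs]
    rw [← add_mul]
    gcongr

theorem fourierInt_ndwtAtom (ψ : ℝ → ℝ) (j k : ℤ) (ξ : ℝ) :
    fourierInt (ndwtAtom ψ j k) ξ = (((2 : ℝ) ^ j)⁻¹ * (2 : ℝ) ^ ((j : ℝ) / 2) : ℝ) *
      Complex.exp ((ξ * k : ℝ) * Complex.I) * fourierInt ψ (((2 : ℝ) ^ j)⁻¹ * ξ) := by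
  have hc : (0 : ℝ) < (2 : ℝ) ^ j := zpow_pos two_pos j
  set c : ℝ := (2 : ℝ) ^ j
  set r : ℝ := (2 : ℝ) ^ ((j : ℝ) / 2)
  let G : ℝ → ℂ := fun v => Complex.exp ((ξ * (c⁻¹ * v + k) : ℝ) * Complex.I) * (r * ψ v : ℝ)
  have h1 : fourierInt (ndwtAtom ψ j k) ξ = ∫ t : ℝ, G (c * (t - k)) := by
    rw [fourierInt]
    congr 1 with t
    simp only [G, inv_mul_cancel_left₀ hc.ne', sub_add_cancel, ndwtAtom]
    push_cast
    rfl
  rw [h1, integral_sub_right_eq_self (fun t => G (c * t)), Measure.integral_comp_mul_left,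
    fourierInt, abs_of_pos (inv_pos.2 hc), Complex.real_smul, Complex.ofReal_mul, mul_assoc,
    mul_assoc]
  congr 1
  rw [← integral_const_mul, ← integral_const_mul]
  congr 1 with v
  simp only [G]
  have : ((ξ * (c⁻¹ * v + k) : ℝ) : ℂ) * Complex.I
      = (ξ * k : ℝ) * Complex.I + (c⁻¹ * ξ : ℝ) * v * Complex.I := by
    push_cast; ring
  rw [this, Complex.exp_add]
  push_cast
  ring

theorem norm_sq_fourierInt_ndwtAtom (ψ : ℝ → ℝ) (j k : ℤ) (ξ : ℝ) :
    ‖fourierInt (ndwtAtom ψ j k) ξ‖ ^ 2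
      = ((2 : ℝ) ^ j)⁻¹ * ‖fourierInt ψ (((2 : ℝ) ^ j)⁻¹ * ξ)‖ ^ 2 := by
  have hc : (0 : ℝ) < (2 : ℝ) ^ j := zpow_pos two_pos j
  have hr : ((2 : ℝ) ^ ((j : ℝ) / 2)) ^ 2 = (2 : ℝ) ^ j := by
    rw [← Real.rpow_natCast, ← Real.rpow_mul two_pos.le, ← Real.rpow_intCast]
    congr 1; push_cast; ring
  rw [fourierInt_ndwtAtom, norm_mul, norm_mul, Complex.norm_exp_ofReal_mul_I, mul_one, mul_pow,
    Complex.norm_real, Real.norm_eq_abs, sq_abs, mul_pow, hr]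
  field_simp

/-- The variance of the wavelet coefficients at level `0`, as a spectral integral. -/
def waveletVariance (ψ : ℝ → ℝ) (H : ℝ) : ℝ :=
  (∫ ξ in Set.Ioi (0 : ℝ), ‖fourierInt ψ ξ‖ ^ 2 * specWeight H ξ) / (2 * specConst H)

theorem waveletVariance_pos {H : ℝ} (hH : H ∈ Set.Ioo (0 : ℝ) 1) {ψ : ℝ → ℝ}
    (hψ : IsWavelet ψ H) : 0 < waveletVariance ψ H :=
  div_pos (integral_spectral_pos hH hψ) (mul_pos two_pos (specConst_pos hH))

/-- Self-similarity in the spectral domain: dilating the wavelet by `2 ^ j` multiplies the spectral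
energy by the power `-(1 + 2 H)` of the dilation factor, and translations do not change it. -/
theorem integral_spectral_ndwtAtom (H : ℝ) (ψ : ℝ → ℝ) (j k : ℤ) :
    ∫ ξ in Set.Ioi (0 : ℝ), ‖fourierInt (ndwtAtom ψ j k) ξ‖ ^ 2 * specWeight H ξ
      = ((2 : ℝ) ^ j) ^ (-1 - 2 * H) *
        ∫ ξ in Set.Ioi (0 : ℝ), ‖fourierInt ψ ξ‖ ^ 2 * specWeight H ξ := by
  have hc : (0 : ℝ) < (2 : ℝ) ^ j := zpow_pos two_pos j
  set c : ℝ := (2 : ℝ) ^ j with hcdef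
  have h := integral_comp_mul_left_Ioi
    (fun ξ => ‖fourierInt ψ ξ‖ ^ 2 * (c⁻¹ * specWeight H (c * ξ))) 0 (inv_pos.2 hc)
  simp only [mul_zero, smul_eq_mul, inv_inv, mul_inv_cancel_left₀ hc.ne'] at h
  calc _ = ∫ ξ in Set.Ioi (0 : ℝ), ‖fourierInt ψ (c⁻¹ * ξ)‖ ^ 2 * (c⁻¹ * specWeight H ξ) := by
        congr 1 with ξ
        rw [norm_sq_fourierInt_ndwtAtom, ← hcdef]
        ring
    _ = _ := by
        rw [h, ← integral_const_mul, ← integral_const_mul]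
        refine setIntegral_congr_fun measurableSet_Ioi fun ξ hξ => ?_
        simp only [specWeight]
        rw [Real.mul_rpow hc.le (le_of_lt hξ)]
        field_simp

/-- Each wavelet coefficient of fractional Brownian motion is centred Gaussian, and its variance
depends on the level only, through a power law. -/
theorem map_ndwtCoeff {Ω : Type*} [MeasurableSpace Ω] {P : Measure Ω} [IsProbabilityMeasure P]
    {H : ℝ} (hH : H ∈ Set.Ioo (0 : ℝ) 1) {B : ℝ → Ω → ℝ} (hB : IsFractionalBrownianMotion B H P)
    {ψ : ℝ → ℝ} (hψ : IsWavelet ψ H) (j k : ℤ) :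
    P.map (ndwtCoeff ψ B j k)
      = gaussianReal 0 (Real.toNNReal (((2 : ℝ) ^ j) ^ (-1 - 2 * H) * waveletVariance ψ H)) := by
  have hi := integrable_ndwtAtom hψ.integrable j k
  have hw := integrable_weight_ndwtAtom hH hψ.integrable hψ.integrable_weight j k
  have h := (variance_eq_spectral hH hi hw (integral_ndwtAtom hψ.integral_eq_zero j k)).2
  rw [integral_spectral_ndwtAtom] at h
  have hC := specConst_pos hH
  have : (∫ z : ℝ × ℝ, fbmCov H z.1 z.2 * (ndwtAtom ψ j k z.1 * ndwtAtom ψ j k z.2))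
      = ((2 : ℝ) ^ j) ^ (-1 - 2 * H) * waveletVariance ψ H := by
    rw [waveletVariance, ← mul_div_assoc, ← h]
    field_simp
  rw [← this]
  exact map_integral_fbm hH hB hi hw

theorem log_level_variance {H V : ℝ} (hV : 0 < V) (j : ℤ) :
    Real.log (((2 : ℝ) ^ j) ^ (-1 - 2 * H) * V)
      = Real.log V - (2 * H + 1) * Real.log 2 * j := by
  have hc : (0 : ℝ) < (2 : ℝ) ^ j := zpow_pos two_pos j
  rw [Real.log_mul (Real.rpow_pos_of_pos hc _).ne' hV.ne', Real.log_rpow hc, Real.log_zpow]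
  ring

/-! ### Independent levels -/

/-- The blocks of a doubly indexed independent family are independent. -/
theorem iIndepFun_curry {Ω ι κ 𝓧 : Type*} [MeasurableSpace Ω] [MeasurableSpace 𝓧] {P : Measure Ω}
    [IsProbabilityMeasure P] {X : ι → κ → Ω → 𝓧} (hX : ∀ i k, Measurable (X i k))
    (h : iIndepFun (fun p : ι × κ => X p.1 p.2) P) : iIndepFun (fun i ω k => X i k ω) P := by
  have hprob : ∀ i k, IsProbabilityMeasure (P.map (X i k)) :=
    fun i k => Measure.isProbabilityMeasure_map (hX i k).aemeasurable
  have h2 : ∀ i, iIndepFun (X i) P := fun i =>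
    h.precomp (g := fun k => (i, k)) (Prod.mk_right_injective i)
  have h3 : iIndepFun (fun (p : (_ : ι) × κ) ω => X p.1 p.2 ω) P :=
    h.precomp (Equiv.sigmaEquivProd ι κ).injective
  have hc : (MeasurableEquiv.piCurry fun (_ : ι) (_ : κ) => 𝓧) ∘ (fun ω p => X p.1 p.2 ω)
      = fun ω i k => X i k ω := by
    ext; simp [Sigma.curry]
  rw [iIndepFun_iff_map_fun_eq_infinitePi_map (by fun_prop), ← hc,
    ← Measure.map_map (by fun_prop) (by fun_prop),
    (iIndepFun_iff_map_fun_eq_infinitePi_map (by fun_prop)).1 h3,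
    Measure.infinitePi_map_piCurry (fun i k => P.map (X i k))]
  congrm Measure.infinitePi fun i => ?_
  rw [(iIndepFun_iff_map_fun_eq_infinitePi_map (by fun_prop)).1 (h2 i)]

/-- The scaled median of the first `N` terms is a measurable function of the whole sequence. -/
theorem measurable_sampleMedian_prefix (μ : ℝ) (N : ℕ) :
    Measurable fun x : ℕ → ℝ => √(N : ℝ) * (sampleMedian (fun k : Fin N => x k) - μ) :=
  ((measurable_sampleMedian.comp (by fun_prop)).sub_const μ).const_mul _

theorem iIndepFun_scaledMedian {Ω ι : Type*} [MeasurableSpace Ω] {P : Measure Ω}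
    [IsProbabilityMeasure P] {X : ι → ℕ → Ω → ℝ} (hX : ∀ i k, Measurable (X i k))
    (h : iIndepFun (fun p : ι × ℕ => X p.1 p.2) P) (μ : ℝ) (N : ℕ) :
    iIndepFun (fun i => scaledMedian (X i) μ N) P :=
  (iIndepFun_curry hX h).comp _ fun _ => measurable_sampleMedian_prefix μ N

theorem identDistrib_scaledMedian {Ω : Type*} [MeasurableSpace Ω] {P : Measure Ω}
    {X Y : ℕ → Ω → ℝ} (hX : iIndepFun X P) (hY : iIndepFun Y P)
    (h : ∀ k, IdentDistrib (X k) (Y k) P P) (μ : ℝ) (N : ℕ) :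
    IdentDistrib (scaledMedian X μ N) (scaledMedian Y μ N) P P :=
  (IdentDistrib.pi h hX hY).comp (measurable_sampleMedian_prefix μ N)

section

variable {Ω : Type*} [MeasurableSpace Ω] {P : Measure Ω} [IsProbabilityMeasure P]

/-- Convergence of expectations for the median of a sample with the law of `log Z²`. -/
theorem logChi_scaledMedian_expectations {E : Type*} [NormedAddCommGroup E] [NormedSpace ℝ E]
    [CompleteSpace E] {X : ℕ → Ω → ℝ} (hX : ∀ k, Measurable (X k)) (hind : iIndepFun X P)
    (hG : ∀ k y, P.real {ω | y < X k ω} = logChiTail y)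
    {g g' : ℝ → E} (hg : ∀ x, HasDerivAt g (g' x) x) (hg' : Continuous g') {C : ℝ}
    (hC : ∀ x, ‖g' x‖ ≤ C * (1 + |x|)) :
    (∀ N : ℕ, 0 < N → Integrable (fun ω => g (scaledMedian X logChiMedian N ω)) P) ∧
      Tendsto (fun N : ℕ => ∫ ω, g (scaledMedian X logChiMedian N ω) ∂P) atTop
        (𝓝 (∫ x, g x ∂(gaussianReal 0 (Real.toNNReal medlA)))) := by
  obtain ⟨a, ha, hup, hlo⟩ := exists_logChiTail_bound
  have h := scaledMedian_expectations hX hind hG logChiTail_median logChiDensity_pos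
    hasDerivAt_logChiTail_median ha hup hlo hg hg' hC
  rwa [one_div_four_mul_logChiDensity_sq] at h

theorem medlA_pos : 0 < medlA := by
  have := abs_lt.1 abs_medlA_sub_lt
  linarith [this.1]

theorem logChi_memLp_scaledMedian {X : ℕ → Ω → ℝ} (hX : ∀ k, Measurable (X k))
    (hind : iIndepFun X P) (hG : ∀ k y, P.real {ω | y < X k ω} = logChiTail y)
    {N : ℕ} (hN : 0 < N) :
    MemLp (scaledMedian X logChiMedian N) 2 P := by
  refine (memLp_two_iff_integrable_sq (measurable_scaledMedian hX N).aestronglyMeasurable).2 ?_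
  refine (logChi_scaledMedian_expectations hX hind hG (g := fun x => x ^ 2) (g' := fun x => 2 * x)
    (C := 2) (fun x => by simpa using hasDerivAt_pow 2 x) (by fun_prop) fun x => ?_).1 N hN
  rw [norm_mul, Real.norm_eq_abs, Real.norm_eq_abs, abs_two]
  linarith

theorem logChi_tendsto_variance_scaledMedian {X : ℕ → Ω → ℝ} (hX : ∀ k, Measurable (X k))
    (hind : iIndepFun X P) (hG : ∀ k y, P.real {ω | y < X k ω} = logChiTail y) :
    Tendsto (fun N => Var[scaledMedian X logChiMedian N; P]) atTop (𝓝 medlA) := by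
  have h1 := (logChi_scaledMedian_expectations hX hind hG (g := fun x => x) (g' := fun _ => 1)
    (C := 1) (fun x => hasDerivAt_id x) (by fun_prop) fun x => by simp).2
  have h2 := (logChi_scaledMedian_expectations hX hind hG (g := fun x => x ^ 2)
    (g' := fun x => 2 * x) (C := 2) (fun x => by simpa using hasDerivAt_pow 2 x) (by fun_prop)
    fun x => by
      rw [norm_mul, Real.norm_eq_abs, Real.norm_eq_abs, abs_two]
      linarith).2
  have hv : ∫ x, x ^ 2 ∂(gaussianReal 0 (Real.toNNReal medlA)) = medlA := by
    have h3 : Var[fun x => x; gaussianReal 0 (Real.toNNReal medlA)] = _ :=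
      variance_fun_id_gaussianReal
    rw [variance_of_integral_eq_zero (by fun_prop) integral_id_gaussianReal,
      Real.coe_toNNReal _ medlA_pos.le] at h3
    exact h3
  rw [integral_id_gaussianReal] at h1
  rw [hv] at h2
  have h := h2.sub (h1.pow 2)
  rw [zero_pow two_ne_zero, sub_zero] at h
  refine h.congr' ?_
  filter_upwards [eventually_gt_atTop 0] with N hN
  rw [variance_eq_sub (logChi_memLp_scaledMedian hX hind hG hN)]
  rfl

theorem logChi_tendsto_charFun_scaledMedian {X : ℕ → Ω → ℝ} (hX : ∀ k, Measurable (X k))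
    (hind : iIndepFun X P) (hG : ∀ k y, P.real {ω | y < X k ω} = logChiTail y)
    (u : ℝ) :
    Tendsto (fun N => charFun (P.map (scaledMedian X logChiMedian N)) u) atTop
      (𝓝 (charFun (gaussianReal 0 (Real.toNNReal medlA)) u)) := by
  have h := (logChi_scaledMedian_expectations hX hind hG
    (g := fun x : ℝ => Complex.exp (u * x * Complex.I))
    (g' := fun x : ℝ => Complex.exp (u * x * Complex.I) * (u * Complex.I)) (C := |u|)
    (fun x => by
      have : HasDerivAt (fun x : ℝ => (u : ℂ) * x * Complex.I) (u * Complex.I) x := by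
        simpa using ((Complex.ofRealCLM.hasDerivAt (x := x)).const_mul (u : ℂ)).mul_const Complex.I
      exact this.cexp) (by fun_prop) fun x => by
        have : ‖Complex.exp (u * x * Complex.I)‖ = 1 := by
          rw [← Complex.ofReal_mul, Complex.norm_exp_ofReal_mul_I]
        rw [norm_mul, this, norm_mul, Complex.norm_I, Complex.norm_real, Real.norm_eq_abs]
        nlinarith [abs_nonneg u, abs_nonneg x, mul_nonneg (abs_nonneg u) (abs_nonneg x)]).2
  simp only [charFun_apply_real]
  refine h.congr fun N => ?_
  rw [integral_map (measurable_scaledMedian hX N).aemeasurable (by fun_prop)]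

end

/-! ### The regression estimator -/

/-- The weight with which the rescaled median of a level enters the estimator. -/
def medlWeight (m : ℕ) (i : Fin m) : ℝ := -(olsWeight m i) / (2 * Real.log 2)

theorem sum_medlWeight (m : ℕ) : ∑ i, medlWeight m i = 0 := by
  simp only [medlWeight]
  rw [← Finset.sum_div, Finset.sum_neg_distrib, sum_olsWeight, neg_zero, zero_div]

/-- The asymptotic variance of the estimator in terms of that of one median. -/
theorem sum_medlWeight_sq_mul {m : ℕ} (hm : 2 ≤ m) (A : ℝ) :
    ∑ i, medlWeight m i ^ 2 * A = 3 * A / (m * ((m : ℝ) ^ 2 - 1) * Real.log 2 ^ 2) := by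
  have h2 : Real.log 2 ≠ 0 := (Real.log_pos one_lt_two).ne'
  have hp := (levels_norm_pos hm).ne'
  have : ∀ i : Fin m, medlWeight m i ^ 2 * A = A / (4 * Real.log 2 ^ 2) * olsWeight m i ^ 2 := by
    intro i
    rw [medlWeight]
    field_simp
    ring
  simp only [this]
  rw [← Finset.mul_sum, sum_olsWeight_sq hm]
  field_simp
  ring

section

variable {Ω : Type*} [MeasurableSpace Ω] {P : Measure Ω} [IsProbabilityMeasure P]

/-- The rescaled estimation error, as a linear combination of the rescaled level-wise medians of a
standardized log-chi-square sample. -/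
def medlError {m : ℕ} (W : Fin m → ℕ → Ω → ℝ) (N : ℕ) (ω : Ω) : ℝ :=
  ∑ i, medlWeight m i * scaledMedian (W i) logChiMedian N ω

theorem memLp_medlError {m : ℕ} {W : Fin m → ℕ → Ω → ℝ} (hW : ∀ i k, Measurable (W i k))
    (hind : iIndepFun (fun p : Fin m × ℕ => W p.1 p.2) P)
    (hG : ∀ i k y, P.real {ω | y < W i k ω} = logChiTail y) {N : ℕ} (hN : 0 < N) :
    MemLp (medlError W N) 2 P :=
  memLp_finsetSum _ fun i _ => (logChi_memLp_scaledMedian (hW i)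
    (hind.precomp (g := fun k => (i, k)) (Prod.mk_right_injective i)) (hG i) hN).const_mul _

/-- The level-wise medians have a common mean, which cancels because the weights sum to zero. -/
theorem integral_medlError {m : ℕ} {W : Fin m → ℕ → Ω → ℝ} (hW : ∀ i k, Measurable (W i k))
    (hind : iIndepFun (fun p : Fin m × ℕ => W p.1 p.2) P)
    (hG : ∀ i k y, P.real {ω | y < W i k ω} = logChiTail y) {N : ℕ} (hN : 0 < N) :
    ∫ ω, medlError W N ω ∂P = 0 := by
  have hi : ∀ i, iIndepFun (W i) P := fun i =>
    hind.precomp (g := fun k => (i, k)) (Prod.mk_right_injective i)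
  have hid : ∀ i j k, IdentDistrib (W i k) (W j k) P P := by
    intro i j k
    refine ⟨(hW i k).aemeasurable, (hW j k).aemeasurable, ?_⟩
    have := Measure.isProbabilityMeasure_map (μ := P) (hW i k).aemeasurable
    have := Measure.isProbabilityMeasure_map (μ := P) (hW j k).aemeasurable
    refine Measure.ext_of_Iic _ _ fun y => ?_
    rw [← Set.compl_Ioi, prob_compl_eq_one_sub measurableSet_Ioi,
      prob_compl_eq_one_sub measurableSet_Ioi]
    congr 1
    rw [Measure.map_apply (hW i k) measurableSet_Ioi, Measure.map_apply (hW j k) measurableSet_Ioi]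
    exact (measureReal_eq_measureReal_iff).1 ((hG i k y).trans (hG j k y).symm)
  have hc : ∃ e : ℝ, ∀ i, ∫ ω, scaledMedian (W i) logChiMedian N ω ∂P = e := by
    rcases isEmpty_or_nonempty (Fin m) with h | ⟨⟨j⟩⟩
    · exact ⟨0, fun i => h.elim i⟩
    · exact ⟨_, fun i => (identDistrib_scaledMedian (hi i) (hi j) (hid i j) _ N).integral_eq⟩
  obtain ⟨e, he⟩ := hc
  simp only [medlError]
  rw [integral_finsetSum _ fun i _ => ((logChi_memLp_scaledMedian (hW i) (hi i) (hG i) hN).integrable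
    one_le_two).const_mul _]
  simp only [integral_const_mul, he]
  rw [← Finset.sum_mul, sum_medlWeight, zero_mul]

theorem tendsto_variance_medlError {m : ℕ} (hm : 2 ≤ m) {W : Fin m → ℕ → Ω → ℝ}
    (hW : ∀ i k, Measurable (W i k)) (hind : iIndepFun (fun p : Fin m × ℕ => W p.1 p.2) P)
    (hG : ∀ i k y, P.real {ω | y < W i k ω} = logChiTail y) :
    Tendsto (fun N => Var[medlError W N; P]) atTop
      (𝓝 (3 * medlA / (m * ((m : ℝ) ^ 2 - 1) * Real.log 2 ^ 2))) := by
  have hi : ∀ i, iIndepFun (W i) P := fun i =>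
    hind.precomp (g := fun k => (i, k)) (Prod.mk_right_injective i)
  have h : Tendsto (fun N => ∑ i, medlWeight m i ^ 2 * Var[scaledMedian (W i) logChiMedian N; P])
      atTop (𝓝 (∑ i, medlWeight m i ^ 2 * medlA)) :=
    tendsto_finsetSum _ fun i _ =>
      (logChi_tendsto_variance_scaledMedian (hW i) (hi i) (hG i)).const_mul _
  rw [sum_medlWeight_sq_mul hm] at h
  refine h.congr' ?_
  filter_upwards [eventually_gt_atTop 0] with N hN
  have hmem : ∀ i, MemLp (fun ω => medlWeight m i * scaledMedian (W i) logChiMedian N ω) 2 P :=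
    fun i => (logChi_memLp_scaledMedian (hW i) (hi i) (hG i) hN).const_mul _
  have hs := (iIndepFun_scaledMedian hW hind logChiMedian N).comp
    (fun i x => medlWeight m i * x) (fun i => by fun_prop)
  have hsum : medlError W N
      = ∑ i, fun ω => medlWeight m i * scaledMedian (W i) logChiMedian N ω := by
    ext ω
    simp [medlError]
  rw [hsum, IndepFun.variance_sum (fun i _ => hmem i) fun i _ j _ hij => hs.indepFun hij]
  simp only [variance_const_mul]

theorem tendsto_charFun_medlError {m : ℕ} (hm : 2 ≤ m) {W : Fin m → ℕ → Ω → ℝ}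
    (hW : ∀ i k, Measurable (W i k)) (hind : iIndepFun (fun p : Fin m × ℕ => W p.1 p.2) P)
    (hG : ∀ i k y, P.real {ω | y < W i k ω} = logChiTail y) (u : ℝ) :
    Tendsto (fun N => charFun (P.map (medlError W N)) u) atTop (𝓝 (charFun (gaussianReal 0
      (Real.toNNReal (3 * medlA / (m * ((m : ℝ) ^ 2 - 1) * Real.log 2 ^ 2)))) u)) := by
  have hi : ∀ i, iIndepFun (W i) P := fun i =>
    hind.precomp (g := fun k => (i, k)) (Prod.mk_right_injective i)
  have h : Tendsto
      (fun N => ∏ i, charFun (P.map (scaledMedian (W i) logChiMedian N)) (medlWeight m i * u))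
      atTop (𝓝 (∏ i : Fin m, charFun (gaussianReal 0 (Real.toNNReal medlA)) (medlWeight m i * u))) :=
    tendsto_finsetProd _ fun i _ => logChi_tendsto_charFun_scaledMedian (hW i) (hi i) (hG i) _
  have hlim : ∏ i : Fin m, charFun (gaussianReal 0 (Real.toNNReal medlA)) (medlWeight m i * u)
      = charFun (gaussianReal 0
        (Real.toNNReal (3 * medlA / (m * ((m : ℝ) ^ 2 - 1) * Real.log 2 ^ 2)))) u := by
    have hpos : 0 ≤ ∑ i, medlWeight m i ^ 2 * medlA :=
      Finset.sum_nonneg fun i _ => mul_nonneg (sq_nonneg _) medlA_pos.le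
    rw [← sum_medlWeight_sq_mul hm]
    simp only [charFun_gaussianReal]
    rw [← Complex.exp_sum, Real.coe_toNNReal _ hpos, Real.coe_toNNReal _ medlA_pos.le]
    congr 1
    push_cast
    simp only [mul_zero, zero_mul, zero_sub]
    rw [Finset.sum_mul, Finset.sum_div, ← Finset.sum_neg_distrib]
    exact Finset.sum_congr rfl fun i _ => by ring
  rw [← hlim]
  refine h.congr fun N => ?_
  have hmeas : ∀ i, AEMeasurable (scaledMedian (W i) logChiMedian N) P :=
    fun i => (measurable_scaledMedian (hW i) N).aemeasurable
  have hs := (iIndepFun_scaledMedian hW hind logChiMedian N).comp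
    (fun i x => medlWeight m i * x) (fun i => by fun_prop)
  have h1 := congrFun (hs.charFun_map_fun_sum_eq_prod fun i =>
    (hmeas i).const_mul (medlWeight m i)) u
  rw [Finset.prod_apply] at h1
  refine Eq.symm (h1.trans (Finset.prod_congr rfl fun i _ => ?_))
  exact charFun_map_mul_comp (hmeas i) _ _

end

/-! ### Standardization of the coefficients -/

theorem map_log_sq_standardized {Ω : Type*} [MeasurableSpace Ω] {P : Measure Ω}
    {X : Ω → ℝ} (hX : Measurable X) {V : ℝ} (hV : 0 < V)
    (h : P.map X = gaussianReal 0 (Real.toNNReal V)) (y : ℝ) :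
    P.real {ω | y < Real.log ((X ω / √V) ^ 2)} = logChiTail y := by
  have hstd : P.map (fun ω => X ω / √V) = gaussianReal 0 1 := by
    have : (fun ω => X ω / √V) = (fun x => x / √V) ∘ X := rfl
    rw [this, ← Measure.map_map (by fun_prop) hX, h, gaussianReal_map_div_const, zero_div]
    congr 1
    ext
    simp [Real.sq_sqrt hV.le, hV.le, hV.ne']
  rw [← gaussianReal_std_log_sq, ← hstd, map_measureReal_apply (by fun_prop)
    (measurableSet_lt measurable_const (by fun_prop))]
  rfl

theorem ae_ne_zero_of_map_gaussianReal {Ω : Type*} [MeasurableSpace Ω] {P : Measure Ω}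
    {X : Ω → ℝ} (hX : Measurable X) {V : ℝ} (hV : 0 < V)
    (h : P.map X = gaussianReal 0 (Real.toNNReal V)) : ∀ᵐ ω ∂P, X ω ≠ 0 := by
  have hv : Real.toNNReal V ≠ 0 := (Real.toNNReal_pos.2 hV).ne'
  have := nullSingletonClass_gaussianReal (μ := 0) hv
  have h0 : ∀ᵐ x ∂(P.map X), x ≠ 0 := by
    rw [h]
    exact compl_mem_ae_iff.2 (measure_singleton (0 : ℝ))
  exact ae_of_ae_map hX.aemeasurable h0

theorem log_sq_eq_standardized {x V : ℝ} (hx : x ≠ 0) (hV : 0 < V) :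
    Real.log (x ^ 2) = Real.log ((x / √V) ^ 2) + Real.log V := by
  rw [div_pow, Real.sq_sqrt hV.le, Real.log_div (pow_ne_zero 2 hx) hV.ne', sub_add_cancel]

/-- Almost surely, the rescaled estimation error is the regression of the rescaled medians of an
independent standardized log-chi-square array. -/
theorem exists_medlError_eq {Ω Ω' : Type*} [MeasurableSpace Ω] [MeasurableSpace Ω']
    {P : Measure Ω} [IsProbabilityMeasure P] {P' : Measure Ω'} [IsProbabilityMeasure P']
    {H : ℝ} (hH : H ∈ Set.Ioo (0 : ℝ) 1) {B : ℝ → Ω' → ℝ} (hB : IsFractionalBrownianMotion B H P')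
    {ψ : ℝ → ℝ} (hψ : IsWavelet ψ H) (j₀ : ℤ) {m : ℕ} (hm : 2 ≤ m) {d : Fin m → ℕ → Ω → ℝ}
    (hd_law : ∀ (i : Fin m) (k : ℕ),
      IdentDistrib (d i k) (ndwtCoeff ψ B (j₀ + (i : ℕ)) k) P P')
    (hd_indep : iIndepFun (fun p : Fin m × ℕ => d p.1 p.2) P) :
    ∃ W : Fin m → ℕ → Ω → ℝ, (∀ i k, Measurable (W i k)) ∧
      iIndepFun (fun p : Fin m × ℕ => W p.1 p.2) P ∧
      (∀ i k y, P.real {ω | y < W i k ω} = logChiTail y) ∧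
      ∀ᵐ ω ∂P, ∀ N : ℕ,
        √(N : ℝ) * (medlEstimator j₀ N (fun i k => d i k ω) - H) = medlError W N ω := by
  -- the coefficients are only almost everywhere measurable, so they are replaced by versions
  choose D hDm hDd using fun i k => (hd_law i k).aemeasurable_fst
  obtain ⟨V, hVdef⟩ : ∃ V : Fin m → ℝ, ∀ i, V i
      = ((2 : ℝ) ^ (j₀ + (i : ℕ) : ℤ)) ^ (-1 - 2 * H) * waveletVariance ψ H := ⟨_, fun _ => rfl⟩
  have hV : ∀ i, 0 < V i := fun i => by
    rw [hVdef]
    exact mul_pos (Real.rpow_pos_of_pos (zpow_pos two_pos _) _) (waveletVariance_pos hH hψ)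
  have hlaw : ∀ i k, P.map (D i k) = gaussianReal 0 (Real.toNNReal (V i)) := fun i k => by
    rw [← Measure.map_congr (hDd i k), (hd_law i k).map_eq, hVdef]
    exact map_ndwtCoeff hH hB hψ _ _
  have hDind : iIndepFun (fun p : Fin m × ℕ => D p.1 p.2) P :=
    hd_indep.congr fun p => hDd p.1 p.2
  have hWind := hDind.comp (fun p x => Real.log ((x / √(V p.1)) ^ 2)) fun p => by fun_prop
  refine ⟨fun i k ω => Real.log ((D i k ω / √(V i)) ^ 2), fun i k => by fun_prop, hWind,
    fun i k y => map_log_sq_standardized (hDm i k) (hV i) (hlaw i k) y, ?_⟩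
  have hae : ∀ᵐ ω ∂P, ∀ i k, d i k ω = D i k ω ∧ D i k ω ≠ 0 :=
    ae_all_iff.2 fun i => ae_all_iff.2 fun k =>
      (hDd i k).and (ae_ne_zero_of_map_gaussianReal (hDm i k) (hV i) (hlaw i k))
  filter_upwards [hae] with ω hω N
  rcases Nat.eq_zero_or_pos N with rfl | hN
  -- for the empty sample both sides vanish, being multiples of `√0`
  · simp [medlError, scaledMedian]
  have hlog : ∀ (i : Fin m) (k : Fin N), Real.log (d i k ω ^ 2)
      = Real.log ((D i k ω / √(V i)) ^ 2) + (Real.log (waveletVariance ψ H)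
        - (2 * H + 1) * Real.log 2 * j₀ - (2 * H + 1) * Real.log 2 * (i : ℕ)) := by
    intro i k
    rw [(hω i k).1, log_sq_eq_standardized (hω i k).2 (hV i), hVdef,
      log_level_variance (waveletVariance_pos hH hψ)]
    push_cast
    ring
  rw [medlEstimator_eq hm j₀ H _ _ _ logChiMedian hN hlog, Finset.mul_sum]
  refine Finset.sum_congr rfl fun i _ => ?_
  rw [medlWeight, scaledMedian]
  ring

end

theorem mainTheorem3
    {Ω Ω' : Type*} [MeasurableSpace Ω] [MeasurableSpace Ω']
    (P : Measure Ω) [IsProbabilityMeasure P] (P' : Measure Ω') [IsProbabilityMeasure P']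
    (H : ℝ) (hH : H ∈ Set.Ioo (0 : ℝ) 1)
    (B : ℝ → Ω' → ℝ) (hB : IsFractionalBrownianMotion B H P')
    (ψ : ℝ → ℝ) (hψ : IsWavelet ψ H)
    (j₀ : ℤ) (m : ℕ) (hm : 2 ≤ m)
    (d : Fin m → ℕ → Ω → ℝ)
    (hd_law : ∀ (i : Fin m) (k : ℕ),
      IdentDistrib (d i k) (ndwtCoeff ψ B (j₀ + (i : ℕ)) k) P P')
    (hd_indep : iIndepFun (fun p : Fin m × ℕ => d p.1 p.2) P) :
    (∀ N : ℕ, 1 ≤ N →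
      MemLp (fun ω => medlEstimator j₀ N fun i k => d i k ω) 2 P ∧
      ∫ ω, medlEstimator j₀ N (fun i k => d i k ω) ∂P = H) ∧
    Tendsto (fun N : ℕ => N * Var[fun ω => medlEstimator j₀ N fun i k => d i k ω; P]) atTop
      (𝓝 (3 * medlA / (m * ((m : ℝ) ^ 2 - 1) * Real.log 2 ^ 2))) ∧
    TendstoInDistribution
      (fun (N : ℕ) ω => √(N : ℝ) * (medlEstimator j₀ N (fun i k => d i k ω) - H)) atTop
      (id : ℝ → ℝ) (fun _ => P)
      (gaussianReal 0 (Real.toNNReal (3 * medlA / (m * ((m : ℝ) ^ 2 - 1) * Real.log 2 ^ 2)))) ∧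
    |medlA - 5.4418| < 0.00005 := by
  obtain ⟨W, hW, hind, hG, hae⟩ := exists_medlError_eq hH hB hψ j₀ hm hd_law hd_indep
  have hest : ∀ N : ℕ, 1 ≤ N → (fun ω => medlEstimator j₀ N fun i k => d i k ω)
      =ᵐ[P] fun ω => (√(N : ℝ))⁻¹ * medlError W N ω + H := by
    intro N hN
    have hs : √(N : ℝ) ≠ 0 := Real.sqrt_ne_zero'.2 (by exact_mod_cast hN)
    filter_upwards [hae] with ω hω
    rw [← hω N, inv_mul_cancel_left₀ hs, sub_add_cancel]
  have hmeas : ∀ N, Measurable (medlError W N) := fun N =>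
    Finset.measurable_fun_sum _ fun i _ => (measurable_scaledMedian (hW i) N).const_mul _
  refine ⟨fun N hN => ?_, ?_, ?_, abs_medlA_sub_lt⟩
  · have hL := memLp_medlError hW hind hG hN
    refine ⟨((hL.const_mul (√(N : ℝ))⁻¹).add (memLp_const H)).ae_eq (hest N hN).symm, ?_⟩
    rw [integral_congr_ae (hest N hN), integral_add ((hL.integrable one_le_two).const_mul _)
      (integrable_const H), integral_const_mul, integral_medlError hW hind hG hN]
    simp
  · refine (tendsto_variance_medlError hm hW hind hG).congr' ?_
    filter_upwards [eventually_ge_atTop 1] with N hN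
    have hN' : (N : ℝ) ≠ 0 := by exact_mod_cast (Nat.one_le_iff_ne_zero.1 hN)
    rw [variance_congr (hest N hN), variance_add_const
      ((hmeas N).const_mul _).aestronglyMeasurable, variance_const_mul, inv_pow,
      Real.sq_sqrt (Nat.cast_nonneg N), mul_inv_cancel_left₀ hN']
  · refine TendstoInDistribution.congr (X := medlError W) (Z := id)
      (fun N => ?_) (ae_eq_refl _) ⟨fun N => (hmeas N).aemeasurable, aemeasurable_id, ?_⟩
    · filter_upwards [hae] with ω hω using (hω N).symm
    · refine ProbabilityMeasure.tendsto_iff_tendsto_charFun.2 fun u => ?_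
      have h := tendsto_charFun_medlError hm hW hind hG u
      simpa only [ProbabilityMeasure.coe_mk, Measure.map_id] using h
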